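/- A hypermap is a triple $(X,R,L)$, where $X$ is a finite set of darts and $R,L$ are permutations of $X$ generating a group that acts transitively on $X$. Its vertices, hyperedges and faces are the orbits of $R$, of $L$ and of $RL$ ($L$ followed by $R$), and the degree of a vertex is the number of darts in it. The case $X=\emptyset$ is allowed: the empty hypermap has, by convention, one vertex (of degree $0$), one face and no hyperedges. The genus $g$ of a hypermap with $t$ darts, $v$ vertices, $e$ hyperedges and $f$ faces is defined by $v+e+f=t+2(1-g)$. A sequenced rooted hypermap is either the empty hypermap or a non-empty hypermap with a distinguished dart (the root), together with a (possibly empty) sequence of pairwise distinct vertices, all different from the vertex containing the root (the root vertex); these are the distinguished vertices, with labels $1,2,\ldots$. (The empty hypermap has no distinguished vertices.) An isomorphism of sequenced rooted hypermaps is a bijection of the darts that preserves $R$, $L$, the root and the sequence of distinguished vertices; sequenced rooted hypermaps are considered up to isomorphism. For integers $g,t,f,e,n$ and a list $D=(d_1,\ldots,d_{|D|})$ of integers let $\mathcal{H}(g,t,f,e,n,D)$ be the set of sequenced rooted hypermaps of genus $g$ with $t$ darts, $f$ faces and $e$ hyperedges, with root vertex of degree $n$ and such that $D$ is the list of degrees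 of the distinguished vertices, in the order of their labels. **Theorem (Bijective decomposition for sequenced hypermaps).** Suppose that $d_j\ge 1$ for all $j$, and that $n\ge 1$ or $t=0$. Then there is a bijection between $\mathcal{H}(g,t,f,e,n,D)$ and the disjoint union $$ \begin{aligned} &\sum_{\substack{g_1+g_2=g,\ t_1+t_2=t-1\\ f_1+e_2=e,\ f_2+e_1=f\\ n_1+n_2=n-1,\ D_1\subseteq D}} \mathcal{H}(g_1,t_1,f_1,e_1,n_1,D_1)\times\mathcal{H}(g_2,t_2,f_2,e_2,n_2,D-D_1)\\ &\quad+\sum_{p=1}^{n-2}\mathcal{H}(g-1,t-1,e,f,n-1-p,p.D)\times\{1,\ldots,p\}\\ &\quad+\sum_{p=n}^{t-1}\mathcal{H}(g,t-1,e,f,p,D)\\ &\quad+\sum_{j=1}^{|D|}\mathcal{H}(g,t-1,e,f,d_j+n-1,D-\{d_j\})\;+\;\Delta_{(g,t,f,e,n,D)=(0,0,1,0,0,[\,])}. \end{aligned} $$ Here $+$ and $\sum$ denote disjoint unions (a union over an empty range being empty); $g_i,t_i,f_i,e_i,n_i$ range over the non-negative integers; $D_1$ ranges over the sublists of $D$,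 counted with multiplicity (one for each set of positions in $D$), and $D-D_1$ is the complementary sublist; $p.D$ is the list $D$ with $p$ prepended; $D-\{d_j\}$ is $D$ with its $j$-th element removed; and $\Delta_\varphi$ is the set containing only the empty hypermap if $\varphi$ is true, and the empty set otherwise. -/

import Mathlib

/-- The set of orbits of the permutation `σ`, each orbit being a set of points
(fixed points give one-element orbits). -/
def permOrbits {α : Type} (σ : Equiv.Perm α) : Set (Set α) :=
  Set.range fun a => {b | σ.SameCycle a b}

/-- A (combinatorial, hence orientable) hypermap: a finite set of darts with two permutations
`R` and `L` generating a group that acts transitively on the darts.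
The empty set of darts is allowed and gives the empty hypermap. -/
structure Hypermap where
  Dart : Type
  finite_dart : Finite Dart
  R : Equiv.Perm Dart
  L : Equiv.Perm Dart
  transitive : ∀ a b : Dart, ∃ σ ∈ Subgroup.closure {R, L}, σ a = b

namespace Hypermap

/-- The vertices of a hypermap are the orbits of `R`. -/
def vertices (h : Hypermap) : Set (Set h.Dart) := permOrbits h.R

/-- The hyperedges of a hypermap are the orbits of `L`. -/
def hyperedges (h : Hypermap) : Set (Set h.Dart) := permOrbits h.L

/-- The faces of a hypermap are the orbits of `L` followed by `R`. -/
def faces (h : Hypermap) : Set (Set h.Dart) := permOrbits (h.R * h.L)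

noncomputable def numDarts (h : Hypermap) : ℕ := Nat.card h.Dart

open Classical in
/-- The number of vertices; by convention the empty hypermap has one vertex. -/
noncomputable def numVertices (h : Hypermap) : ℕ :=
  if IsEmpty h.Dart then 1 else h.vertices.ncard

/-- The number of hyperedges; it is `0` for the empty hypermap. -/
noncomputable def numHyperedges (h : Hypermap) : ℕ := h.hyperedges.ncard

open Classical in
/-- The number of faces; by convention the empty hypermap has one face. -/
noncomputable def numFaces (h : Hypermap) : ℕ :=
  if IsEmpty h.Dart then 1 else h.faces.ncard

/-- `g` is the genus of the hypermap: `v + e + f = t + 2 (1 - g)`. -/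
def HasGenus (h : Hypermap) (g : ℤ) : Prop :=
  (h.numVertices : ℤ) + h.numHyperedges + h.numFaces = h.numDarts + 2 * (1 - g)

end Hypermap

/-- A sequenced rooted hypermap: a hypermap that is empty or has a distinguished root dart,
together with a sequence of pairwise distinct vertices other than the root vertex (the
distinguished vertices, in the order of their labels `1, 2, …, k`). -/
structure SequencedHypermap extends Hypermap where
  root : Option Dart
  root_eq_none : root = none → IsEmpty Dart
  marked : List (Set Dart)
  marked_nodup : marked.Nodup
  marked_vertex : ∀ s ∈ marked, s ∈ toHypermap.vertices
  root_not_marked : ∀ s ∈ marked, ∀ x ∈ root, x ∉ s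

namespace SequencedHypermap

/-- The set of darts of the root vertex (no darts, for the empty hypermap). -/
def rootVertex (h : SequencedHypermap) : Set h.Dart :=
  {b | ∃ x ∈ h.root, h.R.SameCycle x b}

/-- Isomorphism of sequenced hypermaps: a bijection between the darts that takes `R` to `R`,
`L` to `L`, the root to the root and the `i`-th distinguished vertex to the `i`-th
distinguished vertex. -/
def Iso (h k : SequencedHypermap) : Prop :=
  ∃ φ : h.Dart ≃ k.Dart,
    (∀ a, φ (h.R a) = k.R (φ a)) ∧ (∀ a, φ (h.L a) = k.L (φ a)) ∧
    k.root = h.root.map φ ∧ k.marked = h.marked.map (fun s => φ '' s)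

theorem Iso.refl (h : SequencedHypermap) : Iso h h :=
  ⟨Equiv.refl _, by simp⟩

theorem Iso.symm {h k : SequencedHypermap} : Iso h k → Iso k h := by
  rintro ⟨φ, hR, hL, hr, hm⟩
  refine ⟨φ.symm, fun a => ?_, fun a => ?_, ?_, ?_⟩
  · rw [Equiv.symm_apply_eq, hR, Equiv.apply_symm_apply]
  · rw [Equiv.symm_apply_eq, hL, Equiv.apply_symm_apply]
  · rw [hr, Option.map_map]; simp
  · rw [hm, List.map_map]
    simp [Function.comp_def]

theorem Iso.trans {h k l : SequencedHypermap} : Iso h k → Iso k l → Iso h l := by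
  rintro ⟨φ, hR, hL, hr, hm⟩ ⟨ψ, hR', hL', hr', hm'⟩
  refine ⟨φ.trans ψ, fun a => ?_, fun a => ?_, ?_, ?_⟩
  · simp [hR, hR']
  · simp [hL, hL']
  · rw [hr', hr, Option.map_map]; rfl
  · rw [hm', hm, List.map_map]
    simp [Function.comp_def, Set.image_image]

instance isoSetoid : Setoid SequencedHypermap :=
  ⟨Iso, Iso.refl, Iso.symm, Iso.trans⟩

/-- The empty sequenced hypermap. -/
def empty : SequencedHypermap where
  Dart := Empty
  finite_dart := inferInstance
  R := 1
  L := 1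
  transitive := fun a => a.elim
  root := none
  root_eq_none := fun _ => inferInstance
  marked := []
  marked_nodup := List.nodup_nil
  marked_vertex := by simp
  root_not_marked := by simp

/-- The hypermap has genus `g`, `t` darts, `f` faces, `e` hyperedges, a root vertex of degree `n`,
and `D` as the list of the degrees of its distinguished vertices. -/
def HasParams (h : SequencedHypermap) (g t f e n : ℤ) (D : List ℤ) : Prop :=
  h.HasGenus g ∧ (h.numDarts : ℤ) = t ∧ (h.numFaces : ℤ) = f ∧ (h.numHyperedges : ℤ) = e ∧
    (h.rootVertex.ncard : ℤ) = n ∧ h.marked.map (fun s => (s.ncard : ℤ)) = D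

end SequencedHypermap

/-- Sequenced hypermaps up to isomorphism. -/
def SequencedHypermapClass : Type 1 := Quotient SequencedHypermap.isoSetoid

/-- The set `ℋ(g,t,f,e,n,D)` of (isomorphism classes of) sequenced rooted hypermaps with the
given parameters. -/
def seqHypermaps (g t f e n : ℤ) (D : List ℤ) : Set SequencedHypermapClass :=
  Quotient.mk SequencedHypermap.isoSetoid '' {h | h.HasParams g t f e n D}

/-- `Δ_φ`: the set containing only the empty hypermap if `φ` holds, and the empty set if not. -/
def deltaSet (φ : Prop) : Set SequencedHypermapClass :=
  {c | φ ∧ c = Quotient.mk SequencedHypermap.isoSetoid SequencedHypermap.empty}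

/-- The sublist of `D` consisting of the entries at the positions in `S`. Sublists of `D` are
counted with multiplicity, that is, by their sets of positions. -/
def sublistAt (D : List ℤ) (S : Finset (Fin D.length)) : List ℤ :=
  ((List.finRange D.length).filter (fun i => i ∈ S)).map D.get

/-- The index set of the first sum of the decomposition; `S` is the set of positions of
the sublist `D₁` of `D`. -/
@[ext]
structure SplitIndex (g t f e n : ℤ) (D : List ℤ) where
  (g₁ g₂ t₁ t₂ f₁ f₂ e₁ e₂ n₁ n₂ : ℕ)
  S : Finset (Fin D.length)
  hg : (g₁ : ℤ) + g₂ = g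
  ht : (t₁ : ℤ) + t₂ = t - 1
  he : (f₁ : ℤ) + e₂ = e
  hf : (f₂ : ℤ) + e₁ = f
  hn : (n₁ : ℤ) + n₂ = n - 1

/-- First term: pairs of sequenced hypermaps. -/
def SplitTerm (g t f e n : ℤ) (D : List ℤ) : Type 1 :=
  Σ i : SplitIndex g t f e n D,
    seqHypermaps i.g₁ i.t₁ i.f₁ i.e₁ i.n₁ (sublistAt D i.S) ×
      seqHypermaps i.g₂ i.t₂ i.f₂ i.e₂ i.n₂ (sublistAt D i.Sᶜ)

/-- Second term: the sum over `1 ≤ p ≤ n - 2` of `ℋ(g-1,t-1,e,f,n-1-p,p.D) × {1,…,p}`. -/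
def HandleTerm (g t f e n : ℤ) (D : List ℤ) : Type 1 :=
  Σ p : Set.Icc (1 : ℤ) (n - 2),
    seqHypermaps (g - 1) (t - 1) e f (n - 1 - p) (p :: D) × Set.Icc (1 : ℤ) p

/-- Third term: the sum over `n ≤ p ≤ t - 1` of `ℋ(g,t-1,e,f,p,D)`. -/
def LinkTerm (g t f e n : ℤ) (D : List ℤ) : Type 1 :=
  Σ p : Set.Icc n (t - 1), seqHypermaps g (t - 1) e f p D

/-- Fourth term: the sum over the positions `j` in `D` of `ℋ(g,t-1,e,f,d_j+n-1,D-{d_j})`. -/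
def MarkedLinkTerm (g t f e n : ℤ) (D : List ℤ) : Type 1 :=
  Σ j : Fin D.length, seqHypermaps g (t - 1) e f (D.get j + n - 1) (D.eraseIdx j)

open Equiv

/-! A hypermap is determined by its hyperedge permutation `L` and its face permutation `F = R * L`,
since `R = F * L⁻¹`. Delete the root `r` from its cycles in both. What is left is an `Extension`:
two permutations of the other darts and the places `u = L r`, `w = F r`, where `none` means that `r`
was a fixed point. Nothing is lost (`exists_iso_toSeq`, `toSeq_iso_iff`), and transitivity becomes
the condition that every component of the base contains `u` or `w`, so that there are at most two
components. If `ρ` is the ratio of the two remaining permutations, the original `R` is `ρ`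
multiplied by two swaps that involve `r` (`extendPerm_mul_inv`). A non-trivial swap cuts one cycle
into two or merges two cycles into one, and this governs the vertices, their degrees and the genus.

If the component of `u` does not contain `w` (either place may be `none`), the base is a pair of
possibly empty hypermaps rooted at `u` and `w`, whose root vertices together with `r` form the root
vertex: the first term. The hypermap at `u` is read with hyperedges and faces exchanged, which
inverts its `R` and explains the crossed indices.

Otherwise the base, again with hyperedges and faces exchanged, is a single hypermap `k` rooted at
`u`, with a chosen dart `w`. If `w` lies in the root vertex of `k`, that vertex is cut into the new
root vertex and a vertex through `u`; the latter is unmarked (third term) or marked (fourth term).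
Here `w` is `R⁻ⁿ` applied to the root of `k`, so the degree `n` determines it. If `w` lies in
another vertex, that vertex is merged with the root vertex and the genus goes up by one; putting it
at the head of the marked list of `k` leaves `p` choices of `w`, where `p` is its degree: the second
term.

`exists_decomposition` shows that these cases exhaust all extensions, the lemmas `split_iso_iff`,
`handle_iso_iff`, `link_iso_iff` and `markedLink_iso_iff` that isomorphic results come from
isomorphic data, and the invariant `kind` that the terms do not overlap. Each term is tied to the
isomorphism classes by a relation rather than a function, so that representatives can be varied
freely; the relations are then shown to be total and one-to-one. -/

namespace HypermapDecomposition

/-! ### Orbits and invariant sets of a permutation. -/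

section Orbits
variable {α β : Type}

/-- The orbit of a point under a permutation. -/
def orb (σ : Perm α) (a : α) : Set α := {b | σ.SameCycle a b}

/-- A set is invariant under a permutation if it is a union of orbits. -/
def Invariant (σ : Perm α) (s : Set α) : Prop := ∀ a, σ a ∈ s ↔ a ∈ s

theorem mem_orb_self (σ : Perm α) (a : α) : a ∈ orb σ a := Perm.SameCycle.refl σ a

theorem mem_orb {σ : Perm α} {a b : α} : b ∈ orb σ a ↔ σ.SameCycle a b := Iff.rfl

theorem orb_mem_permOrbits (σ : Perm α) (a : α) : orb σ a ∈ permOrbits σ := ⟨a, rfl⟩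

theorem orb_eq_of_mem {σ : Perm α} {a b : α} (h : b ∈ orb σ a) : orb σ b = orb σ a := by
  ext c
  exact ⟨fun hc => h.trans hc, fun hc => (Perm.SameCycle.symm h).trans hc⟩

theorem eq_orb {σ : Perm α} {a : α} {s : Set α} (hs : s ∈ permOrbits σ) (ha : a ∈ s) :
    s = orb σ a := by
  obtain ⟨b, rfl⟩ := hs
  exact (orb_eq_of_mem ha).symm

theorem nonempty_of_mem_permOrbits {σ : Perm α} {s : Set α} (hs : s ∈ permOrbits σ) :
    s.Nonempty := by
  obtain ⟨a, rfl⟩ := hs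
  exact ⟨a, mem_orb_self σ a⟩

theorem Invariant.inv {σ : Perm α} {s : Set α} (h : Invariant σ s) : Invariant σ⁻¹ s := by
  intro a
  rw [← h (σ⁻¹ a)]
  simp

theorem invariant_inv {σ : Perm α} {s : Set α} : Invariant σ⁻¹ s ↔ Invariant σ s :=
  ⟨fun h => by simpa using h.inv, Invariant.inv⟩

theorem Invariant.mul {σ τ : Perm α} {s : Set α} (h : Invariant σ s) (h' : Invariant τ s) :
    Invariant (σ * τ) s := by
  intro a
  rw [Perm.mul_apply, h, h']

theorem Invariant.compl {σ : Perm α} {s : Set α} (h : Invariant σ s) : Invariant σ sᶜ :=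
  fun a => not_congr (h a)

theorem Invariant.union {σ : Perm α} {s t : Set α} (h : Invariant σ s) (h' : Invariant σ t) :
    Invariant σ (s ∪ t) := fun a => or_congr (h a) (h' a)

theorem invariant_orb (σ : Perm α) (a : α) : Invariant σ (orb σ a) := fun _ =>
  Perm.sameCycle_apply_right

theorem Invariant.zpow {σ : Perm α} {s : Set α} (h : Invariant σ s) (i : ℤ) :
    Invariant (σ ^ i) s := by
  induction i with
  | zero => intro a; simp
  | succ n ih => rw [zpow_add_one]; exact ih.mul h
  | pred n ih => rw [zpow_sub_one]; exact ih.mul h.inv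

theorem Invariant.mem_iff {σ : Perm α} {s : Set α} (h : Invariant σ s) {a b : α}
    (hab : σ.SameCycle a b) : a ∈ s ↔ b ∈ s := by
  obtain ⟨i, rfl⟩ := hab
  exact (h.zpow i a).symm

theorem Invariant.orb_subset {σ : Perm α} {s : Set α} (h : Invariant σ s) {a : α} (ha : a ∈ s) :
    orb σ a ⊆ s := fun _ hb => (h.mem_iff hb).1 ha

theorem invariant_of_mem_permOrbits {σ : Perm α} {s : Set α} (hs : s ∈ permOrbits σ) :
    Invariant σ s := by
  obtain ⟨a, rfl⟩ := hs
  exact invariant_orb σ a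

/-- The right-hand side mentions `σ` only through its invariant sets, so orbits can be compared
between permutations that have the same invariant subsets of `s`. -/
theorem mem_permOrbits_iff {σ : Perm α} {s : Set α} :
    s ∈ permOrbits σ ↔
      s.Nonempty ∧ Invariant σ s ∧ ∀ t ⊆ s, t.Nonempty → Invariant σ t → t = s := by
  constructor
  · intro hs
    refine ⟨nonempty_of_mem_permOrbits hs, invariant_of_mem_permOrbits hs, ?_⟩
    rintro t hts ⟨a, ha⟩ ht
    refine hts.antisymm ?_
    rw [eq_orb hs (hts ha)]
    exact ht.orb_subset ha
  · rintro ⟨⟨a, ha⟩, hs, hmin⟩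
    exact ⟨a, hmin _ (hs.orb_subset ha) ⟨a, mem_orb_self σ a⟩ (invariant_orb σ a)⟩

theorem permOrbits_inv (σ : Perm α) : permOrbits σ⁻¹ = permOrbits σ := by
  ext s
  simp only [mem_permOrbits_iff, invariant_inv]

theorem orb_inv (σ : Perm α) (a : α) : orb σ⁻¹ a = orb σ a := by
  ext b
  exact Perm.sameCycle_inv

theorem invariant_image_iff {σ : Perm α} {τ : Perm β} (e : α ≃ β) (h : ∀ a, e (σ a) = τ (e a))
    {s : Set α} : Invariant τ (e '' s) ↔ Invariant σ s := by
  constructor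
  · intro H a
    have := H (e a)
    rwa [← h, e.injective.mem_set_image, e.injective.mem_set_image] at this
  · intro H b
    obtain ⟨a, rfl⟩ := e.surjective b
    rw [← h, e.injective.mem_set_image, e.injective.mem_set_image]
    exact H a

theorem sameCycle_equiv {σ : Perm α} {τ : Perm β} (e : α ≃ β) (h : ∀ a, e (σ a) = τ (e a))
    (a b : α) : τ.SameCycle (e a) (e b) ↔ σ.SameCycle a b := by
  have hτ : τ = e.symm.trans (σ.trans e) := by
    ext b
    simp [h]
  constructor
  · intro H
    have := ((invariant_image_iff e h).2 (invariant_orb σ a)).mem_iff H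
    rw [← mem_orb, ← e.injective.mem_set_image]
    exact this.1 (Set.mem_image_of_mem e (mem_orb_self σ a))
  · intro H
    have h' : ∀ b, e.symm (τ b) = σ (e.symm b) := by
      intro b
      rw [Equiv.symm_apply_eq, h, Equiv.apply_symm_apply]
    have := ((invariant_image_iff e.symm h').2 (invariant_orb τ (e a))).mem_iff H
    have h2 := this.1 ⟨e a, mem_orb_self τ (e a), by simp⟩
    obtain ⟨c, hc, rfl⟩ := h2
    rw [mem_orb] at hc
    simpa using hc

theorem image_orb {σ : Perm α} {τ : Perm β} (e : α ≃ β) (h : ∀ a, e (σ a) = τ (e a)) (a : α) :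
    e '' orb σ a = orb τ (e a) := by
  ext b
  obtain ⟨b, rfl⟩ := e.surjective b
  rw [e.injective.mem_set_image, mem_orb, mem_orb, sameCycle_equiv e h]

theorem permOrbits_equiv {σ : Perm α} {τ : Perm β} (e : α ≃ β) (h : ∀ a, e (σ a) = τ (e a)) :
    permOrbits τ = (fun s => e '' s) '' permOrbits σ := by
  ext s
  constructor
  · rintro ⟨b, rfl⟩
    obtain ⟨a, rfl⟩ := e.surjective b
    exact ⟨_, orb_mem_permOrbits σ a, image_orb e h a⟩
  · rintro ⟨_, ⟨a, rfl⟩, rfl⟩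
    exact ⟨e a, (image_orb e h a).symm⟩

/-- The number of orbits of a permutation. -/
noncomputable def numOrbits (σ : Perm α) : ℕ := (permOrbits σ).ncard

theorem numOrbits_equiv {σ : Perm α} {τ : Perm β} (e : α ≃ β) (h : ∀ a, e (σ a) = τ (e a)) :
    numOrbits τ = numOrbits σ := by
  rw [numOrbits, permOrbits_equiv e h]
  exact Set.ncard_image_of_injective _ (Set.image_injective.2 e.injective)

theorem numOrbits_inv (σ : Perm α) : numOrbits σ⁻¹ = numOrbits σ := by
  rw [numOrbits, permOrbits_inv, numOrbits]

theorem numOrbits_of_isEmpty [IsEmpty α] (σ : Perm α) : numOrbits σ = 0 := by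
  have : permOrbits σ = ∅ := by
    ext s
    simp only [Set.mem_empty_iff_false, iff_false]
    rintro ⟨a, -⟩
    exact isEmptyElim a
  rw [numOrbits, this, Set.ncard_empty]

end Orbits

/-! ### Multiplication by a transposition: cutting and merging cycles. -/

section Swap
variable {α : Type} [DecidableEq α]

theorem Invariant.swap_iff {a b : α} {s : Set α} : Invariant (swap a b) s ↔ (a ∈ s ↔ b ∈ s) := by
  constructor
  · intro h
    simpa using (h a).symm
  · intro h c
    by_cases hca : c = a
    · subst hca; simp [h]
    by_cases hcb : c = b
    · subst hcb; simp [h]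
    rw [swap_apply_of_ne_of_ne hca hcb]

theorem invariant_swap_mul {σ : Perm α} {a b : α} {s : Set α} (h : a ∈ s ↔ b ∈ s) :
    Invariant (swap a b * σ) s ↔ Invariant σ s := by
  refine ⟨fun H => ?_, fun H => (Invariant.swap_iff.2 h).mul H⟩
  simpa using (Invariant.swap_iff.2 h).mul H

theorem mem_permOrbits_swap_mul {σ : Perm α} {a b : α} {s : Set α} (ha : a ∉ s) (hb : b ∉ s) :
    s ∈ permOrbits (swap a b * σ) ↔ s ∈ permOrbits σ := by
  rw [mem_permOrbits_iff, mem_permOrbits_iff, invariant_swap_mul (by tauto)]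
  refine and_congr_right fun _ => and_congr_right fun _ => forall_congr' fun t =>
    forall_congr' fun hts => ?_
  rw [invariant_swap_mul (iff_of_false (fun h => ha (hts h)) (fun h => hb (hts h)))]

/-- The union on the right contains both `a` and `b`, hence is also invariant under the product.
This gives one inclusion for every permutation, and its application to `swap a b * σ` gives the
other. -/
theorem orb_union_swap_mul (σ : Perm α) (a b : α) :
    orb (swap a b * σ) a ∪ orb (swap a b * σ) b = orb σ a ∪ orb σ b := by
  have key : ∀ τ : Perm α, orb (swap a b * τ) a ∪ orb (swap a b * τ) b ⊆ orb τ a ∪ orb τ b := by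
    intro τ
    have hi : Invariant (swap a b * τ) (orb τ a ∪ orb τ b) :=
      (invariant_swap_mul (iff_of_true (Set.mem_union_left _ (mem_orb_self τ a))
        (Set.mem_union_right _ (mem_orb_self τ b)))).2
        ((invariant_orb τ a).union (invariant_orb τ b))
    exact Set.union_subset (hi.orb_subset (Or.inl (mem_orb_self τ a)))
      (hi.orb_subset (Or.inr (mem_orb_self τ b)))
  refine (key σ).antisymm ?_
  have := key (swap a b * σ)
  rwa [swap_mul_self_mul] at this

/-- Follow `a` under `σ` up to the first time `n > 0` at which it reaches `a` or `b`. Before time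
`n` the two permutations move `a` in the same way; at time `n` the swap exchanges the two outcomes.
So one of them closes its cycle without meeting `b`, and the other arrives at `b`. -/
theorem sameCycle_swap_mul [Finite α] (σ : Perm α) {a b : α} (hab : a ≠ b) :
    (swap a b * σ).SameCycle a b ↔ ¬ σ.SameCycle a b := by
  have hex : ∃ n, 0 < n ∧ ((σ ^ n) a = a ∨ (σ ^ n) a = b) :=
    ⟨orderOf σ, orderOf_pos σ, by simp [pow_orderOf_eq_one]⟩
  classical
  obtain ⟨hn0, hn⟩ := Nat.find_spec hex
  have hmin : ∀ i, 0 < i → i < Nat.find hex → (σ ^ i) a ≠ a ∧ (σ ^ i) a ≠ b := by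
    intro i hi hlt
    have := Nat.find_min hex hlt
    tauto
  set n := Nat.find hex with hndef
  clear_value n
  have hiter : ∀ i, i < n → ((swap a b * σ) ^ i) a = (σ ^ i) a := by
    intro i
    induction i with
    | zero => simp
    | succ i ih =>
      intro hi
      rw [pow_succ', Perm.mul_apply, ih (by omega), Perm.mul_apply, ← Perm.mul_apply σ, ← pow_succ',
        swap_apply_of_ne_of_ne (hmin _ (by omega) hi).1 (hmin _ (by omega) hi).2]
  have hlast : ((swap a b * σ) ^ n) a = swap a b ((σ ^ n) a) := by
    obtain ⟨m, rfl⟩ : ∃ m, n = m + 1 := ⟨n - 1, by omega⟩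
    rw [pow_succ', Perm.mul_apply, hiter m (by omega), Perm.mul_apply, ← Perm.mul_apply σ,
      ← pow_succ']
  have hperiod : ∀ (τ : Perm α), (τ ^ n) a = a → (∀ i, i < n → (τ ^ i) a ≠ b) →
      ¬ τ.SameCycle a b := by
    intro τ hτ hne h
    obtain ⟨j, hj⟩ := h.exists_nat_pow_eq
    apply hne (j % n) (Nat.mod_lt _ hn0)
    rw [← hj]
    conv_rhs => rw [← Nat.mod_add_div j n, pow_add, Perm.mul_apply, pow_mul]
    congr 1
    exact (Function.IsFixedPt.perm_pow hτ _).symm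
  have hne : ∀ i, i < n → (σ ^ i) a ≠ b := by
    intro i hi
    rcases Nat.eq_zero_or_pos i with rfl | h0
    · simpa using hab
    · exact (hmin i h0 hi).2
  rcases hn with h | h
  · refine iff_of_true ⟨n, ?_⟩ (hperiod σ h hne)
    rw [zpow_natCast, hlast, h, swap_apply_left]
  · refine iff_of_false (hperiod _ ?_ fun i hi => ?_) (not_not.2 ⟨n, by rw [zpow_natCast, h]⟩)
    · rw [hlast, h, swap_apply_right]
    · rw [hiter i hi]
      exact hne i hi

theorem numOrbits_swap_mul_of_sameCycle [Finite α] {σ : Perm α} {a b : α} (hab : a ≠ b)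
    (h : σ.SameCycle a b) : numOrbits (swap a b * σ) = numOrbits σ + 1 := by
  set τ := swap a b * σ with hτ
  have hnot : ¬ τ.SameCycle a b := by rw [sameCycle_swap_mul σ hab]; exact not_not.2 h
  -- The orbits that avoid `a` and `b` are common to `σ` and `τ`, so only the one or two orbits
  -- through `a` and `b` have to be compared.
  have key : ∀ ρ : Perm α, permOrbits ρ =
      insert (orb ρ a) (insert (orb ρ b) {s ∈ permOrbits ρ | a ∉ s ∧ b ∉ s}) := by
    intro ρ
    ext s
    simp only [Set.mem_insert_iff, Set.mem_ofPred_eq]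
    constructor
    · intro hs
      by_cases ha : a ∈ s
      · exact Or.inl (eq_orb hs ha)
      by_cases hb : b ∈ s
      · exact Or.inr (Or.inl (eq_orb hs hb))
      exact Or.inr (Or.inr ⟨hs, ha, hb⟩)
    · rintro (rfl | rfl | hs)
      · exact orb_mem_permOrbits ρ a
      · exact orb_mem_permOrbits ρ b
      · exact hs.1
  have hsame : {s ∈ permOrbits τ | a ∉ s ∧ b ∉ s} = {s ∈ permOrbits σ | a ∉ s ∧ b ∉ s} := by
    ext s
    simp only [Set.mem_ofPred_eq]
    constructor
    · rintro ⟨h1, h2, h3⟩; exact ⟨(mem_permOrbits_swap_mul h2 h3).1 h1, h2, h3⟩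
    · rintro ⟨h1, h2, h3⟩; exact ⟨(mem_permOrbits_swap_mul h2 h3).2 h1, h2, h3⟩
  have hσ : orb σ b = orb σ a := orb_eq_of_mem h
  rw [numOrbits, numOrbits, key τ, key σ, hsame, hσ, Set.insert_eq_of_mem (Set.mem_insert _ _),
    Set.ncard_insert_of_notMem _ (Set.toFinite _), Set.ncard_insert_of_notMem _ (Set.toFinite _),
    Set.ncard_insert_of_notMem _ (Set.toFinite _)]
  · exact fun H => H.2.1 (mem_orb_self σ a)
  · exact fun H => H.2.2 (mem_orb_self τ b)
  · rintro (H | H)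
    · exact hnot (by rw [← mem_orb, H]; exact mem_orb_self τ b)
    · exact H.2.1 (mem_orb_self τ a)

theorem numOrbits_swap_mul_of_not_sameCycle [Finite α] {σ : Perm α} {a b : α}
    (h : ¬ σ.SameCycle a b) : numOrbits (swap a b * σ) + 1 = numOrbits σ := by
  have hab : a ≠ b := by rintro rfl; exact h (Perm.SameCycle.refl σ a)
  have := numOrbits_swap_mul_of_sameCycle hab ((sameCycle_swap_mul σ hab).2 h)
  rwa [swap_mul_self_mul, eq_comm] at this

theorem orb_swap_mul_of_not_sameCycle [Finite α] {σ : Perm α} {a b : α}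
    (h : ¬ σ.SameCycle a b) : orb (swap a b * σ) a = orb σ a ∪ orb σ b := by
  have hab : a ≠ b := by rintro rfl; exact h (Perm.SameCycle.refl σ a)
  have := (sameCycle_swap_mul σ hab).2 h
  rw [← orb_union_swap_mul, orb_eq_of_mem (mem_orb.2 this), Set.union_self]

end Swap

/-! ### Inserting a new point into permutations and into their ratio. -/

section Extend
open Classical
variable {α β : Type}

theorem mem_permOrbits_mul_swap [DecidableEq α] {σ : Perm α} {a b : α} {s : Set α} (ha : a ∉ s)
    (hb : b ∉ s) : s ∈ permOrbits (σ * swap a b) ↔ s ∈ permOrbits σ := by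
  rw [← permOrbits_inv, mul_inv_rev, swap_inv, mem_permOrbits_swap_mul ha hb, permOrbits_inv]

theorem invariant_optionCongr {σ : Perm α} {s : Set (Option α)} :
    Invariant (optionCongr σ) s ↔ Invariant σ (some ⁻¹' s) := by
  constructor
  · intro h a
    simpa using h (some a)
  · rintro h (_ | a)
    · simp
    · simpa using h a

theorem preimage_some_image (s : Set α) : some ⁻¹' (some '' s) = s :=
  Set.preimage_image_eq s (Option.some_injective α)

theorem none_notMem_image (s : Set α) : none ∉ some '' s := by simp

theorem image_some_preimage {S : Set (Option α)} (h : none ∉ S) : some '' (some ⁻¹' S) = S := by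
  ext (_ | a) <;> simp [h]

theorem image_some_mem_permOrbits {σ : Perm α} {s : Set α} :
    some '' s ∈ permOrbits (optionCongr σ) ↔ s ∈ permOrbits σ := by
  rw [mem_permOrbits_iff, mem_permOrbits_iff, invariant_optionCongr, preimage_some_image,
    Set.image_nonempty]
  refine and_congr_right fun _ => and_congr_right fun _ => ⟨fun h t hts ht hi => ?_,
    fun h t hts ht hi => ?_⟩
  · have := h (some '' t) (Set.image_mono hts) (ht.image _)
      (invariant_optionCongr.2 (by rwa [preimage_some_image]))
    exact (Option.some_injective α).image_injective this
  · have hn : none ∉ t := fun H => none_notMem_image s (hts H)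
    rw [← image_some_preimage hn] at hts ht ⊢
    rw [h _ ((Set.image_subset_image_iff (Option.some_injective α)).1 hts) (Set.image_nonempty.1 ht)
      (invariant_optionCongr.1 hi)]

theorem orb_optionCongr_none (σ : Perm α) : orb (optionCongr σ) none = {none} := by
  refine Set.Subset.antisymm (Invariant.orb_subset (invariant_optionCongr.2 ?_) rfl)
    (Set.singleton_subset_iff.2 (mem_orb_self _ _))
  intro a
  simp

theorem orb_optionCongr_some (σ : Perm α) (a : α) :
    orb (optionCongr σ) (some a) = some '' orb σ a :=
  (eq_orb (image_some_mem_permOrbits.2 (orb_mem_permOrbits σ a))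
    (Set.mem_image_of_mem _ (mem_orb_self σ a))).symm

theorem numOrbits_optionCongr [Finite α] (σ : Perm α) :
    numOrbits (optionCongr σ) = numOrbits σ + 1 := by
  have : permOrbits (optionCongr σ) = insert {none} ((fun s => some '' s) '' permOrbits σ) := by
    ext S
    simp only [Set.mem_insert_iff, Set.mem_image]
    constructor
    · rintro ⟨_ | a, rfl⟩
      · exact Or.inl (orb_optionCongr_none σ)
      · exact Or.inr ⟨_, orb_mem_permOrbits σ a, (orb_optionCongr_some σ a).symm⟩
    · rintro (rfl | ⟨s, hs, rfl⟩)
      · exact ⟨none, orb_optionCongr_none σ⟩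
      · exact image_some_mem_permOrbits.2 hs
  rw [numOrbits, this, Set.ncard_insert_of_notMem _ (Set.toFinite _), numOrbits,
    Set.ncard_image_of_injective _ (Option.some_injective α).image_injective]
  rintro ⟨s, -, hs⟩
  exact none_notMem_image s (by rw [show some '' s = _ from hs]; rfl)

/-- The permutation of `Option α` that sends `none` to `u` and gives `σ` when `none` is
removed from its cycle. -/
noncomputable def extendPerm (u : Option α) (σ : Perm α) : Perm (Option α) :=
  swap none u * optionCongr σ

theorem extendPerm_none (u : Option α) (σ : Perm α) : extendPerm u σ none = u := by
  simp [extendPerm]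

theorem exists_eq_extendPerm (τ : Perm (Option α)) : ∃ u σ, τ = extendPerm u σ := by
  refine ⟨τ none, removeNone τ, ?_⟩
  rw [extendPerm, map_equiv_removeNone]
  convert (swap_mul_self_mul none (τ none) τ).symm

/-- Conjugation by `optionCongr e` turns `swap none u` into `swap none (u.map e)`. Evaluation at
`none` yields the place, and then the swaps cancel. -/
theorem optionCongr_extendPerm (e : α ≃ β) {u : Option α} {v : Option β} {σ : Perm α}
    {τ : Perm β} :
    (∀ x, optionCongr e (extendPerm u σ x) = extendPerm v τ (optionCongr e x)) ↔
      v = u.map e ∧ ∀ a, e (σ a) = τ (e a) := by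
  have key : ∀ x, optionCongr e (extendPerm u σ x) =
      swap none (u.map e) (optionCongr e (optionCongr σ x)) := by
    intro x
    rw [extendPerm, Perm.mul_apply, (optionCongr e).injective.map_swap]
    simp only [optionCongr_apply, Option.map_none]
  constructor
  · intro h
    have hv : v = u.map e := by
      have := h none
      rw [extendPerm_none] at this
      simpa [extendPerm_none] using this.symm
    subst hv
    refine ⟨rfl, fun a => ?_⟩
    have := h (some a)
    rw [key, extendPerm, Perm.mul_apply] at this
    have h2 := (swap none (Option.map e u)).injective (this.trans (by congr))
    simpa using h2
  · rintro ⟨rfl, h⟩ x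
    rw [key, extendPerm, Perm.mul_apply]
    have : optionCongr e (optionCongr σ x) = optionCongr τ (optionCongr e x) := by
      cases x <;> simp [h]
    rw [this]

theorem invariant_extendPerm {u : Option α} {σ : Perm α} {s : Set (Option α)} :
    Invariant (extendPerm u σ) s ↔ (none ∈ s ↔ u ∈ s) ∧ Invariant σ (some ⁻¹' s) := by
  constructor
  · intro h
    have h1 : none ∈ s ↔ u ∈ s := by
      rw [← h none, extendPerm_none]
    exact ⟨h1, invariant_optionCongr.1 ((invariant_swap_mul h1).1 h)⟩
  · rintro ⟨h1, h2⟩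
    exact (invariant_swap_mul h1).2 (invariant_optionCongr.2 h2)

theorem not_sameCycle_optionCongr_none (σ : Perm α) (a : α) :
    ¬ Perm.SameCycle (optionCongr σ) none (some a) := by
  rw [← mem_orb, orb_optionCongr_none]
  simp

theorem numOrbits_extendPerm_none [Finite α] (σ : Perm α) :
    numOrbits (extendPerm none σ) = numOrbits σ + 1 := by
  rw [extendPerm, swap_self]
  exact numOrbits_optionCongr σ

theorem numOrbits_extendPerm_some [Finite α] (a : α) (σ : Perm α) :
    numOrbits (extendPerm (some a) σ) = numOrbits σ := by
  have := numOrbits_swap_mul_of_not_sameCycle (not_sameCycle_optionCongr_none σ a)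
  rw [numOrbits_optionCongr] at this
  exact Nat.succ_injective this

theorem orb_extendPerm_none [Finite α] (u : Option α) (σ : Perm α) :
    orb (extendPerm u σ) none = insert none (some '' {b | ∃ a ∈ u, σ.SameCycle a b}) := by
  cases u with
  | none =>
    rw [extendPerm, swap_self]
    refine (orb_optionCongr_none σ).trans ?_
    simp
  | some a =>
    rw [extendPerm, orb_swap_mul_of_not_sameCycle (not_sameCycle_optionCongr_none σ a),
      orb_optionCongr_none, orb_optionCongr_some, Set.singleton_union]
    simp [orb]

/-- The permutation of `Option α` obtained from `extendPerm w σ * (extendPerm u τ)⁻¹`, where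
`ρ = σ * τ⁻¹`. -/
noncomputable def vertexPerm (u w : Option α) (ρ : Perm α) : Perm (Option α) :=
  swap none w * (optionCongr ρ * swap none u)

/-- With `σ` and `τ` the face and hyperedge permutations, the left-hand side is the vertex
permutation after the insertion of the root; it depends on them only through their ratio. -/
theorem extendPerm_mul_inv (u w : Option α) (σ τ : Perm α) :
    extendPerm w σ * (extendPerm u τ)⁻¹ = vertexPerm u w (σ * τ⁻¹) := by
  have : (optionCongr τ : Perm (Option α))⁻¹ = optionCongr τ⁻¹ := (optionCongr_symm τ).symm
  have h2 : optionCongr (σ * τ⁻¹) = optionCongr σ * optionCongr τ⁻¹ := by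
    ext (_ | a) <;> simp
  rw [extendPerm, extendPerm, vertexPerm, mul_inv_rev, this, swap_inv, h2]
  simp only [mul_assoc]

/-- Moving `swap none u` across `ρ` inserts `none` between `u` and `ρ u` (or as a fixed point). Only
the multiplication by `swap none w` remains, and the results on transpositions apply to it. -/
theorem vertexPerm_eq (u w : Option α) (ρ : Perm α) :
    vertexPerm u w ρ = swap none w * extendPerm (u.map ρ) ρ := by
  rw [vertexPerm, extendPerm, mul_swap_eq_swap_mul]
  simp

theorem vertexPerm_apply_left (u w : Option α) (ρ : Perm α) : vertexPerm u w ρ u = w := by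
  simp [vertexPerm]

theorem image_some_mem_permOrbits_vertexPerm {u w : Option α} {ρ : Perm α} {s : Set α}
    (hu : u ∉ some '' s) (hw : w ∉ some '' s) :
    some '' s ∈ permOrbits (vertexPerm u w ρ) ↔ s ∈ permOrbits ρ := by
  rw [vertexPerm, mem_permOrbits_swap_mul (none_notMem_image s) hw,
    mem_permOrbits_mul_swap (none_notMem_image s) hu, image_some_mem_permOrbits]

theorem exists_image_of_mem_permOrbits_vertexPerm {u w : Option α} {ρ : Perm α}
    {S : Set (Option α)} (hS : S ∈ permOrbits (vertexPerm u w ρ)) (hn : none ∉ S) (hu : u ∉ S) :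
    ∃ s ∈ permOrbits ρ, S = some '' s ∧ w ∉ S := by
  have hw : w ∉ S := by
    rw [← vertexPerm_apply_left u w ρ]
    exact fun h => hu ((invariant_of_mem_permOrbits hS u).1 h)
  refine ⟨some ⁻¹' S, ?_, (image_some_preimage hn).symm, hw⟩
  rw [← image_some_preimage hn] at hS hu hw
  rwa [image_some_mem_permOrbits_vertexPerm hu hw, ] at hS

/-- The points in the given (optional) places lie on a common cycle. -/
def Linked (u w : Option α) (ρ : Perm α) : Prop := ∃ a ∈ u, ∃ b ∈ w, ρ.SameCycle a b

theorem sameCycle_extendPerm_iff_linked [Finite α] {u w : Option α} {ρ : Perm α} (hw : w ≠ none) :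
    (extendPerm (u.map ρ) ρ).SameCycle none w ↔ Linked u w ρ := by
  rw [← mem_orb, orb_extendPerm_none, Set.mem_insert_iff, or_iff_right hw]
  obtain ⟨b, rfl⟩ := Option.ne_none_iff_exists'.1 hw
  simp [Linked]

theorem numOrbits_vertexPerm_of_linked [Finite α] {u w : Option α} {ρ : Perm α}
    (h : Linked u w ρ) : numOrbits (vertexPerm u w ρ) = numOrbits ρ + 1 := by
  have hw : w ≠ none := by obtain ⟨a, -, b, hb, -⟩ := h; rintro rfl; simp at hb
  rw [vertexPerm_eq, numOrbits_swap_mul_of_sameCycle hw.symm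
    ((sameCycle_extendPerm_iff_linked hw).2 h)]
  obtain ⟨a, ha, -⟩ := h
  rw [Option.mem_def] at ha
  rw [ha, Option.map_some, numOrbits_extendPerm_some]

/-- The insertion at `u` creates an orbit only if `u = none`; multiplication by the last swap then
merges two orbits unless `w = none`, when it does nothing. -/
theorem numOrbits_vertexPerm_of_not_linked [Finite α] {u w : Option α} {ρ : Perm α}
    (h : ¬ Linked u w ρ) : numOrbits (vertexPerm u w ρ) + 1 =
      numOrbits ρ + (if u = none then 1 else 0) + (if w = none then 1 else 0) := by
  have h1 : numOrbits (extendPerm (u.map ρ) ρ) = numOrbits ρ + if u = none then 1 else 0 := by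
    cases u with
    | none => simp [numOrbits_extendPerm_none]
    | some a => simp [numOrbits_extendPerm_some]
  rw [vertexPerm_eq, ← h1]
  by_cases hw : w = none
  · rw [hw, if_pos rfl, swap_self]
    rfl
  · rw [if_neg hw, add_zero]
    exact numOrbits_swap_mul_of_not_sameCycle
      (mt (sameCycle_extendPerm_iff_linked hw).1 h)

theorem orb_vertexPerm_of_not_linked [Finite α] {u w : Option α} {ρ : Perm α}
    (h : ¬ Linked u w ρ) : orb (vertexPerm u w ρ) none =
      insert none (some '' ({b | ∃ a ∈ u, ρ.SameCycle a b} ∪ {b | ∃ a ∈ w, ρ.SameCycle a b})) := by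
  have h1 : orb (extendPerm (u.map ρ) ρ) none =
      insert none (some '' {b | ∃ a ∈ u, ρ.SameCycle a b}) := by
    rw [orb_extendPerm_none]
    cases u <;> simp
  rw [vertexPerm_eq]
  cases w with
  | none =>
    rw [swap_self]
    refine h1.trans ?_
    simp
  | some b =>
    have h2 := mt (sameCycle_extendPerm_iff_linked (Option.some_ne_none b)).1 h
    rw [orb_swap_mul_of_not_sameCycle h2, h1]
    have hb : b ∉ {b | ∃ a ∈ u, ρ.SameCycle a b} := by
      rintro ⟨a, ha, hab⟩
      exact h ⟨a, ha, b, rfl, hab⟩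
    -- The orbit of `b` avoids `u`, since the places are not linked. Taking `none` as second place
    -- makes the last swap trivial, so the general lemma on orbits of `vertexPerm` describes the
    -- insertion at `u` alone.
    have hs : some '' orb ρ b ∈ permOrbits (extendPerm (u.map ρ) ρ) := by
      have hu : u ∉ some '' orb ρ b := by
        rintro ⟨a, ha, rfl⟩
        exact hb ⟨a, rfl, Perm.SameCycle.symm ha⟩
      have := (image_some_mem_permOrbits_vertexPerm (w := none) hu (none_notMem_image _)).2
        (orb_mem_permOrbits ρ b)
      rw [vertexPerm_eq, swap_self] at this
      exact this
    rw [← eq_orb hs (Set.mem_image_of_mem _ (mem_orb_self ρ b))]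
    rw [Set.insert_union, ← Set.image_union]
    simp [orb]

/-- After the insertion at `u`, the points `none` and `w` share a cycle, which the last swap cuts
between them; and `u` stays with `w`, its image. -/
theorem not_sameCycle_vertexPerm_of_linked [Finite α] {u w : Option α} {ρ : Perm α}
    (h : Linked u w ρ) : ¬ (vertexPerm u w ρ).SameCycle none u := by
  have hw : w ≠ none := by obtain ⟨a, -, b, hb, -⟩ := h; rintro rfl; simp at hb
  rw [← Perm.sameCycle_apply_right, vertexPerm_apply_left, vertexPerm_eq,
    sameCycle_swap_mul _ hw.symm, not_not]
  exact (sameCycle_extendPerm_iff_linked hw).2 h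

theorem orb_union_vertexPerm_of_linked [Finite α] {a b : α} {ρ : Perm α}
    (h : ρ.SameCycle a b) :
    orb (vertexPerm (some a) (some b) ρ) none ∪ orb (vertexPerm (some a) (some b) ρ) (some a) =
      insert none (some '' orb ρ a) := by
  have h0 : orb (vertexPerm (some a) (some b) ρ) (some a) =
      orb (vertexPerm (some a) (some b) ρ) (some b) := by
    symm
    apply orb_eq_of_mem
    have := (invariant_orb (vertexPerm (some a) (some b) ρ) (some a) (some a)).2
      (mem_orb_self _ _)
    rwa [vertexPerm_apply_left] at this
  have h1 : (extendPerm ((some a).map ρ) ρ).SameCycle none (some b) :=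
    (sameCycle_extendPerm_iff_linked (by simp)).2 ⟨a, rfl, b, rfl, h⟩
  rw [h0, vertexPerm_eq, orb_union_swap_mul, orb_eq_of_mem (mem_orb.2 h1), Set.union_self,
    orb_extendPerm_none]
  simp [orb]

theorem ncard_orb [Finite α] (σ : Perm α) (a : α) :
    (orb σ a).ncard = Function.minimalPeriod σ a := by
  have hper : a ∈ Function.periodicPts σ :=
    Function.mk_mem_periodicPts (orderOf_pos σ) (by
      rw [Function.IsPeriodicPt, Function.IsFixedPt, Perm.iterate_eq_pow, pow_orderOf_eq_one]; rfl)
  have : orb σ a = (fun i => σ^[i] a) '' (Finset.range (Function.minimalPeriod σ a) : Set ℕ) := by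
    ext b
    simp only [Finset.coe_range, Set.mem_image, Set.mem_Iio]
    constructor
    · intro h
      obtain ⟨j, hj⟩ := Perm.SameCycle.exists_nat_pow_eq h
      refine ⟨j % Function.minimalPeriod σ a,
        Nat.mod_lt _ (Function.minimalPeriod_pos_of_mem_periodicPts hper), ?_⟩
      rw [Function.iterate_mod_minimalPeriod_eq, Perm.iterate_eq_pow, hj]
    · rintro ⟨i, -, rfl⟩
      exact ⟨i, by rw [zpow_natCast, Perm.iterate_eq_pow]⟩
  rw [this, Set.InjOn.ncard_image, Set.ncard_coe_finset, Finset.card_range]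
  rw [Finset.coe_range]
  exact Function.iterate_injOn_Iio_minimalPeriod

/-- The exponent runs from `1` to the size of the orbit, a full turn standing for exponent `0`,
because it will be the degree of a vertex that contains the root. -/
theorem exists_iterate_of_sameCycle [Finite α] {σ : Perm α} {a b : α} (h : σ.SameCycle a b) :
    ∃ n, 0 < n ∧ n ≤ (orb σ a).ncard ∧ σ^[n] a = b := by
  rw [ncard_orb]
  have hpos : 0 < Function.minimalPeriod σ a := by
    rw [← ncard_orb, Set.ncard_pos (Set.toFinite _)]
    exact ⟨a, mem_orb_self σ a⟩
  obtain ⟨j, hj⟩ := Perm.SameCycle.exists_nat_pow_eq h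
  rw [← Perm.iterate_eq_pow, ← Function.iterate_mod_minimalPeriod_eq] at hj
  rcases Nat.eq_zero_or_pos (j % Function.minimalPeriod σ a) with h0 | h0
  · refine ⟨_, hpos, le_rfl, ?_⟩
    rw [h0] at hj
    rw [Function.iterate_minimalPeriod, ← hj]
    rfl
  · exact ⟨_, h0, (Nat.mod_lt _ hpos).le, hj⟩

/-- From `none` the new permutation runs through `ρ a, …, ρ^[n-1] a` and returns to `none` where `ρ`
would have reached `ρ^[n] a`. Thus the exponent of the insertion place is the degree of the new root
vertex. -/
theorem ncard_orb_vertexPerm_of_iterate [Finite α] {ρ : Perm α} {a : α} {n : ℕ} (h0 : 0 < n)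
    (hn : n ≤ (orb ρ a).ncard) :
    (orb (vertexPerm (some a) (some (ρ^[n] a)) ρ) none).ncard = n := by
  rw [ncard_orb] at hn
  set R := vertexPerm (some a) (some (ρ^[n] a)) ρ with hR
  have hne : ∀ i, 0 < i → i < n → ρ^[i] a ≠ ρ^[n] a := by
    intro i hi hin h
    have h2 : ρ^[n - i] a = a := by
      have : ρ^[i] (ρ^[n - i] a) = ρ^[i] a := by
        rw [← Function.iterate_add_apply, h]; congr 1; omega
      exact (ρ.injective.iterate i) this
    exact Function.not_isPeriodicPt_of_pos_of_lt_minimalPeriod (by omega) (by omega) h2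
  have hstep : ∀ x : α, x ≠ a → R (some x) = swap none (some (ρ^[n] a)) (some (ρ x)) := by
    intro x hx
    rw [hR, vertexPerm, Perm.mul_apply, Perm.mul_apply,
      swap_apply_of_ne_of_ne (a := none) (b := some a) (by simp) (by simpa using hx)]
    simp only [optionCongr_apply, Option.map_some]
  have hfirst : R none = swap none (some (ρ^[n] a)) (some (ρ a)) := by
    rw [hR, vertexPerm, Perm.mul_apply, Perm.mul_apply]
    simp only [swap_apply_left, optionCongr_apply, Option.map_some]
  have hall : ∀ i, 0 < i → i ≤ n → R^[i] none = swap none (some (ρ^[n] a)) (some (ρ^[i] a)) := by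
    intro i
    induction i with
    | zero => intro h; omega
    | succ i ih =>
      intro _ hi
      rw [Function.iterate_succ_apply', Function.iterate_succ_apply']
      rcases Nat.eq_zero_or_pos i with rfl | hi0
      · exact hfirst
      rw [ih hi0 (by omega), swap_apply_of_ne_of_ne (by simp)
        (by simpa using hne i hi0 (by omega)), hstep]
      exact fun h => Function.not_isPeriodicPt_of_pos_of_lt_minimalPeriod
        (n := i) (by omega) (by omega) h
  rw [ncard_orb]
  have hper : Function.IsPeriodicPt R n none := by
    rw [Function.IsPeriodicPt, Function.IsFixedPt, hall n h0 le_rfl, swap_apply_right]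
  refine (hper.minimalPeriod_le h0).antisymm (not_lt.1 fun hlt => ?_)
  have hp := hper.minimalPeriod_pos h0
  have := hall _ hp hlt.le
  rw [Function.iterate_minimalPeriod, swap_apply_of_ne_of_ne (by simp)
    (by simpa using hne _ hp hlt)] at this
  simp at this

end Extend

/-! ### Permutations of a disjoint union. -/

section Sum
variable {α β : Type}

theorem invariant_sumCongr {σ : Perm α} {τ : Perm β} {s : Set (α ⊕ β)} :
    Invariant (sumCongr σ τ) s ↔ Invariant σ (Sum.inl ⁻¹' s) ∧ Invariant τ (Sum.inr ⁻¹' s) := by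
  constructor
  · intro h
    exact ⟨fun a => h (Sum.inl a), fun a => h (Sum.inr a)⟩
  · rintro ⟨h, h'⟩ (a | a)
    · exact h a
    · exact h' a

theorem orb_sumCongr_inl (σ : Perm α) (τ : Perm β) (a : α) :
    orb (sumCongr σ τ) (Sum.inl a) = Sum.inl '' orb σ a := by
  refine Set.Subset.antisymm (Invariant.orb_subset ?_ (Set.mem_image_of_mem _ (mem_orb_self _ _)))
    ?_
  · rw [invariant_sumCongr, Set.preimage_image_eq _ Sum.inl_injective]
    exact ⟨invariant_orb σ a, fun b => by simp⟩
  · rintro _ ⟨b, hb, rfl⟩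
    exact (invariant_sumCongr.1 (invariant_orb (sumCongr σ τ) (Sum.inl a))).1.orb_subset
      (mem_orb_self _ _) hb

theorem orb_sumCongr_inr (σ : Perm α) (τ : Perm β) (b : β) :
    orb (sumCongr σ τ) (Sum.inr b) = Sum.inr '' orb τ b := by
  refine Set.Subset.antisymm (Invariant.orb_subset ?_ (Set.mem_image_of_mem _ (mem_orb_self _ _)))
    ?_
  · rw [invariant_sumCongr, Set.preimage_image_eq _ Sum.inr_injective]
    exact ⟨fun b => by simp, invariant_orb τ b⟩
  · rintro _ ⟨b, hb, rfl⟩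
    exact (invariant_sumCongr.1 (invariant_orb (sumCongr σ τ) (Sum.inr _))).2.orb_subset
      (mem_orb_self _ _) hb

theorem permOrbits_sumCongr (σ : Perm α) (τ : Perm β) :
    permOrbits (sumCongr σ τ) =
      (fun s => Sum.inl '' s) '' permOrbits σ ∪ (fun s => Sum.inr '' s) '' permOrbits τ := by
  ext s
  constructor
  · rintro ⟨a | a, rfl⟩
    · exact Or.inl ⟨_, orb_mem_permOrbits σ a, (orb_sumCongr_inl σ τ a).symm⟩
    · exact Or.inr ⟨_, orb_mem_permOrbits τ a, (orb_sumCongr_inr σ τ a).symm⟩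
  · rintro (⟨_, ⟨a, rfl⟩, rfl⟩ | ⟨_, ⟨a, rfl⟩, rfl⟩)
    · exact ⟨_, orb_sumCongr_inl σ τ a⟩
    · exact ⟨_, orb_sumCongr_inr σ τ a⟩

theorem numOrbits_sumCongr [Finite α] [Finite β] (σ : Perm α) (τ : Perm β) :
    numOrbits (sumCongr σ τ) = numOrbits σ + numOrbits τ := by
  rw [numOrbits, permOrbits_sumCongr, Set.ncard_union_eq _ (Set.toFinite _) (Set.toFinite _),
    Set.ncard_image_of_injective _ Sum.inl_injective.image_injective,
    Set.ncard_image_of_injective _ Sum.inr_injective.image_injective]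
  · rfl
  · rw [Set.disjoint_left]
    rintro _ ⟨s, ⟨a, rfl⟩, rfl⟩ ⟨t, -, ht⟩
    have : Sum.inl a ∈ Sum.inr '' t := by
      rw [show Sum.inr '' t = _ from ht]
      exact Set.mem_image_of_mem _ (mem_orb_self σ a)
    simp at this

end Sum

/-! ### Transitivity through invariant sets, and rigidity of rooted hypermaps. -/

theorem transitive_iff {α : Type} {R L : Perm α} :
    (∀ a b : α, ∃ σ ∈ Subgroup.closure {R, L}, σ a = b) ↔
      ∀ s : Set α, Invariant R s → Invariant L s → s = ∅ ∨ s = Set.univ := by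
  constructor
  · intro h s hR hL
    have key : ∀ σ ∈ Subgroup.closure {R, L}, Invariant σ s := by
      intro σ hσ
      induction hσ using Subgroup.closure_induction with
      | mem x hx =>
        rcases hx with rfl | rfl
        · exact hR
        · exact hL
      | one => intro a; simp
      | mul x y _ _ hx hy => exact hx.mul hy
      | inv x _ hx => exact hx.inv
    rcases s.eq_empty_or_nonempty with h0 | ⟨a, ha⟩
    · exact Or.inl h0
    · refine Or.inr (Set.eq_univ_of_forall fun b => ?_)
      obtain ⟨σ, hσ, rfl⟩ := h a b
      exact (key σ hσ a).2 ha
  · intro h a b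
    -- The orbit of `a` under the group is an invariant set that contains `a`, hence it is
    -- everything.
    have hinv : ∀ τ ∈ Subgroup.closure {R, L},
        Invariant τ {b | ∃ σ ∈ Subgroup.closure {R, L}, σ a = b} := by
      intro τ hτ c
      constructor
      · rintro ⟨σ, hσ, hc⟩
        exact ⟨τ⁻¹ * σ, mul_mem (inv_mem hτ) hσ, by rw [Perm.mul_apply, hc]; simp⟩
      · rintro ⟨σ, hσ, rfl⟩
        exact ⟨τ * σ, mul_mem hτ hσ, rfl⟩
    rcases h _ (hinv R (Subgroup.subset_closure (by simp)))
      (hinv L (Subgroup.subset_closure (by simp))) with h0 | h0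
    · have : a ∈ {b | ∃ σ ∈ Subgroup.closure {R, L}, σ a = b} := ⟨1, one_mem _, rfl⟩
      rw [h0] at this
      exact this.elim
    · have : b ∈ {b | ∃ σ ∈ Subgroup.closure {R, L}, σ a = b} := h0 ▸ Set.mem_univ b
      exact this

theorem Invariant.of_mul_inv {α : Type} {F L : Perm α} {s : Set α} (h : Invariant (F * L⁻¹) s)
    (hL : Invariant L s) : Invariant F s := by
  simpa using h.mul hL

/-- The sequenced hypermap with given hyperedge and face permutations. -/
def mkSeq {A : Type} [Finite A] (L F : Perm A) (root : Option A) (marked : List (Set A))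
    (reach : ∀ s : Set A, Invariant L s → Invariant F s → root ∉ some '' s → s = ∅)
    (nodup : marked.Nodup) (hmem : ∀ s ∈ marked, s ∈ permOrbits (F * L⁻¹))
    (hroot : ∀ s ∈ marked, ∀ x ∈ root, x ∉ s) : SequencedHypermap where
  Dart := A
  finite_dart := inferInstance
  R := F * L⁻¹
  L := L
  transitive := transitive_iff.2 fun s hR hL => by
    have hF := hR.of_mul_inv hL
    by_cases h : root ∈ some '' s
    · right
      rw [← compl_compl s, reach sᶜ hL.compl hF.compl, Set.compl_empty]
      obtain ⟨x, hx, rfl⟩ := h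
      simpa using hx
    · exact Or.inl (reach s hL hF h)
  root := root
  -- The condition `reach` encodes both transitivity and this property: without a root it applies to
  -- the set of all darts.
  root_eq_none := by
    rintro rfl
    rw [← Set.univ_eq_empty_iff]
    exact reach _ (fun _ => Iff.rfl) (fun _ => Iff.rfl) (none_notMem_image _)
  marked := marked
  marked_nodup := nodup
  marked_vertex := hmem
  root_not_marked := hroot

/-- The bijection `φ` of the darts is an isomorphism. -/
def IsoVia (h k : SequencedHypermap) (φ : h.Dart ≃ k.Dart) : Prop :=
  (∀ a, φ (h.R a) = k.R (φ a)) ∧ (∀ a, φ (h.L a) = k.L (φ a)) ∧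
    k.root = h.root.map φ ∧ k.marked = h.marked.map (fun s => φ '' s)

/-- The fixed points of `φ` form an invariant set that contains the root. This rigidity is what
makes the `p` choices of a dart in the second term give `p` different classes. -/
theorem IsoVia.eq_refl {h : SequencedHypermap} {φ : h.Dart ≃ h.Dart} (hφ : IsoVia h h φ)
    (a : h.Dart) : φ a = a := by
  obtain ⟨hR, hL, hr, -⟩ := hφ
  have key : ∀ σ : Perm h.Dart, (∀ a, φ (σ a) = σ (φ a)) → Invariant σ {a | φ a = a} := by
    intro σ hσ a
    change φ (σ a) = σ a ↔ φ a = a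
    rw [hσ, σ.injective.eq_iff]
  rcases transitive_iff.1 h.transitive _ (key _ hR) (key _ hL) with h0 | h0
  · rcases hroot : h.root with _ | x
    · exact (h.root_eq_none hroot).elim a
    · rw [hroot, Option.map_some, Option.some_inj] at hr
      have : x ∈ {a | φ a = a} := hr.symm
      rw [h0] at this
      exact this.elim
  · have : a ∈ {a | φ a = a} := h0 ▸ Set.mem_univ a
    exact this

/-! ### Invariance of the parameters under isomorphism. -/

section Params

theorem numHyperedges_eq (h : Hypermap) : h.numHyperedges = numOrbits h.L := rfl

theorem numFaces_eq (h : Hypermap) [Nonempty h.Dart] : h.numFaces = numOrbits (h.R * h.L) := by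
  rw [Hypermap.numFaces, if_neg (not_isEmpty_of_nonempty _)]
  rfl

theorem numVertices_eq (h : Hypermap) [Nonempty h.Dart] : h.numVertices = numOrbits h.R := by
  rw [Hypermap.numVertices, if_neg (not_isEmpty_of_nonempty _)]
  rfl

theorem numFaces_of_isEmpty (h : Hypermap) [IsEmpty h.Dart] : h.numFaces = 1 := by
  rw [Hypermap.numFaces, if_pos ‹_›]

theorem numVertices_of_isEmpty (h : Hypermap) [IsEmpty h.Dart] : h.numVertices = 1 := by
  rw [Hypermap.numVertices, if_pos ‹_›]

theorem rootVertex_of_root_eq_some {h : SequencedHypermap} {a : h.Dart} (ha : h.root = some a) :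
    h.rootVertex = orb h.R a := by
  ext b
  simp [SequencedHypermap.rootVertex, ha, orb]

theorem IsoVia.mul {h k : SequencedHypermap} {φ : h.Dart ≃ k.Dart} (hφ : IsoVia h k φ)
    (a : h.Dart) : φ ((h.R * h.L) a) = (k.R * k.L) (φ a) := by
  rw [Perm.mul_apply, hφ.1, hφ.2.1, Perm.mul_apply]

theorem IsoVia.image_rootVertex {h k : SequencedHypermap} {φ : h.Dart ≃ k.Dart}
    (hφ : IsoVia h k φ) : k.rootVertex = φ '' h.rootVertex := by
  rcases hroot : h.root with _ | x
  · have hk : k.root = none := by rw [hφ.2.2.1, hroot]; rfl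
    simp [SequencedHypermap.rootVertex, hroot, hk]
  · have hk : k.root = some (φ x) := by rw [hφ.2.2.1, hroot]; rfl
    rw [rootVertex_of_root_eq_some hk, rootVertex_of_root_eq_some hroot, image_orb φ hφ.1]

theorem IsoVia.hasParams {h k : SequencedHypermap} {φ : h.Dart ≃ k.Dart} (hφ : IsoVia h k φ)
    {g t f e n : ℤ} {D : List ℤ} (H : h.HasParams g t f e n D) : k.HasParams g t f e n D := by
  have h1 : k.numDarts = h.numDarts := (Nat.card_congr φ).symm
  have h2 : k.numHyperedges = h.numHyperedges := numOrbits_equiv φ hφ.2.1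
  have h3 : k.numFaces = h.numFaces := by
    rcases isEmpty_or_nonempty h.Dart with he | he
    · have := φ.symm.isEmpty
      rw [numFaces_of_isEmpty, numFaces_of_isEmpty]
    · have := φ.symm.nonempty
      rw [numFaces_eq, numFaces_eq, numOrbits_equiv φ hφ.mul]
  have h4 : k.numVertices = h.numVertices := by
    rcases isEmpty_or_nonempty h.Dart with he | he
    · have := φ.symm.isEmpty
      rw [numVertices_of_isEmpty, numVertices_of_isEmpty]
    · have := φ.symm.nonempty
      rw [numVertices_eq, numVertices_eq, numOrbits_equiv φ hφ.1]
  obtain ⟨H1, H2, H3, H4, H5, H6⟩ := H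
  refine ⟨?_, by rw [h1, H2], by rw [h3, H3], by rw [h2, H4], ?_, ?_⟩
  · rw [Hypermap.HasGenus, h1, h2, h3, h4]
    exact H1
  · rw [hφ.image_rootVertex, Set.ncard_image_of_injective _ φ.injective, H5]
  · rw [hφ.2.2.2, List.map_map, ← H6]
    refine List.map_congr_left fun s _ => ?_
    simp [Set.ncard_image_of_injective _ φ.injective]

theorem hasParams_iff_of_iso {h k : SequencedHypermap} (H : SequencedHypermap.Iso h k)
    {g t f e n : ℤ} {D : List ℤ} : h.HasParams g t f e n D ↔ k.HasParams g t f e n D := by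
  constructor
  · obtain ⟨φ, hφ⟩ := H
    exact IsoVia.hasParams hφ
  · obtain ⟨φ, hφ⟩ := H.symm
    exact IsoVia.hasParams hφ

theorem mk_mem_seqHypermaps {h : SequencedHypermap} {g t f e n : ℤ} {D : List ℤ} :
    Quotient.mk SequencedHypermap.isoSetoid h ∈ seqHypermaps g t f e n D ↔
      h.HasParams g t f e n D := by
  constructor
  · rintro ⟨k, hk, hkh⟩
    exact (hasParams_iff_of_iso (Quotient.exact hkh)).1 hk
  · intro H
    exact ⟨h, H, rfl⟩

end Params

/-! ### Removal and insertion of the root. -/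

/-- The data left when the root is removed from the hyperedge and face permutations of a
non-empty sequenced hypermap: the two permutations of the remaining darts, the places `u`, `w`
where the root has to be inserted, and the marked vertices of the original hypermap. -/
structure Extension where
  Base : Type
  finite_base : Finite Base
  L : Perm Base
  F : Perm Base
  u : Option Base
  w : Option Base
  marked : List (Set (Option Base))
  -- Transitivity after the insertion of the root: a component of the base that contains neither
  -- place would stay disconnected from the root.
  reach : ∀ s : Set Base, Invariant L s → Invariant F s → u ∉ some '' s → w ∉ some '' s → s = ∅
  nodup : marked.Nodup
  mem_permOrbits : ∀ s ∈ marked, s ∈ permOrbits (vertexPerm u w (F * L⁻¹))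
  none_notMem : ∀ s ∈ marked, none ∉ s

namespace Extension

attribute [instance] finite_base

/-- The sequenced hypermap given by the data. -/
noncomputable def toSeq (E : Extension) : SequencedHypermap :=
  mkSeq (extendPerm E.u E.L) (extendPerm E.w E.F) (some none) E.marked
    (by
      intro s hL hF hn
      rw [invariant_extendPerm] at hL hF
      have hn' : none ∉ s := by simpa using hn
      rw [← image_some_preimage hn', Set.image_eq_empty]
      refine E.reach _ hL.2 hF.2 ?_ ?_ <;> rw [image_some_preimage hn']
      · exact fun h => hn' (hL.1.2 h)
      · exact fun h => hn' (hF.1.2 h))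
    E.nodup (by rw [extendPerm_mul_inv]; exact E.mem_permOrbits)
    (by rintro s hs _ ⟨⟩; exact E.none_notMem s hs)

theorem toSeq_R (E : Extension) : E.toSeq.R = vertexPerm E.u E.w (E.F * E.L⁻¹) :=
  extendPerm_mul_inv _ _ _ _

theorem toSeq_R_mul_L (E : Extension) : E.toSeq.R * E.toSeq.L = extendPerm E.w E.F := by
  change extendPerm E.w E.F * (extendPerm E.u E.L)⁻¹ * extendPerm E.u E.L = _
  simp

theorem toSeq_root (E : Extension) : E.toSeq.root = some none := rfl

/-- The bijection `ψ` is an isomorphism of the data. -/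
def IsoVia (E E' : Extension) (ψ : E.Base ≃ E'.Base) : Prop :=
  (∀ a, ψ (E.L a) = E'.L (ψ a)) ∧ (∀ a, ψ (E.F a) = E'.F (ψ a)) ∧ E'.u = E.u.map ψ ∧
    E'.w = E.w.map ψ ∧ E'.marked = E.marked.map (fun s => optionCongr ψ '' s)

/-- An isomorphism preserves the root `none`, so it is `optionCongr ψ` for a bijection `ψ` of the
bases, and `optionCongr_extendPerm` translates the compatibility with `L` and with the face
permutation. -/
theorem toSeq_iso_iff {E E' : Extension} :
    SequencedHypermap.Iso E.toSeq E'.toSeq ↔ ∃ ψ, IsoVia E E' ψ := by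
  constructor
  · rintro ⟨φ, hφ⟩
    have hF := HypermapDecomposition.IsoVia.mul hφ
    obtain ⟨-, hL, hr, hm⟩ := hφ
    change Option E.Base ≃ Option E'.Base at φ
    have hnone : φ none = none := by
      have : some none = some (φ none) := hr
      exact (Option.some_inj.1 this).symm
    obtain ⟨ψ, rfl⟩ : ∃ ψ : E.Base ≃ E'.Base, φ = optionCongr ψ := by
      refine ⟨removeNone φ, ?_⟩
      ext1 x
      rcases x with _ | x
      · simpa using hnone
      · have : ∃ y, φ (some x) = some y := by
          apply Option.ne_none_iff_exists'.1
          rw [← hnone]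
          exact φ.injective.ne (by simp)
        rw [optionCongr_apply, Option.map_some, removeNone_some _ this]
    rw [toSeq_R_mul_L, toSeq_R_mul_L] at hF
    obtain ⟨hu, hL⟩ := (optionCongr_extendPerm ψ).1 hL
    obtain ⟨hw, hF⟩ := (optionCongr_extendPerm ψ).1 hF
    exact ⟨ψ, hL, hF, hu, hw, hm⟩
  · rintro ⟨ψ, hL, hF, hu, hw, hm⟩
    have hL' := (optionCongr_extendPerm ψ).2 ⟨hu, hL⟩
    have hF' := (optionCongr_extendPerm ψ).2 ⟨hw, hF⟩
    refine ⟨optionCongr ψ, ?_, hL', rfl, hm⟩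
    intro x
    -- Every dart has the form `L x`, and `R (L x) = F x`; so compatibility with `R` follows from
    -- compatibility with `L` and `F`.
    obtain ⟨x, rfl⟩ := (extendPerm E.u E.L).surjective x
    have h1 : E.toSeq.R (extendPerm E.u E.L x) = extendPerm E.w E.F x := by
      rw [← toSeq_R_mul_L]; rfl
    have h2 := congrFun (congrArg DFunLike.coe (toSeq_R_mul_L E')) (optionCongr ψ x)
    have h3 : E'.toSeq.R (extendPerm E'.u E'.L (optionCongr ψ x)) =
        extendPerm E'.w E'.F (optionCongr ψ x) := h2
    exact (congrArg (optionCongr ψ) h1).trans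
      ((hF' x).trans (h3.symm.trans (congrArg E'.toSeq.R (hL' x).symm)))

theorem exists_iso_toSeq (h : SequencedHypermap) (hne : h.root ≠ none) :
    ∃ E : Extension, SequencedHypermap.Iso E.toSeq h := by
  classical
  obtain ⟨r, hr⟩ := Option.ne_none_iff_exists'.1 hne
  have := h.finite_dart
  set e := optionSubtypeNe r with he
  obtain ⟨u, L, hL⟩ := exists_eq_extendPerm (e.trans (h.L.trans e.symm))
  obtain ⟨w, F, hF⟩ := exists_eq_extendPerm (e.trans ((h.R * h.L).trans e.symm))
  have hL' : ∀ x, e (extendPerm u L x) = h.L (e x) := by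
    intro x; rw [← hL]; simp
  have hF' : ∀ x, e (extendPerm w F x) = (h.R * h.L) (e x) := by
    intro x; rw [← hF]; simp
  have hR' : ∀ x, e (vertexPerm u w (F * L⁻¹) x) = h.R (e x) := by
    intro x
    rw [← extendPerm_mul_inv]
    obtain ⟨x, rfl⟩ := (extendPerm u L).surjective x
    simp [hL', hF']
  refine ⟨⟨{b // b ≠ r}, inferInstance, L, F, u, w, h.marked.map (fun s => e.symm '' s), ?_, ?_,
    ?_, ?_⟩, e, ?_, hL', ?_, ?_⟩
  -- A set that avoids both places stays invariant when the root is put back, and it misses the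
  -- root; transitivity leaves only the empty set.
  · intro s hs hs' hu hw
    have h1 : Invariant (extendPerm u L) (some '' s) :=
      invariant_extendPerm.2 ⟨iff_of_false (none_notMem_image s) hu, by
        rwa [preimage_some_image]⟩
    have h2 : Invariant (extendPerm w F) (some '' s) :=
      invariant_extendPerm.2 ⟨iff_of_false (none_notMem_image s) hw, by
        rwa [preimage_some_image]⟩
    rw [← invariant_image_iff e hL'] at h1
    rw [← invariant_image_iff e hF'] at h2
    have h3 : Invariant h.R (e '' (some '' s)) := by
      refine Invariant.of_mul_inv (L := h.L⁻¹) ?_ h1.inv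
      simpa using h2
    rcases transitive_iff.1 h.transitive _ h3 h1 with h0 | h0
    · simpa using h0
    · have : r ∈ e '' (some '' s) := h0 ▸ Set.mem_univ r
      obtain ⟨x, hx, hxr⟩ := this
      have hxn : x = none := e.injective (hxr.trans (optionSubtypeNe_none r).symm)
      subst hxn
      exact (none_notMem_image s hx).elim
  · exact h.marked_nodup.map e.symm.injective.image_injective
  · intro s hs
    obtain ⟨s, hs0, rfl⟩ := List.mem_map.1 hs
    have := h.marked_vertex s hs0
    have h2 : s ∈ permOrbits h.R := this
    rw [permOrbits_equiv e hR'] at h2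
    obtain ⟨s', hs', rfl⟩ := h2
    simpa using hs'
  · intro s hs hn
    obtain ⟨s, hs0, rfl⟩ := List.mem_map.1 hs
    refine h.root_not_marked s hs0 r hr ?_
    obtain ⟨x, hx, hxn⟩ := hn
    rw [Equiv.symm_apply_eq] at hxn
    rwa [hxn] at hx
  · intro x
    rw [toSeq_R]
    exact hR' x
  · exact hr
  · change h.marked = (h.marked.map (fun s => e.symm '' s)).map (fun s => e '' s)
    simp [List.map_map, Function.comp_def]

section Params
variable (E : Extension)

instance : Nonempty E.toSeq.Dart := ⟨(none : Option E.Base)⟩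

theorem numDarts_toSeq : E.toSeq.numDarts = Nat.card E.Base + 1 := Finite.card_option

open Classical in
theorem numHyperedges_toSeq :
    E.toSeq.numHyperedges = numOrbits E.L + if E.u = none then 1 else 0 := by
  change numOrbits (extendPerm E.u E.L) = _
  rcases E.u with _ | a
  · simp [numOrbits_extendPerm_none]
  · simp [numOrbits_extendPerm_some]

open Classical in
theorem numFaces_toSeq :
    E.toSeq.numFaces = numOrbits E.F + if E.w = none then 1 else 0 := by
  rw [numFaces_eq, toSeq_R_mul_L]
  change numOrbits (extendPerm E.w E.F) = _
  rcases E.w with _ | a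
  · simp [numOrbits_extendPerm_none]
  · simp [numOrbits_extendPerm_some]

theorem numVertices_toSeq :
    E.toSeq.numVertices = numOrbits (vertexPerm E.u E.w (E.F * E.L⁻¹)) := by
  rw [numVertices_eq, toSeq_R]
  rfl

theorem rootVertex_toSeq :
    E.toSeq.rootVertex = orb (vertexPerm E.u E.w (E.F * E.L⁻¹)) none := by
  rw [rootVertex_of_root_eq_some E.toSeq_root, toSeq_R]
  rfl

end Params

end Extension

/-! ### Lists of subsets of a disjoint union. -/

section Lists
variable {α β : Type}

theorem exists_map_eq {ι γ : Type} {g : ι → γ} {P : ι → Prop} (l : List γ)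
    (h : ∀ s ∈ l, ∃ x, s = g x ∧ P x) : ∃ M : List ι, l = M.map g ∧ ∀ x ∈ M, P x := by
  induction l with
  | nil => exact ⟨[], rfl, by simp⟩
  | cons s l ih =>
    obtain ⟨x, rfl, hx⟩ := h _ List.mem_cons_self
    obtain ⟨M, rfl, hM⟩ := ih fun t ht => h t (List.mem_cons_of_mem _ ht)
    exact ⟨x :: M, rfl, by simpa using ⟨hx, hM⟩⟩

theorem map_inj_of_injOn {ι γ : Type} {g : ι → γ} {P : ι → Prop}
    (hg : ∀ x y, P x → P y → g x = g y → x = y) {l m : List ι} (hl : ∀ x ∈ l, P x)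
    (hm : ∀ x ∈ m, P x) (h : l.map g = m.map g) : l = m := by
  induction l generalizing m with
  | nil => simpa using h.symm
  | cons x l ih =>
    rcases m with _ | ⟨y, m⟩
    · simp at h
    · simp only [List.map_cons, List.cons.injEq] at h
      rw [hg x y (hl x List.mem_cons_self) (hm y List.mem_cons_self) h.1,
        ih (fun z hz => hl z (List.mem_cons_of_mem _ hz))
          (fun z hz => hm z (List.mem_cons_of_mem _ hz)) h.2]

theorem mem_filterMap_getLeft {M : List (α ⊕ β)} {x : α} :
    x ∈ M.filterMap Sum.getLeft? ↔ Sum.inl x ∈ M := by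
  simp [List.mem_filterMap]

theorem mem_filterMap_getRight {M : List (α ⊕ β)} {x : β} :
    x ∈ M.filterMap Sum.getRight? ↔ Sum.inr x ∈ M := by
  simp [List.mem_filterMap]

theorem nodup_of_filterMap {M : List (α ⊕ β)} (h : (M.filterMap Sum.getLeft?).Nodup)
    (h' : (M.filterMap Sum.getRight?).Nodup) : M.Nodup := by
  induction M with
  | nil => exact List.nodup_nil
  | cons x M ih =>
    rcases x with x | x
    · rw [List.filterMap_cons_some (f := Sum.getLeft?) (b := x) rfl, List.nodup_cons,
        mem_filterMap_getLeft] at h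
      rw [List.filterMap_cons_none (f := Sum.getRight?) rfl] at h'
      exact List.nodup_cons.2 ⟨h.1, ih h.2 h'⟩
    · rw [List.filterMap_cons_some (f := Sum.getRight?) (b := x) rfl, List.nodup_cons,
        mem_filterMap_getRight] at h'
      rw [List.filterMap_cons_none (f := Sum.getLeft?) rfl] at h
      exact List.nodup_cons.2 ⟨h'.1, ih h h'.2⟩

theorem filterMap_getLeft_map {γ δ : Type} (f : α → γ) (g : β → δ) (M : List (α ⊕ β)) :
    (M.map (Sum.map f g)).filterMap Sum.getLeft? = (M.filterMap Sum.getLeft?).map f := by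
  induction M with
  | nil => rfl
  | cons x M ih => rcases x with x | x <;> simp [List.filterMap_cons, ih]

theorem filterMap_getRight_map {γ δ : Type} (f : α → γ) (g : β → δ) (M : List (α ⊕ β)) :
    (M.map (Sum.map f g)).filterMap Sum.getRight? = (M.filterMap Sum.getRight?).map g := by
  induction M with
  | nil => rfl
  | cons x M ih => rcases x with x | x <;> simp [List.filterMap_cons, ih]

/-- A subset of one of the summands as a subset of the sum. -/
def sumSet : Set α ⊕ Set β → Set (α ⊕ β) :=
  Sum.elim (fun s => Sum.inl '' s) (fun s => Sum.inr '' s)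

/-- Non-emptiness matters: the empty sets of the two sides have the same image. -/
theorem sumSet_inj {x y : Set α ⊕ Set β} (hx : (sumSet x).Nonempty)
    (h : sumSet x = sumSet y) : x = y := by
  rcases x with s | s <;> rcases y with t | t
  · rw [Sum.inl_injective.image_injective h]
  · obtain ⟨_, a, ha, rfl⟩ := hx
    have : Sum.inl a ∈ Sum.inr '' t := (Set.ext_iff.1 h _).1 (Set.mem_image_of_mem _ ha)
    simp at this
  · obtain ⟨_, a, ha, rfl⟩ := hx
    have : Sum.inr a ∈ Sum.inl '' t := (Set.ext_iff.1 h _).1 (Set.mem_image_of_mem _ ha)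
    simp at this
  · rw [Sum.inr_injective.image_injective h]

theorem image_sumSet {γ δ : Type} (φ : α ≃ γ) (ψ : β ≃ δ) (x : Set α ⊕ Set β) :
    sumCongr φ ψ '' sumSet x = sumSet (Sum.map (fun s => φ '' s) (fun s => ψ '' s) x) := by
  rcases x with s | s <;> simp [sumSet, Set.image_image]

theorem image_optionCongr_image_some (φ : α ≃ β) (s : Set α) :
    optionCongr φ '' (some '' s) = some '' (φ '' s) := by
  simp [Set.image_image]

end Lists

/-! ### Joining a new root to one hypermap. -/

theorem perm_inv_apply_self {α : Type} (σ : Perm α) (a : α) : σ⁻¹ (σ a) = a := by simp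

/-- Exchanging hyperedges and faces inverts the vertex permutation, so the dual hypermap has the
same vertices. -/
theorem mul_inv_face (h : Hypermap) : h.L * (h.R * h.L)⁻¹ = h.R⁻¹ := by
  rw [mul_inv_rev, mul_inv_cancel_left]

theorem face_mul_inv (h : Hypermap) : h.R * h.L * h.L⁻¹ = h.R := mul_inv_cancel_right _ _

theorem reach_root (h : SequencedHypermap) {s : Set h.Dart} (hF : Invariant (h.R * h.L) s)
    (hL : Invariant h.L s) (hr : h.root ∉ some '' s) : s = ∅ := by
  have hR : Invariant h.R s := by
    rw [← face_mul_inv h.toHypermap]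
    exact hF.mul hL.inv
  rcases transitive_iff.1 h.transitive s hR hL with h0 | h0
  · exact h0
  · subst h0
    rcases hroot : h.root with _ | x
    · have := h.root_eq_none hroot
      exact Set.univ_eq_empty_iff.2 this
    · rw [hroot] at hr
      simp at hr

theorem root_notMem_image {h : SequencedHypermap} {s : Set h.Dart} (hs : s ∈ h.marked) :
    h.root ∉ some '' s := by
  rintro ⟨x, hx, hr⟩
  exact h.root_not_marked s hs x hr.symm hx

theorem eq_orb_of_mem_marked {h : SequencedHypermap} {s : Set h.Dart} (hs : s ∈ h.marked)
    {a : h.Dart} (ha : a ∈ s) : s = orb h.R a := eq_orb (h.marked_vertex s hs) ha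

theorem notMem_of_mem_rootVertex {h : SequencedHypermap} {w : h.Dart} (hw : w ∈ h.rootVertex)
    {s : Set h.Dart} (hs : s ∈ h.marked) : w ∉ s := by
  obtain ⟨x, hx, hxw⟩ := hw
  intro hws
  exact h.root_not_marked s hs x hx
    (((invariant_of_mem_permOrbits (h.marked_vertex s hs)).mem_iff hxw).2 hws)

theorem root_ne_none_of_mem {h : SequencedHypermap} (w : h.Dart) : h.root ≠ none :=
  fun hr => (h.root_eq_none hr).false w

theorem linked_inv_iff {h : SequencedHypermap} {w : h.Dart} :
    Linked h.root (some w) h.R⁻¹ ↔ w ∈ h.rootVertex := by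
  constructor
  · rintro ⟨a, ha, b, hb, hab⟩
    rw [Option.mem_some_iff] at hb
    subst hb
    exact ⟨a, ha, Perm.sameCycle_inv.1 hab⟩
  · rintro ⟨a, ha, hab⟩
    exact ⟨a, ha, w, rfl, Perm.sameCycle_inv.2 hab⟩

namespace Extension

/-- Join a new root to the dual of `k`. -/
def join (k : SequencedHypermap) (w : k.Dart) (M : List (Set (Option k.Dart))) (nodup : M.Nodup)
    (hmem : ∀ s ∈ M, s ∈ permOrbits (vertexPerm k.root (some w) k.R⁻¹))
    (hnone : ∀ s ∈ M, none ∉ s) : Extension where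
  Base := k.Dart
  finite_base := k.finite_dart
  L := k.R * k.L
  F := k.L
  u := k.root
  w := some w
  marked := M
  reach := fun _ hF hL hu _ => reach_root k hF hL hu
  nodup := nodup
  mem_permOrbits := by rwa [mul_inv_face]
  none_notMem := hnone

theorem IsoVia.ratio {E E' : Extension} {ψ : E.Base ≃ E'.Base} (h : IsoVia E E' ψ) (a : E.Base) :
    ψ ((E.F * E.L⁻¹) a) = (E'.F * E'.L⁻¹) (ψ a) := by
  obtain ⟨a, rfl⟩ := E.L.surjective a
  rw [Perm.mul_apply, perm_inv_apply_self, h.2.1, h.1, Perm.mul_apply, perm_inv_apply_self]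

theorem join_isoVia_iff {k k' : SequencedHypermap} {w : k.Dart} {w' : k'.Dart} {M nd hm hn}
    {M' nd' hm' hn'} {φ : k.Dart ≃ k'.Dart} :
    IsoVia (join k w M nd hm hn) (join k' w' M' nd' hm' hn') φ ↔
      (∀ a, φ (k.R a) = k'.R (φ a)) ∧ (∀ a, φ (k.L a) = k'.L (φ a)) ∧ k'.root = k.root.map φ ∧
        w' = φ w ∧ M' = M.map (fun s => optionCongr φ '' s) := by
  constructor
  · rintro ⟨hL, hF, hu, hw, hM⟩
    refine ⟨fun a => ?_, hF, hu, Option.some_inj.1 hw, hM⟩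
    obtain ⟨a, rfl⟩ := k.L.surjective a
    have h1 : φ (k.R (k.L a)) = k'.R (k'.L (φ a)) := hL a
    have h2 : φ (k.L a) = k'.L (φ a) := hF a
    rw [h1, h2]
  · rintro ⟨hR, hL, hr, rfl, hM⟩
    refine ⟨fun a => ?_, hL, hr, rfl, hM⟩
    exact (hR (k.L a)).trans (congrArg k'.R (hL a))

theorem join_iso_iff {k k' : SequencedHypermap} {w : k.Dart} {w' : k'.Dart} {M nd hm hn}
    {M' nd' hm' hn'} :
    SequencedHypermap.Iso (join k w M nd hm hn).toSeq (join k' w' M' nd' hm' hn').toSeq ↔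
      ∃ φ : k.Dart ≃ k'.Dart, (∀ a, φ (k.R a) = k'.R (φ a)) ∧ (∀ a, φ (k.L a) = k'.L (φ a)) ∧
        k'.root = k.root.map φ ∧ w' = φ w ∧ M' = M.map (fun s => optionCongr φ '' s) :=
  toSeq_iso_iff.trans (exists_congr fun _ => join_isoVia_iff)

theorem image_mem_permOrbits_of_mem_marked {k : SequencedHypermap} {w : k.Dart} {s : Set k.Dart}
    (hs : s ∈ k.marked) (hw : w ∉ s) :
    some '' s ∈ permOrbits (vertexPerm k.root (some w) k.R⁻¹) := by
  rw [image_some_mem_permOrbits_vertexPerm (root_notMem_image hs) (by simpa using hw),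
    permOrbits_inv]
  exact k.marked_vertex s hs

/-- The root is joined to `k` in such a way that the root vertex of `k` is divided into the new
root vertex and a vertex that is not marked. -/
def link (k : SequencedHypermap) (w : k.Dart) (hw : w ∈ k.rootVertex) : Extension :=
  join k w (k.marked.map fun s => some '' s)
    (k.marked_nodup.map (Option.some_injective _).image_injective)
    (by
      intro s hs
      obtain ⟨s, hs', rfl⟩ := List.mem_map.1 hs
      exact image_mem_permOrbits_of_mem_marked hs' (notMem_of_mem_rootVertex hw hs'))
    (by
      intro s hs
      obtain ⟨s, hs', rfl⟩ := List.mem_map.1 hs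
      exact none_notMem_image s)

/-- The vertex that is separated from the root vertex when the root is joined to `k`. -/
noncomputable def newVertex (k : SequencedHypermap) (w : k.Dart) : Set (Option k.Dart) :=
  orb (vertexPerm k.root (some w) k.R⁻¹) k.root

theorem newVertex_notMem_map (k : SequencedHypermap) (w : k.Dart) :
    newVertex k w ∉ k.marked.map fun s => some '' s := by
  intro h
  obtain ⟨s, hs, h⟩ := List.mem_map.1 h
  exact root_notMem_image hs (h ▸ mem_orb_self _ _)

theorem none_notMem_newVertex {k : SequencedHypermap} {w : k.Dart} (hw : w ∈ k.rootVertex) :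
    none ∉ newVertex k w := by
  have := k.finite_dart
  intro h
  exact not_sameCycle_vertexPerm_of_linked (linked_inv_iff.2 hw) (Perm.SameCycle.symm h)

/-- The root is joined to `k` in such a way that the root vertex of `k` is divided into the new
root vertex and a vertex that is marked, with `j` in the list. -/
noncomputable def markedLink (k : SequencedHypermap) (w : k.Dart) (hw : w ∈ k.rootVertex) (j : ℕ)
    (hj : j ≤ k.marked.length) : Extension :=
  join k w ((k.marked.map fun s => some '' s).insertIdx j (newVertex k w))
    (by
      rw [(List.perm_insertIdx _ _ (by simpa using hj)).nodup_iff, List.nodup_cons]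
      exact ⟨newVertex_notMem_map k w,
        k.marked_nodup.map (Option.some_injective _).image_injective⟩)
    (by
      intro s hs
      rcases List.eq_or_mem_of_mem_insertIdx hs with rfl | hs
      · exact orb_mem_permOrbits _ _
      · obtain ⟨s, hs', rfl⟩ := List.mem_map.1 hs
        exact image_mem_permOrbits_of_mem_marked hs' (notMem_of_mem_rootVertex hw hs'))
    (by
      intro s hs
      rcases List.eq_or_mem_of_mem_insertIdx hs with rfl | hs
      · exact none_notMem_newVertex hw
      · obtain ⟨s, hs', rfl⟩ := List.mem_map.1 hs
        exact none_notMem_image s)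

theorem notMem_of_mem_tail {k : SequencedHypermap} {s t : Set k.Dart} {l : List (Set k.Dart)}
    (h : k.marked = s :: l) {w : k.Dart} (hw : w ∈ s) (ht : t ∈ l) : w ∉ t := by
  intro hwt
  have h1 : s = t := by
    rw [eq_orb_of_mem_marked (h ▸ List.mem_cons_self) hw,
      eq_orb_of_mem_marked (h ▸ List.mem_cons_of_mem _ ht) hwt]
  have := k.marked_nodup
  rw [h, List.nodup_cons] at this
  exact this.1 (h1 ▸ ht)

/-- The root is joined to `k` in such a way that the root vertex of `k` and the first marked
vertex are merged into the new root vertex. -/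
def handle (k : SequencedHypermap) (w : k.Dart) (s : Set k.Dart) (l : List (Set k.Dart))
    (h : k.marked = s :: l) (hw : w ∈ s) : Extension :=
  join k w (l.map fun s => some '' s)
    ((List.nodup_cons.1 (h ▸ k.marked_nodup)).2.map (Option.some_injective _).image_injective)
    (by
      intro t ht
      obtain ⟨t, ht', rfl⟩ := List.mem_map.1 ht
      exact image_mem_permOrbits_of_mem_marked (h ▸ List.mem_cons_of_mem _ ht')
        (notMem_of_mem_tail h hw ht'))
    (by
      intro t ht
      obtain ⟨t, ht', rfl⟩ := List.mem_map.1 ht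
      exact none_notMem_image t)

theorem map_image_some_map {A B : Type} (φ : A ≃ B) (l : List (Set A)) :
    (l.map fun s => some '' s).map (fun s => optionCongr φ '' s) =
      (l.map fun s => φ '' s).map fun s => some '' s := by
  rw [List.map_map, List.map_map]
  refine List.map_congr_left fun s _ => ?_
  exact image_optionCongr_image_some φ s

theorem map_image_some_injective {A : Type} :
    Function.Injective (List.map fun s : Set A => some '' s) :=
  List.map_injective_iff.2 (Option.some_injective A).image_injective

theorem link_iso_iff {k k' : SequencedHypermap} {w : k.Dart} {w' : k'.Dart} {hw hw'} :
    SequencedHypermap.Iso (link k w hw).toSeq (link k' w' hw').toSeq ↔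
      ∃ φ : k.Dart ≃ k'.Dart, HypermapDecomposition.IsoVia k k' φ ∧ w' = φ w := by
  refine join_iso_iff.trans (exists_congr fun φ => ?_)
  rw [map_image_some_map, map_image_some_injective.eq_iff]
  unfold HypermapDecomposition.IsoVia
  tauto

theorem image_newVertex {k k' : SequencedHypermap} {φ : k.Dart ≃ k'.Dart}
    (hR : ∀ a, φ (k.R a) = k'.R (φ a)) (hr : k'.root = k.root.map φ) (w : k.Dart) :
    optionCongr φ '' newVertex k w = newVertex k' (φ w) := by
  rw [newVertex, newVertex, hr]
  refine image_orb _ (fun x => ?_) _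
  have hR' : ∀ a, φ (k.R⁻¹ a) = k'.R⁻¹ (φ a) := by
    intro a
    rw [Perm.eq_inv_iff_eq, ← hR]
    simp
  -- Writing `vertexPerm` as a ratio of two insertions, the second into the identity, makes its
  -- compatibility with `φ` follow from that of `extendPerm`.
  have h1 := (optionCongr_extendPerm φ (u := k.root) (σ := 1) (τ := 1)).2
    ⟨rfl, fun a => rfl⟩
  have h2 := (optionCongr_extendPerm φ (u := some w) (σ := k.R⁻¹) (τ := k'.R⁻¹)).2
    ⟨rfl, hR'⟩
  have e1 : vertexPerm k.root (some w) k.R⁻¹ =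
      extendPerm (some w) k.R⁻¹ * (extendPerm k.root 1)⁻¹ := by
    rw [extendPerm_mul_inv]; simp
  have e2 : vertexPerm (k.root.map φ) (some (φ w)) k'.R⁻¹ =
      extendPerm (some (φ w)) k'.R⁻¹ * (extendPerm (k.root.map φ) 1)⁻¹ := by
    rw [extendPerm_mul_inv]; simp
  rw [e1, e2]
  obtain ⟨x, rfl⟩ := (extendPerm k.root 1).surjective x
  rw [Perm.mul_apply, perm_inv_apply_self, h2, h1, Perm.mul_apply, perm_inv_apply_self]
  rfl

theorem markedLink_iso_iff {k k' : SequencedHypermap} {w : k.Dart} {w' : k'.Dart} {hw hw'} {j j' : ℕ}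
    {hj hj'} :
    SequencedHypermap.Iso (markedLink k w hw j hj).toSeq (markedLink k' w' hw' j' hj').toSeq ↔
      ∃ φ : k.Dart ≃ k'.Dart, HypermapDecomposition.IsoVia k k' φ ∧ w' = φ w ∧ j = j' := by
  refine join_iso_iff.trans (exists_congr fun φ => ?_)
  constructor
  · rintro ⟨hR, hL, hr, rfl, hM⟩
    rw [List.map_insertIdx, image_newVertex hR hr] at hM
    -- The marked list has no repetitions, so the position of the new vertex in it is determined.
    have hjj : j = j' := by
      have hnd := (markedLink k' (φ w) hw' j' hj').nodup
      change List.Nodup (List.insertIdx _ j' _) at hnd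
      have h1 : (List.insertIdx (k'.marked.map fun s => some '' s) j' (newVertex k' (φ w)))[j']? =
          some (newVertex k' (φ w)) := by
        rw [List.getElem?_insertIdx_self, if_pos (by simpa using hj')]
      have h2 : (List.insertIdx (k'.marked.map fun s => some '' s) j' (newVertex k' (φ w)))[j]? =
          some (newVertex k' (φ w)) := by
        rw [hM, List.getElem?_insertIdx_self, if_pos (by simpa using hj)]
      obtain ⟨h3, h4⟩ := List.getElem?_eq_some_iff.1 h1
      obtain ⟨h5, h6⟩ := List.getElem?_eq_some_iff.1 h2
      exact (hnd.getElem_inj_iff (hi := h5) (hj := h3)).1 (h6.trans h4.symm)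
    subst hjj
    have := List.insertIdx_injective _ _ hM
    rw [map_image_some_map, map_image_some_injective.eq_iff] at this
    exact ⟨⟨hR, hL, hr, this⟩, rfl, rfl⟩
  · rintro ⟨⟨hR, hL, hr, hm⟩, rfl, rfl⟩
    refine ⟨hR, hL, hr, rfl, ?_⟩
    rw [List.map_insertIdx, image_newVertex hR hr, map_image_some_map, hm]

theorem handle_iso_iff {k k' : SequencedHypermap} {w : k.Dart} {w' : k'.Dart} {s l h hw}
    {s' l' h' hw'} :
    SequencedHypermap.Iso (handle k w s l h hw).toSeq (handle k' w' s' l' h' hw').toSeq ↔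
      ∃ φ : k.Dart ≃ k'.Dart, HypermapDecomposition.IsoVia k k' φ ∧ w' = φ w := by
  refine join_iso_iff.trans (exists_congr fun φ => ?_)
  rw [map_image_some_map, map_image_some_injective.eq_iff]
  constructor
  · rintro ⟨hR, hL, hr, rfl, hl⟩
    -- The first marked vertex of `k` is not kept in the extension, but it is recovered as the
    -- vertex that contains `w`.
    refine ⟨⟨hR, hL, hr, ?_⟩, rfl⟩
    rw [h, h', List.map_cons, hl, eq_orb_of_mem_marked (h ▸ List.mem_cons_self) hw, image_orb φ hR,
      eq_orb_of_mem_marked (h' ▸ List.mem_cons_self) hw']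
  · rintro ⟨⟨hR, hL, hr, hm⟩, rfl⟩
    rw [h, h', List.map_cons, List.cons.injEq] at hm
    exact ⟨hR, hL, hr, rfl, hm.2⟩

end Extension

/-! ### Joining a new root to two hypermaps. -/

namespace Extension

theorem sumCongr_mul_inv {α β : Type} (σ τ : Perm α) (σ' τ' : Perm β) :
    (sumCongr σ σ' : Perm (α ⊕ β)) * (sumCongr τ τ' : Perm (α ⊕ β))⁻¹ =
      sumCongr (σ * τ⁻¹) (σ' * τ'⁻¹) := by
  ext (x | x) <;> rfl

theorem nonempty_sumSet {h₁ h₂ : SequencedHypermap} {M : List (Set h₁.Dart ⊕ Set h₂.Dart)}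
    (hM₁ : M.filterMap Sum.getLeft? = h₁.marked) (hM₂ : M.filterMap Sum.getRight? = h₂.marked)
    {x} (hx : x ∈ M) : (sumSet x).Nonempty := by
  rcases x with s | s
  · rw [← mem_filterMap_getLeft, hM₁] at hx
    exact (nonempty_of_mem_permOrbits (h₁.marked_vertex s hx)).image _
  · rw [← mem_filterMap_getRight, hM₂] at hx
    exact (nonempty_of_mem_permOrbits (h₂.marked_vertex s hx)).image _

/-- The root joins the dual of `h₁` and `h₂`; the list `M` interleaves the marked vertices
of the two hypermaps. -/
def split (h₁ h₂ : SequencedHypermap) (M : List (Set h₁.Dart ⊕ Set h₂.Dart))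
    (hM₁ : M.filterMap Sum.getLeft? = h₁.marked)
    (hM₂ : M.filterMap Sum.getRight? = h₂.marked) : Extension where
  Base := h₁.Dart ⊕ h₂.Dart
  finite_base := by
    have := h₁.finite_dart
    have := h₂.finite_dart
    infer_instance
  L := sumCongr (h₁.R * h₁.L) h₂.L
  F := sumCongr h₁.L (h₂.R * h₂.L)
  u := h₁.root.map Sum.inl
  w := h₂.root.map Sum.inr
  marked := M.map fun x => some '' sumSet x
  reach := by
    intro s hL hF hu hw
    rw [invariant_sumCongr] at hL hF
    have h1 := reach_root h₁ hL.1 hF.1 (by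
      rintro ⟨x, hx, hr⟩
      exact hu ⟨Sum.inl x, hx, by rw [← hr]; rfl⟩)
    have h2 := reach_root h₂ hF.2 hL.2 (by
      rintro ⟨x, hx, hr⟩
      exact hw ⟨Sum.inr x, hx, by rw [← hr]; rfl⟩)
    ext (x | x)
    · exact Set.ext_iff.1 h1 x
    · exact Set.ext_iff.1 h2 x
  nodup := by
    refine List.Nodup.map_on (fun x hx y _ hxy => ?_)
      (nodup_of_filterMap (hM₁ ▸ h₁.marked_nodup) (hM₂ ▸ h₂.marked_nodup))
    exact sumSet_inj (nonempty_sumSet hM₁ hM₂ hx) ((Option.some_injective _).image_injective hxy)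
  mem_permOrbits := by
    intro s hs
    obtain ⟨x, hx, rfl⟩ := List.mem_map.1 hs
    rw [sumCongr_mul_inv, mul_inv_face, face_mul_inv]
    rcases x with t | t
    · rw [← mem_filterMap_getLeft, hM₁] at hx
      rw [image_some_mem_permOrbits_vertexPerm, permOrbits_sumCongr]
      · left
        refine ⟨t, ?_, rfl⟩
        rw [permOrbits_inv]
        exact h₁.marked_vertex t hx
      · intro H
        obtain ⟨_, ⟨y, hy, rfl⟩, H⟩ := H
        rcases hroot : h₁.root with _ | z
        · simp [hroot] at H
        · rw [hroot, Option.map_some, Option.some_inj, Sum.inl.injEq] at H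
          exact root_notMem_image hx ⟨y, hy, by rw [hroot, H]⟩
      · intro H
        obtain ⟨_, ⟨y, hy, rfl⟩, H⟩ := H
        rcases hroot : h₂.root with _ | z <;> simp [hroot] at H
    · rw [← mem_filterMap_getRight, hM₂] at hx
      rw [image_some_mem_permOrbits_vertexPerm, permOrbits_sumCongr]
      · right
        exact ⟨t, h₂.marked_vertex t hx, rfl⟩
      · intro H
        obtain ⟨_, ⟨y, hy, rfl⟩, H⟩ := H
        rcases hroot : h₁.root with _ | z <;> simp [hroot] at H
      · intro H
        obtain ⟨_, ⟨y, hy, rfl⟩, H⟩ := H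
        rcases hroot : h₂.root with _ | z
        · simp [hroot] at H
        · rw [hroot, Option.map_some, Option.some_inj, Sum.inr.injEq] at H
          exact root_notMem_image hx ⟨y, hy, by rw [hroot, H]⟩
  none_notMem := by
    intro s hs
    obtain ⟨x, -, rfl⟩ := List.mem_map.1 hs
    exact none_notMem_image _

theorem exists_sumCongr {α β γ δ : Type} (ψ : α ⊕ β ≃ γ ⊕ δ)
    (hl : ∀ a, ∃ c, ψ (Sum.inl a) = Sum.inl c) (hr : ∀ b, ∃ d, ψ (Sum.inr b) = Sum.inr d) :
    ∃ (φ₁ : α ≃ γ) (φ₂ : β ≃ δ), ψ = sumCongr φ₁ φ₂ := by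
  choose f hf using hl
  choose g hg using hr
  have hfb : Function.Bijective f := by
    refine ⟨fun a a' h => ?_, fun c => ?_⟩
    · have : ψ (Sum.inl a) = ψ (Sum.inl a') := by rw [hf, hf, h]
      simpa using this
    · obtain ⟨a | b, hx⟩ := ψ.surjective (Sum.inl c)
      · exact ⟨a, by simpa [hf] using hx⟩
      · simp [hg] at hx
  have hgb : Function.Bijective g := by
    refine ⟨fun a a' h => ?_, fun c => ?_⟩
    · have : ψ (Sum.inr a) = ψ (Sum.inr a') := by rw [hg, hg, h]
      simpa using this
    · obtain ⟨a | b, hx⟩ := ψ.surjective (Sum.inr c)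
      · simp [hf] at hx
      · exact ⟨b, by simpa [hg] using hx⟩
  refine ⟨ofBijective f hfb, ofBijective g hgb, ?_⟩
  ext1 (a | b)
  · exact hf a
  · exact hg b

theorem forall_of_invariant {h : SequencedHypermap} {p : h.Dart → Prop}
    (hF : ∀ a, p ((h.R * h.L) a) ↔ p a) (hL : ∀ a, p (h.L a) ↔ p a) (hr : ∀ a ∈ h.root, p a)
    (a : h.Dart) : p a := by
  have := reach_root h (s := {a | p a}ᶜ) (Invariant.compl hF) (Invariant.compl hL) (by
    rintro ⟨x, hx, hxr⟩
    exact hx (hr x hxr.symm))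
  by_contra ha
  have h2 : a ∈ {a | p a}ᶜ := ha
  rw [this] at h2
  exact h2

section SplitIso
variable {h₁ h₂ h₁' h₂' : SequencedHypermap} {M : List (Set h₁.Dart ⊕ Set h₂.Dart)}
  {M' : List (Set h₁'.Dart ⊕ Set h₂'.Dart)} {hM₁ hM₂ hM₁' hM₂'}

/-- An isomorphism cannot mix the two summands: lying on the left after `ψ` is a property invariant
under both permutations, so by connectedness its truth on each summand is decided at the root there,
and `ψ` maps places to places. -/
theorem split_iso_iff :
    SequencedHypermap.Iso (split h₁ h₂ M hM₁ hM₂).toSeq (split h₁' h₂' M' hM₁' hM₂').toSeq ↔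
      ∃ (φ₁ : h₁.Dart ≃ h₁'.Dart) (φ₂ : h₂.Dart ≃ h₂'.Dart),
        HypermapDecomposition.IsoVia h₁ h₁' φ₁ ∧ HypermapDecomposition.IsoVia h₂ h₂' φ₂ ∧
          M' = M.map (Sum.map (fun s => φ₁ '' s) (fun s => φ₂ '' s)) := by
  rw [toSeq_iso_iff]
  constructor
  · rintro ⟨ψ, hψ⟩
    change h₁.Dart ⊕ h₂.Dart ≃ h₁'.Dart ⊕ h₂'.Dart at ψ
    obtain ⟨hL, hF, hu, hw, hM⟩ := hψ
    change ∀ a, ψ (sumCongr (h₁.R * h₁.L) h₂.L a) = sumCongr (h₁'.R * h₁'.L) h₂'.L (ψ a) at hL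
    change ∀ a, ψ (sumCongr h₁.L (h₂.R * h₂.L) a) = sumCongr h₁'.L (h₂'.R * h₂'.L) (ψ a) at hF
    change h₁'.root.map Sum.inl = (h₁.root.map Sum.inl).map ψ at hu
    change h₂'.root.map Sum.inr = (h₂.root.map Sum.inr).map ψ at hw
    change M'.map (fun x => some '' sumSet x) =
      (M.map fun x => some '' sumSet x).map fun s => optionCongr ψ '' s at hM
    have hside : ∀ (σ : Perm h₁'.Dart) (τ : Perm h₂'.Dart) x,
        (sumCongr σ τ x).isLeft = x.isLeft := by
      rintro σ τ (x | x) <;> rfl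
    have hl : ∀ a, (ψ (Sum.inl a)).isLeft = true := by
      refine forall_of_invariant (fun a => ?_) (fun a => ?_) (fun a ha => ?_)
      · rw [← hside (h₁'.R * h₁'.L) h₂'.L (ψ (Sum.inl a)), ← hL]; rfl
      · rw [← hside h₁'.L (h₂'.R * h₂'.L) (ψ (Sum.inl a)), ← hF]; rfl
      · rw [Option.mem_def] at ha
        rw [ha] at hu
        obtain ⟨b, -, hb⟩ := Option.map_eq_some_iff.1 hu
        rw [← hb]; rfl
    have hr : ∀ a, (ψ (Sum.inr a)).isLeft = false := by
      refine forall_of_invariant (fun a => ?_) (fun a => ?_) (fun a ha => ?_)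
      · rw [← hside h₁'.L (h₂'.R * h₂'.L) (ψ (Sum.inr a)), ← hF]; rfl
      · rw [← hside (h₁'.R * h₁'.L) h₂'.L (ψ (Sum.inr a)), ← hL]; rfl
      · rw [Option.mem_def] at ha
        rw [ha] at hw
        obtain ⟨b, -, hb⟩ := Option.map_eq_some_iff.1 hw
        rw [← hb]; rfl
    obtain ⟨φ₁, φ₂, rfl⟩ := exists_sumCongr ψ (fun a => Sum.isLeft_iff.1 (hl a))
      (fun b => Sum.isRight_iff.1 (by simpa using hr b))
    have hL₁ : ∀ a, φ₁ (h₁.L a) = h₁'.L (φ₁ a) := fun a => Sum.inl_injective (hF (Sum.inl a))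
    have hL₂ : ∀ a, φ₂ (h₂.L a) = h₂'.L (φ₂ a) := fun a => Sum.inr_injective (hL (Sum.inr a))
    have hF₁ : ∀ a, φ₁ (h₁.R (h₁.L a)) = h₁'.R (h₁'.L (φ₁ a)) :=
      fun a => Sum.inl_injective (hL (Sum.inl a))
    have hF₂ : ∀ a, φ₂ (h₂.R (h₂.L a)) = h₂'.R (h₂'.L (φ₂ a)) :=
      fun a => Sum.inr_injective (hF (Sum.inr a))
    have hM' : M' = M.map (Sum.map (fun s => φ₁ '' s) (fun s => φ₂ '' s)) := by
      have h1 : (M.map (Sum.map (fun s => φ₁ '' s) (fun s => φ₂ '' s))).map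
          (fun x => some '' sumSet x) = M'.map (fun x => some '' sumSet x) := by
        rw [hM, List.map_map, List.map_map]
        refine List.map_congr_left fun x _ => ?_
        simp only [Function.comp_apply]
        rw [image_optionCongr_image_some, image_sumSet]
      refine (map_inj_of_injOn (P := fun x => (sumSet x).Nonempty) ?_ ?_ ?_ h1).symm
      · exact fun x y hx _ h => sumSet_inj hx ((Option.some_injective _).image_injective h)
      · intro x hx
        obtain ⟨y, hy, rfl⟩ := List.mem_map.1 hx
        rw [← image_sumSet]
        exact (nonempty_sumSet hM₁ hM₂ hy).image _
      · exact fun x hx => nonempty_sumSet hM₁' hM₂' hx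
    refine ⟨φ₁, φ₂, ⟨fun a => ?_, hL₁, ?_, ?_⟩, ⟨fun a => ?_, hL₂, ?_, ?_⟩, hM'⟩
    · obtain ⟨a, rfl⟩ := h₁.L.surjective a
      rw [hF₁, hL₁]
    · refine Option.map_injective Sum.inl_injective (hu.trans ?_)
      rw [Option.map_map, Option.map_map]
      rfl
    · rw [← hM₁', ← hM₁, hM', filterMap_getLeft_map]
    · obtain ⟨a, rfl⟩ := h₂.L.surjective a
      rw [hF₂, hL₂]
    · refine Option.map_injective Sum.inr_injective (hw.trans ?_)
      rw [Option.map_map, Option.map_map]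
      rfl
    · rw [← hM₂', ← hM₂, hM', filterMap_getRight_map]
  · rintro ⟨φ₁, φ₂, ⟨hR₁, hL₁, hr₁, -⟩, ⟨hR₂, hL₂, hr₂, -⟩, hM⟩
    refine ⟨sumCongr φ₁ φ₂, ?_, ?_, ?_, ?_, ?_⟩
    · rintro (a | a)
      · exact congrArg Sum.inl ((hR₁ _).trans (congrArg _ (hL₁ a)))
      · exact congrArg Sum.inr (hL₂ a)
    · rintro (a | a)
      · exact congrArg Sum.inl (hL₁ a)
      · exact congrArg Sum.inr ((hR₂ _).trans (congrArg _ (hL₂ a)))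
    · change h₁'.root.map Sum.inl = (h₁.root.map Sum.inl).map (sumCongr φ₁ φ₂)
      rw [hr₁, Option.map_map, Option.map_map]
      rfl
    · change h₂'.root.map Sum.inr = (h₂.root.map Sum.inr).map (sumCongr φ₁ φ₂)
      rw [hr₂, Option.map_map, Option.map_map]
      rfl
    · change M'.map (fun x => some '' sumSet x) =
        (M.map fun x => some '' sumSet x).map fun s => optionCongr (sumCongr φ₁ φ₂) '' s
      rw [hM, List.map_map, List.map_map]
      refine List.map_congr_left fun x _ => ?_
      simp only [Function.comp_apply]
      rw [image_optionCongr_image_some, image_sumSet]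

end SplitIso

/-! ### Invariants that tell the four constructions apart. -/

section Kinds

/-- The base is connected and contains the places where the root is inserted. -/
def Connected (E : Extension) : Prop :=
  E.u ≠ none ∧ E.w ≠ none ∧ ∀ s : Set E.Base, Invariant E.L s → Invariant E.F s → s = ∅ ∨ s = Set.univ

/-- The two places where the root is inserted lie in one vertex of the base. -/
def IsLinked (E : Extension) : Prop := Linked E.u E.w (E.F * E.L⁻¹)

/-- The vertex containing the place `u` is marked. -/
def MarkedAt (E : Extension) : Prop := ∃ s ∈ E.marked, E.u ∈ s

variable {E E' : Extension} {ψ : E.Base ≃ E'.Base}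

theorem IsoVia.connected (h : IsoVia E E' ψ) (H : E.Connected) : E'.Connected := by
  obtain ⟨hL, hF, hu, hw, -⟩ := h
  obtain ⟨H1, H2, H3⟩ := H
  refine ⟨by simpa [hu] using H1, by simpa [hw] using H2, fun s hs hs' => ?_⟩
  obtain ⟨s, rfl⟩ := ψ.surjective.image_surjective s
  rw [invariant_image_iff ψ hL] at hs
  rw [invariant_image_iff ψ hF] at hs'
  rcases H3 s hs hs' with rfl | rfl
  · exact Or.inl (Set.image_empty _)
  · exact Or.inr (by simp)

theorem IsoVia.isLinked (h : IsoVia E E' ψ) (H : E.IsLinked) : E'.IsLinked := by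
  obtain ⟨a, ha, b, hb, hab⟩ := H
  refine ⟨ψ a, ?_, ψ b, ?_, (sameCycle_equiv ψ h.ratio a b).2 hab⟩
  · rw [h.2.2.1]; exact Option.mem_map_of_mem ψ ha
  · rw [h.2.2.2.1]; exact Option.mem_map_of_mem ψ hb

theorem IsoVia.markedAt (h : IsoVia E E' ψ) (H : E.MarkedAt) : E'.MarkedAt := by
  obtain ⟨s, hs, hus⟩ := H
  refine ⟨optionCongr ψ '' s, ?_, E.u, hus, ?_⟩
  · rw [h.2.2.2.2]
    exact List.mem_map_of_mem hs
  · rw [h.2.2.1]; rfl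

theorem connected_iff_of_iso (h : SequencedHypermap.Iso E.toSeq E'.toSeq) :
    E.Connected ↔ E'.Connected := by
  obtain ⟨ψ, hψ⟩ := toSeq_iso_iff.1 h
  obtain ⟨ψ', hψ'⟩ := toSeq_iso_iff.1 h.symm
  exact ⟨hψ.connected, hψ'.connected⟩

theorem isLinked_iff_of_iso (h : SequencedHypermap.Iso E.toSeq E'.toSeq) :
    E.IsLinked ↔ E'.IsLinked := by
  obtain ⟨ψ, hψ⟩ := toSeq_iso_iff.1 h
  obtain ⟨ψ', hψ'⟩ := toSeq_iso_iff.1 h.symm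
  exact ⟨hψ.isLinked, hψ'.isLinked⟩

theorem markedAt_iff_of_iso (h : SequencedHypermap.Iso E.toSeq E'.toSeq) :
    E.MarkedAt ↔ E'.MarkedAt := by
  obtain ⟨ψ, hψ⟩ := toSeq_iso_iff.1 h
  obtain ⟨ψ', hψ'⟩ := toSeq_iso_iff.1 h.symm
  exact ⟨hψ.markedAt, hψ'.markedAt⟩

/-- If one hypermap is empty, the corresponding place is `none`; otherwise the left summand is a
proper non-empty invariant set. -/
theorem not_connected_split {h₁ h₂ : SequencedHypermap} {M hM₁ hM₂} :
    ¬ (split h₁ h₂ M hM₁ hM₂).Connected := by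
  rintro ⟨hu, hw, H⟩
  change h₁.root.map Sum.inl ≠ none at hu
  change h₂.root.map Sum.inr ≠ none at hw
  rw [Ne, Option.map_eq_none_iff] at hu hw
  obtain ⟨a, ha⟩ := Option.ne_none_iff_exists'.1 hu
  obtain ⟨b, hb⟩ := Option.ne_none_iff_exists'.1 hw
  change ∀ s : Set (h₁.Dart ⊕ h₂.Dart), _ at H
  have hi : ∀ (σ : Perm h₁.Dart) (τ : Perm h₂.Dart),
      Invariant (sumCongr σ τ) (Set.range Sum.inl : Set (h₁.Dart ⊕ h₂.Dart)) := by
    rintro σ τ (x | x) <;> simp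
  rcases H (Set.range Sum.inl) (hi _ _) (hi _ _) with h0 | h0
  · have : Sum.inl a ∈ (Set.range Sum.inl : Set (h₁.Dart ⊕ h₂.Dart)) := ⟨a, rfl⟩
    rw [h0] at this
    exact this
  · have : Sum.inr b ∈ (Set.range Sum.inl : Set (h₁.Dart ⊕ h₂.Dart)) := h0 ▸ Set.mem_univ _
    simp at this

theorem not_isLinked_split {h₁ h₂ : SequencedHypermap} {M hM₁ hM₂} :
    ¬ (split h₁ h₂ M hM₁ hM₂).IsLinked := by
  rintro ⟨a, ha, b, hb, hab⟩
  change a ∈ h₁.root.map Sum.inl at ha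
  change b ∈ h₂.root.map Sum.inr at hb
  change Perm.SameCycle (α := h₁.Dart ⊕ h₂.Dart)
    (sumCongr h₁.L (h₂.R * h₂.L) * (sumCongr (h₁.R * h₁.L) h₂.L)⁻¹) a b at hab
  obtain ⟨a, -, rfl⟩ := Option.map_eq_some_iff.1 ha
  obtain ⟨b, -, rfl⟩ := Option.map_eq_some_iff.1 hb
  rw [sumCongr_mul_inv, ← mem_orb, orb_sumCongr_inl] at hab
  simp at hab

theorem connected_join {k : SequencedHypermap} {w : k.Dart} {M nd hm hn} :
    (join k w M nd hm hn).Connected := by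
  refine ⟨root_ne_none_of_mem w, Option.some_ne_none w, fun s hs hs' => ?_⟩
  refine transitive_iff.1 k.transitive s ?_ hs'
  have h1 : Invariant (k.R * k.L) s := hs
  have h2 : Invariant k.L s := hs'
  rw [← face_mul_inv k.toHypermap]
  exact h1.mul h2.inv

theorem isLinked_join {k : SequencedHypermap} {w : k.Dart} {M nd hm hn} :
    (join k w M nd hm hn).IsLinked ↔ w ∈ k.rootVertex := by
  rw [← linked_inv_iff, ← mul_inv_face]
  rfl

theorem isLinked_link {k : SequencedHypermap} {w : k.Dart} {hw} : (link k w hw).IsLinked :=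
  isLinked_join.2 hw

theorem isLinked_markedLink {k : SequencedHypermap} {w : k.Dart} {hw j hj} :
    (markedLink k w hw j hj).IsLinked :=
  isLinked_join.2 hw

theorem not_isLinked_handle {k : SequencedHypermap} {w : k.Dart} {s l h hw} :
    ¬ (handle k w s l h hw).IsLinked := fun H =>
  notMem_of_mem_rootVertex (isLinked_join.1 H) (h ▸ List.mem_cons_self) hw

theorem not_markedAt_link {k : SequencedHypermap} {w : k.Dart} {hw} :
    ¬ (link k w hw).MarkedAt := by
  rintro ⟨s, hs, hus⟩
  obtain ⟨s, hs', rfl⟩ := List.mem_map.1 hs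
  exact root_notMem_image hs' hus

theorem markedAt_markedLink {k : SequencedHypermap} {w : k.Dart} {hw j hj} :
    (markedLink k w hw j hj).MarkedAt := by
  refine ⟨newVertex k w, ?_, mem_orb_self _ _⟩
  exact (List.mem_insertIdx (hj.trans_eq (List.length_map _).symm)).2 (Or.inl rfl)

end Kinds

end Extension

/-! ### Every extension arises from one of the four constructions. -/

namespace Extension

theorem exists_iso_split (E : Extension) {α β : Type} [Finite α] [Finite β] {L₁ F₁ : Perm α}
    {L₂ F₂ : Perm β} {u : Option α} {w : Option β} (e : α ⊕ β ≃ E.Base)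
    (hL : ∀ x, e (sumCongr L₁ L₂ x) = E.L (e x)) (hF : ∀ x, e (sumCongr F₁ F₂ x) = E.F (e x))
    (hu : E.u = (u.map Sum.inl).map e) (hw : E.w = (w.map Sum.inr).map e) :
    ∃ h₁ h₂ M hM₁ hM₂, SequencedHypermap.Iso (split h₁ h₂ M hM₁ hM₂).toSeq E.toSeq := by
  have hratio : ∀ x, e (sumCongr (F₁ * L₁⁻¹) (F₂ * L₂⁻¹) x) = (E.F * E.L⁻¹) (e x) := by
    intro x
    rw [← sumCongr_mul_inv]
    obtain ⟨x, rfl⟩ := (sumCongr L₁ L₂).surjective x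
    rw [Perm.mul_apply]
    erw [perm_inv_apply_self]
    rw [hL, hF, Perm.mul_apply, perm_inv_apply_self]
  have hnl : ¬ E.IsLinked := by
    rintro ⟨a, ha, b, hb, hab⟩
    rw [hu] at ha
    rw [hw] at hb
    obtain ⟨_, ha', rfl⟩ := Option.map_eq_some_iff.1 ha
    obtain ⟨a, -, rfl⟩ := Option.map_eq_some_iff.1 ha'
    obtain ⟨_, hb', rfl⟩ := Option.map_eq_some_iff.1 hb
    obtain ⟨b, -, rfl⟩ := Option.map_eq_some_iff.1 hb'
    rw [sameCycle_equiv e hratio, ← mem_orb, orb_sumCongr_inl] at hab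
    simp at hab
  -- As the places are not linked, `u`, if present, lies in the root vertex. A marked vertex
  -- therefore avoids both places, so it is an orbit of the ratio and lies within one summand.
  have hmark : ∀ S ∈ E.marked, ∃ x : Set α ⊕ Set β, S = some '' (e '' sumSet x) ∧
      (∀ s, x = Sum.inl s → s ∈ permOrbits (F₁ * L₁⁻¹) ∧ ∀ a ∈ u, a ∉ s) ∧
      (∀ s, x = Sum.inr s → s ∈ permOrbits (F₂ * L₂⁻¹) ∧ ∀ a ∈ w, a ∉ s) := by
    intro S hS
    have huS : E.u ∉ S := by
      intro h
      have h1 := eq_orb (E.mem_permOrbits S hS) h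
      have hn := E.none_notMem S hS
      have h2 := orb_vertexPerm_of_not_linked hnl
      rcases hu' : E.u with _ | a
      · rw [hu'] at h; exact hn h
      · have h3 : E.u ∈ orb (vertexPerm E.u E.w (E.F * E.L⁻¹)) none := by
          rw [h2, hu']
          exact Or.inr ⟨a, Or.inl ⟨a, rfl, Perm.SameCycle.refl _ _⟩, rfl⟩
        rw [orb_eq_of_mem h3] at h1
        exact hn (h1 ▸ mem_orb_self _ _)
    obtain ⟨s, hs, rfl, hwS⟩ := exists_image_of_mem_permOrbits_vertexPerm
      (E.mem_permOrbits S hS) (E.none_notMem S hS) huS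
    rw [permOrbits_equiv e hratio] at hs
    obtain ⟨t, ht, rfl⟩ := hs
    rw [permOrbits_sumCongr] at ht
    rcases ht with ⟨s, hs, rfl⟩ | ⟨s, hs, rfl⟩
    · refine ⟨Sum.inl s, rfl, ?_, by simp⟩
      rintro _ ⟨⟩
      refine ⟨hs, fun a ha has => huS ?_⟩
      rw [hu, Option.mem_def.1 ha]
      exact ⟨_, ⟨_, ⟨a, has, rfl⟩, rfl⟩, rfl⟩
    · refine ⟨Sum.inr s, rfl, by simp, ?_⟩
      rintro _ ⟨⟩
      refine ⟨hs, fun a ha has => hwS ?_⟩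
      rw [hw, Option.mem_def.1 ha]
      exact ⟨_, ⟨_, ⟨a, has, rfl⟩, rfl⟩, rfl⟩
  obtain ⟨M, hM, hMP⟩ := exists_map_eq E.marked hmark
  have hMnd : M.Nodup := (hM ▸ E.nodup : (M.map _).Nodup).of_map
  have hiL := fun s => invariant_image_iff (s := s) e hL
  have hiF := fun s => invariant_image_iff (s := s) e hF
  let h₁ : SequencedHypermap := mkSeq F₁ L₁ u (M.filterMap Sum.getLeft?)
    (by
      intro s hF₁ hL₁ hus
      have := E.reach (e '' (Sum.inl '' s)) ?_ ?_ ?_ ?_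
      · simpa using this
      · rw [hiL, invariant_sumCongr, Set.preimage_image_eq _ Sum.inl_injective]
        exact ⟨hL₁, fun b => by simp⟩
      · rw [hiF, invariant_sumCongr, Set.preimage_image_eq _ Sum.inl_injective]
        exact ⟨hF₁, fun b => by simp⟩
      · rw [hu]
        rcases u with _ | a
        · simp
        · simpa using hus
      · rw [hw]
        rcases w with _ | a <;> simp)
    (hMnd.filterMap (by
      rintro (a | a) (b | b) c
      all_goals simp
      all_goals grind))
    (fun s hs => by
      rw [← permOrbits_inv, mul_inv_rev, inv_inv]
      exact ((hMP _ (mem_filterMap_getLeft.1 hs)).1 s rfl).1)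
    (fun s hs => ((hMP _ (mem_filterMap_getLeft.1 hs)).1 s rfl).2)
  let h₂ : SequencedHypermap := mkSeq L₂ F₂ w (M.filterMap Sum.getRight?)
    (by
      intro s hL₂ hF₂ hws
      have := E.reach (e '' (Sum.inr '' s)) ?_ ?_ ?_ ?_
      · simpa using this
      · rw [hiL, invariant_sumCongr, Set.preimage_image_eq _ Sum.inr_injective]
        exact ⟨fun b => by simp, hL₂⟩
      · rw [hiF, invariant_sumCongr, Set.preimage_image_eq _ Sum.inr_injective]
        exact ⟨fun b => by simp, hF₂⟩
      · rw [hu]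
        rcases u with _ | a <;> simp
      · rw [hw]
        rcases w with _ | a
        · simp
        · simpa using hws)
    (hMnd.filterMap (by
      rintro (a | a) (b | b) c
      all_goals simp
      all_goals grind))
    (fun s hs => ((hMP _ (mem_filterMap_getRight.1 hs)).2 s rfl).1)
    (fun s hs => ((hMP _ (mem_filterMap_getRight.1 hs)).2 s rfl).2)
  refine ⟨h₁, h₂, M, rfl, rfl, toSeq_iso_iff.2 ⟨e, ?_, ?_, hu, hw, ?_⟩⟩
  · intro x
    refine (congrArg e ?_).trans (hL x)
    change sumCongr (L₁ * F₁⁻¹ * F₁) L₂ x = _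
    rw [inv_mul_cancel_right]
  · intro x
    refine (congrArg e ?_).trans (hF x)
    change sumCongr F₁ (F₂ * L₂⁻¹ * L₂) x = _
    rw [inv_mul_cancel_right]
  · change E.marked = (M.map fun x => some '' sumSet x).map fun s => optionCongr e '' s
    rw [hM, List.map_map]
    refine List.map_congr_left fun x _ => ?_
    exact (image_optionCongr_image_some e _).symm

theorem exists_marked_eq (E : Extension) {l : List (Set (Option E.Base))} (hl : ∀ s ∈ l, s ∈ E.marked)
    (hu : ∀ s ∈ l, E.u ∉ s) : ∃ M : List (Set E.Base), l = M.map (fun s => some '' s) ∧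
      ∀ s ∈ M, s ∈ permOrbits (E.F * E.L⁻¹) ∧ E.u ∉ some '' s ∧ E.w ∉ some '' s := by
  refine exists_map_eq l fun S hS => ?_
  obtain ⟨s, hs, rfl, hwS⟩ := exists_image_of_mem_permOrbits_vertexPerm
    (E.mem_permOrbits S (hl S hS)) (E.none_notMem S (hl S hS)) (hu S hS)
  exact ⟨s, rfl, hs, hu _ hS, hwS⟩

/-- The hypermap on the base of a connected extension. -/
def base (E : Extension)
    (reach : ∀ s : Set E.Base, Invariant E.F s → Invariant E.L s → E.u ∉ some '' s → s = ∅)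
    (M : List (Set E.Base)) (nodup : M.Nodup)
    (hM : ∀ s ∈ M, s ∈ permOrbits (E.F * E.L⁻¹) ∧ E.u ∉ some '' s) : SequencedHypermap :=
  mkSeq E.F E.L E.u M reach nodup
    (fun s hs => by
      rw [← permOrbits_inv, mul_inv_rev, inv_inv]
      exact (hM s hs).1)
    (fun s hs x hx hxs => (hM s hs).2 ⟨x, hxs, hx.symm⟩)

theorem join_iso (E : Extension) {reach M nd hM} {w : E.Base} (hw : E.w = some w) {M' nd' hm' hn'}
    (hMM : M' = E.marked) :
    SequencedHypermap.Iso (join (base E reach M nd hM) w M' nd' hm' hn').toSeq E.toSeq := by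
  refine toSeq_iso_iff.2 ⟨Equiv.refl _, ?_, ?_, ?_, ?_, ?_⟩
  · intro a
    change (E.L * E.F⁻¹ * E.F) a = E.L a
    rw [inv_mul_cancel_right]
  · intro a
    rfl
  · change E.u = E.u.map id
    simp
  · exact hw
  · change E.marked = M'.map fun s => optionCongr (Equiv.refl E.Base) '' s
    rw [hMM]
    simp

/-- The dual of the base, rooted at `u`, is a hypermap. Whether `w` lies in its root vertex, and
whether the vertex through `u` in the extension is marked, decides between the three alternatives.
-/
theorem exists_iso_of_reach (E : Extension)
    (reach : ∀ s : Set E.Base, Invariant E.F s → Invariant E.L s → E.u ∉ some '' s → s = ∅)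
    {a b : E.Base} (ha : E.u = some a) (hb : E.w = some b) :
    (∃ k w hw, SequencedHypermap.Iso (link k w hw).toSeq E.toSeq) ∨
    (∃ k w hw j hj, SequencedHypermap.Iso (markedLink k w hw j hj).toSeq E.toSeq) ∨
    (∃ k w s l h hw, SequencedHypermap.Iso (handle k w s l h hw).toSeq E.toSeq) := by
  have hinv : (E.L * E.F⁻¹)⁻¹ = E.F * E.L⁻¹ := by simp
  by_cases hlink : E.IsLinked
  · have hab : (E.F * E.L⁻¹).SameCycle a b := by
      obtain ⟨a', ha', b', hb', h⟩ := hlink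
      rw [ha, Option.mem_some_iff] at ha'
      rw [hb, Option.mem_some_iff] at hb'
      subst ha' hb'
      exact h
    have hroot : ∀ {M nd hM}, b ∈ (base E reach M nd hM).rootVertex := by
      intro M nd hM
      refine ⟨a, ha, ?_⟩
      change (E.L * E.F⁻¹).SameCycle a b
      rw [← Perm.sameCycle_inv, hinv]
      exact hab
    by_cases hmk : E.MarkedAt
    · obtain ⟨S, hS, huS⟩ := hmk
      obtain ⟨j, hj, hjS⟩ := List.getElem_of_mem hS
      have hsub : ∀ s ∈ E.marked.eraseIdx j, s ∈ E.marked := fun s hs => List.mem_of_mem_eraseIdx hs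
      -- Once `S` is taken out of the list, no remaining marked vertex contains `u`, since distinct
      -- orbits are disjoint.
      obtain ⟨M, hM, hMP⟩ := exists_marked_eq E hsub (by
        intro s hs hus
        have h1 : s = S := by
          rw [eq_orb (E.mem_permOrbits s (hsub s hs)) hus, eq_orb (E.mem_permOrbits S hS) huS]
        subst h1
        obtain ⟨i, hi, hne, his⟩ := List.mem_eraseIdx_iff_getElem.1 hs
        exact hne ((E.nodup.getElem_inj_iff).1 (his.trans hjS.symm)))
      have hnd : M.Nodup := by
        have := E.nodup.sublist (List.eraseIdx_sublist E.marked j)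
        rw [hM] at this
        exact this.of_map
      refine Or.inr (Or.inl ⟨base E reach M hnd fun s hs => ⟨(hMP s hs).1, (hMP s hs).2.1⟩, b,
        hroot, j, ?_, ?_⟩)
      · change j ≤ M.length
        have := congrArg List.length hM
        rw [List.length_eraseIdx, if_pos hj, List.length_map] at this
        omega
      · refine join_iso E hb ?_
        change (M.map fun s => some '' s).insertIdx j
          (orb (vertexPerm E.u (some b) (E.L * E.F⁻¹)⁻¹) E.u) = E.marked
        rw [← hM, hinv, ← hb, ← eq_orb (E.mem_permOrbits S hS) huS, ← hjS,
          List.insertIdx_eraseIdx_getElem]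
    · obtain ⟨M, hM, hMP⟩ := exists_marked_eq E (fun s hs => hs) (fun s hs hus => hmk ⟨s, hs, hus⟩)
      refine Or.inl ⟨base E reach M (hM ▸ E.nodup : (M.map _).Nodup).of_map
        fun s hs => ⟨(hMP s hs).1, (hMP s hs).2.1⟩, b, hroot, ?_⟩
      exact join_iso E hb hM.symm
  · have hab : ¬ (E.F * E.L⁻¹).SameCycle a b := fun h => hlink ⟨a, ha, b, hb, h⟩
    obtain ⟨M, hM, hMP⟩ := exists_marked_eq E (fun s hs => hs) (by
      intro s hs hus
      have h1 := eq_orb (E.mem_permOrbits s hs) hus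
      have h3 : E.u ∈ orb (vertexPerm E.u E.w (E.F * E.L⁻¹)) none := by
        rw [orb_vertexPerm_of_not_linked hlink, ha]
        exact Or.inr ⟨a, Or.inl ⟨a, rfl, Perm.SameCycle.refl _ _⟩, rfl⟩
      rw [orb_eq_of_mem h3] at h1
      exact E.none_notMem s hs (h1 ▸ mem_orb_self _ _))
    -- The vertex of `w` in the base, absorbed by the root vertex, is remembered at the head of the
    -- marked list.
    refine Or.inr (Or.inr ⟨base E reach (orb (E.F * E.L⁻¹) b :: M) ?_ ?_, b, _, M, rfl,
      mem_orb_self _ _, join_iso E hb hM.symm⟩)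
    · refine List.nodup_cons.2 ⟨fun h => ?_, (hM ▸ E.nodup : (M.map _).Nodup).of_map⟩
      exact (hMP _ h).2.2 ⟨b, mem_orb_self _ _, hb.symm⟩
    · intro s hs
      rcases List.mem_cons.1 hs with rfl | hs
      · refine ⟨orb_mem_permOrbits _ _, ?_⟩
        rw [ha]
        rintro ⟨x, hx, hxa⟩
        rw [Option.some_inj] at hxa
        subst hxa
        exact hab (Perm.SameCycle.symm hx)
      · exact ⟨(hMP s hs).1, (hMP s hs).2.1⟩

theorem exists_decomposition (E : Extension) :
    (∃ h₁ h₂ M hM₁ hM₂, SequencedHypermap.Iso (split h₁ h₂ M hM₁ hM₂).toSeq E.toSeq) ∨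
    (∃ k w hw, SequencedHypermap.Iso (link k w hw).toSeq E.toSeq) ∨
    (∃ k w hw j hj, SequencedHypermap.Iso (markedLink k w hw j hj).toSeq E.toSeq) ∨
    (∃ k w s l h hw, SequencedHypermap.Iso (handle k w s l h hw).toSeq E.toSeq) := by
  classical
  -- `C` is the component of `u`, the intersection of all invariant sets that contain it; it is
  -- empty when `u = none`.
  obtain ⟨C, hCL, hCF, huC, hmin⟩ : ∃ C : Set E.Base, Invariant E.L C ∧ Invariant E.F C ∧
      (∀ a ∈ E.u, a ∈ C) ∧
      ∀ s, Invariant E.L s → Invariant E.F s → E.u ∉ some '' s → ∀ b ∈ C, b ∉ s := by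
    refine ⟨{b | ∀ s, Invariant E.L s → Invariant E.F s → (∀ a ∈ E.u, a ∈ s) → b ∈ s}, ?_, ?_, ?_, ?_⟩
    · intro b
      exact forall_congr' fun s => forall_congr' fun hs => by rw [hs b]
    · intro b
      exact forall_congr' fun s => forall_congr' fun _ => forall_congr' fun hs => by rw [hs b]
    · intro a ha s _ _ h
      exact h a ha
    · intro s hs hs' hu b hb
      exact hb sᶜ hs.compl hs'.compl fun a ha has => hu ⟨a, has, ha.symm⟩
  by_cases hw : E.w ∈ some '' C
  · right
    obtain ⟨b, hbC, hb⟩ := hw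
    have huniv : Cᶜ = ∅ := E.reach _ hCL.compl hCF.compl
      (by rintro ⟨x, hx, hxu⟩; exact hx (huC x hxu.symm))
      (by rw [← hb]; rintro ⟨x, hx, hxb⟩; rw [Option.some_inj] at hxb; exact hx (hxb ▸ hbC))
    have huniv' : ∀ a, a ∈ C := fun a => by
      rw [Set.compl_empty_iff] at huniv
      rw [huniv]; trivial
    have hreach : ∀ s : Set E.Base, Invariant E.F s → Invariant E.L s → E.u ∉ some '' s → s = ∅ := by
      intro s hF hL hu
      exact Set.eq_empty_of_forall_notMem fun x => hmin s hL hF hu x (huniv' x)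
    rcases ha : E.u with _ | a
    · have := hreach Set.univ (fun _ => Iff.rfl) (fun _ => Iff.rfl) (by rw [ha]; simp)
      exact absurd (Set.mem_univ b) (this ▸ Set.notMem_empty b)
    · exact exists_iso_of_reach E hreach ha hb.symm
  · left
    obtain ⟨u, hu⟩ : ∃ u : Option {x // x ∈ C}, E.u = u.map Subtype.val := by
      rcases h : E.u with _ | a
      · exact ⟨none, rfl⟩
      · exact ⟨some ⟨a, huC a h⟩, rfl⟩
    obtain ⟨w, hw⟩ : ∃ w : Option {x // x ∉ C}, E.w = w.map Subtype.val := by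
      rcases h : E.w with _ | a
      · exact ⟨none, rfl⟩
      · exact ⟨some ⟨a, fun ha => hw ⟨a, ha, h.symm⟩⟩, rfl⟩
    refine exists_iso_split E (L₁ := E.L.subtypePerm hCL) (F₁ := E.F.subtypePerm hCF)
      (L₂ := E.L.subtypePerm hCL.compl) (F₂ := E.F.subtypePerm hCF.compl) (u := u) (w := w)
      (Equiv.sumCompl (· ∈ C)) ?_ ?_ ?_ ?_
    · rintro (x | x) <;> rfl
    · rintro (x | x) <;> rfl
    · rw [hu, Option.map_map]; rfl
    · rw [hw, Option.map_map]; rfl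

end Extension

/-! ### The parameters of the four constructions. -/

open Classical in
theorem numFaces_eq_add (h : SequencedHypermap) :
    h.numFaces = numOrbits (h.R * h.L) + if h.root = none then 1 else 0 := by
  by_cases hr : h.root = none
  · have := h.root_eq_none hr
    rw [numFaces_of_isEmpty, numOrbits_of_isEmpty, if_pos hr]
  · obtain ⟨a, ha⟩ := Option.ne_none_iff_exists'.1 hr
    have : Nonempty h.Dart := ⟨a⟩
    rw [numFaces_eq, if_neg hr, add_zero]

open Classical in
theorem numVertices_eq_add (h : SequencedHypermap) :
    h.numVertices = numOrbits h.R + if h.root = none then 1 else 0 := by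
  by_cases hr : h.root = none
  · have := h.root_eq_none hr
    rw [numVertices_of_isEmpty, numOrbits_of_isEmpty, if_pos hr]
  · obtain ⟨a, ha⟩ := Option.ne_none_iff_exists'.1 hr
    have : Nonempty h.Dart := ⟨a⟩
    rw [numVertices_eq, if_neg hr, add_zero]

theorem ncard_image_some {α : Type} (s : Set α) : (some '' s).ncard = s.ncard :=
  Set.ncard_image_of_injective s (Option.some_injective α)

theorem ncard_insert_none {α : Type} [Finite α] (s : Set α) :
    (insert none (some '' s) : Set (Option α)).ncard = s.ncard + 1 := by
  rw [Set.ncard_insert_of_notMem (none_notMem_image s) (Set.toFinite _), ncard_image_some]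

theorem ncard_inl_union_inr {α β : Type} [Finite α] [Finite β] (s : Set α) (t : Set β) :
    (Sum.inl '' s ∪ Sum.inr '' t).ncard = s.ncard + t.ncard := by
  rw [Set.ncard_union_eq _ (Set.toFinite _) (Set.toFinite _),
    Set.ncard_image_of_injective _ Sum.inl_injective,
    Set.ncard_image_of_injective _ Sum.inr_injective]
  rw [Set.disjoint_left]
  rintro _ ⟨a, -, rfl⟩ ⟨b, -, h⟩
  simp at h

namespace Extension

theorem ncard_rootVertex_toSeq (E : Extension) : E.toSeq.rootVertex.ncard =
    (orb (vertexPerm E.u E.w (E.F * E.L⁻¹)) none : Set (Option E.Base)).ncard :=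
  congrArg Set.ncard E.rootVertex_toSeq

section Split
variable {h₁ h₂ : SequencedHypermap} {M : List (Set h₁.Dart ⊕ Set h₂.Dart)} {hM₁ hM₂}

theorem numDarts_split :
    (split h₁ h₂ M hM₁ hM₂).toSeq.numDarts = h₁.numDarts + h₂.numDarts + 1 := by
  have := h₁.finite_dart
  have := h₂.finite_dart
  rw [numDarts_toSeq]
  exact congrArg (· + 1) Nat.card_sum

/-- If `h₁` is empty, the one face it has by convention accounts for the hyperedge formed by the new
root alone. -/
theorem numHyperedges_split :
    (split h₁ h₂ M hM₁ hM₂).toSeq.numHyperedges = h₁.numFaces + h₂.numHyperedges := by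
  classical
  have := h₁.finite_dart
  have := h₂.finite_dart
  rw [numHyperedges_toSeq, numFaces_eq_add, numHyperedges_eq]
  have h1 : numOrbits (split h₁ h₂ M hM₁ hM₂).L = numOrbits (h₁.R * h₁.L) + numOrbits h₂.L :=
    numOrbits_sumCongr _ _
  have h2 : (split h₁ h₂ M hM₁ hM₂).u = none ↔ h₁.root = none := Option.map_eq_none_iff
  simp only [h1, h2]
  omega

theorem numFaces_split :
    (split h₁ h₂ M hM₁ hM₂).toSeq.numFaces = h₁.numHyperedges + h₂.numFaces := by
  classical
  have := h₁.finite_dart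
  have := h₂.finite_dart
  rw [numFaces_toSeq, numFaces_eq_add, numHyperedges_eq]
  have h1 : numOrbits (split h₁ h₂ M hM₁ hM₂).F = numOrbits h₁.L + numOrbits (h₂.R * h₂.L) :=
    numOrbits_sumCongr _ _
  have h2 : (split h₁ h₂ M hM₁ hM₂).w = none ↔ h₂.root = none := Option.map_eq_none_iff
  simp only [h1, h2]
  omega

/-- The two root vertices and the new root merge into a single vertex; an empty hypermap contributes
its conventional vertex of degree `0`. -/
theorem numVertices_split :
    (split h₁ h₂ M hM₁ hM₂).toSeq.numVertices + 1 = h₁.numVertices + h₂.numVertices := by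
  classical
  have := h₁.finite_dart
  have := h₂.finite_dart
  rw [numVertices_toSeq, numOrbits_vertexPerm_of_not_linked not_isLinked_split, numVertices_eq_add,
    numVertices_eq_add]
  have h1 : numOrbits ((split h₁ h₂ M hM₁ hM₂).F * (split h₁ h₂ M hM₁ hM₂).L⁻¹) =
      numOrbits h₁.R + numOrbits h₂.R := by
    rw [← numOrbits_inv h₁.R, ← mul_inv_face, ← face_mul_inv h₂.toHypermap, ← numOrbits_sumCongr,
      ← sumCongr_mul_inv]
    rfl
  have h2 : (split h₁ h₂ M hM₁ hM₂).u = none ↔ h₁.root = none := Option.map_eq_none_iff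
  have h3 : (split h₁ h₂ M hM₁ hM₂).w = none ↔ h₂.root = none := Option.map_eq_none_iff
  simp only [h1, h2, h3]
  omega

theorem ncard_rootVertex_split :
    (split h₁ h₂ M hM₁ hM₂).toSeq.rootVertex.ncard =
      h₁.rootVertex.ncard + h₂.rootVertex.ncard + 1 := by
  have := h₁.finite_dart
  have := h₂.finite_dart
  have := (split h₁ h₂ M hM₁ hM₂).finite_base
  rw [ncard_rootVertex_toSeq, orb_vertexPerm_of_not_linked not_isLinked_split, ncard_insert_none]
  have hρ : (split h₁ h₂ M hM₁ hM₂).F * (split h₁ h₂ M hM₁ hM₂).L⁻¹ =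
      sumCongr h₁.R⁻¹ h₂.R := by
    rw [← mul_inv_face, ← face_mul_inv h₂.toHypermap, ← sumCongr_mul_inv]
    rfl
  have h1 : {b | ∃ a ∈ (split h₁ h₂ M hM₁ hM₂).u,
      ((split h₁ h₂ M hM₁ hM₂).F * (split h₁ h₂ M hM₁ hM₂).L⁻¹).SameCycle a b} =
        Sum.inl '' h₁.rootVertex := by
    rw [hρ]
    change {b | ∃ a ∈ h₁.root.map Sum.inl, b ∈ orb (sumCongr h₁.R⁻¹ h₂.R) a} = _
    rcases hr : h₁.root with _ | a
    · simp [SequencedHypermap.rootVertex, hr]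
    · rw [rootVertex_of_root_eq_some hr, ← orb_inv, ← orb_sumCongr_inl _ h₂.R]
      simp
  have h2 : {b | ∃ a ∈ (split h₁ h₂ M hM₁ hM₂).w,
      ((split h₁ h₂ M hM₁ hM₂).F * (split h₁ h₂ M hM₁ hM₂).L⁻¹).SameCycle a b} =
        Sum.inr '' h₂.rootVertex := by
    rw [hρ]
    change {b | ∃ a ∈ h₂.root.map Sum.inr, b ∈ orb (sumCongr h₁.R⁻¹ h₂.R) a} = _
    rcases hr : h₂.root with _ | a
    · simp [SequencedHypermap.rootVertex, hr]
    · rw [rootVertex_of_root_eq_some hr, ← orb_sumCongr_inr h₁.R⁻¹]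
      simp
  rw [h1, h2]
  exact congrArg (· + 1) (ncard_inl_union_inr _ _)

theorem degrees_split :
    (split h₁ h₂ M hM₁ hM₂).toSeq.marked.map (fun s => (s.ncard : ℤ)) =
      M.map (Sum.elim (fun s => (s.ncard : ℤ)) (fun s => (s.ncard : ℤ))) := by
  refine (List.map_map ..).trans (List.map_congr_left fun x _ => ?_)
  rcases x with s | s
  · change (((some '' (Sum.inl '' s)).ncard : ℕ) : ℤ) = s.ncard
    rw [ncard_image_some, Set.ncard_image_of_injective _ Sum.inl_injective]
  · change (((some '' (Sum.inr '' s)).ncard : ℕ) : ℤ) = s.ncard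
    rw [ncard_image_some, Set.ncard_image_of_injective _ Sum.inr_injective]

end Split

section Join
variable {k : SequencedHypermap} {w : k.Dart} {M nd hm hn}

theorem numDarts_join : (join k w M nd hm hn).toSeq.numDarts = k.numDarts + 1 :=
  numDarts_toSeq _

theorem numHyperedges_join : (join k w M nd hm hn).toSeq.numHyperedges = k.numFaces := by
  have : Nonempty k.Dart := ⟨w⟩
  rw [numHyperedges_toSeq, numFaces_eq, if_neg (show (join k w M nd hm hn).u ≠ none from
    root_ne_none_of_mem w)]
  rfl

theorem numFaces_join : (join k w M nd hm hn).toSeq.numFaces = k.numHyperedges := by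
  rw [numFaces_toSeq, if_neg (show (join k w M nd hm hn).w ≠ none from Option.some_ne_none w)]
  rfl

theorem ratio_join : (join k w M nd hm hn).F * (join k w M nd hm hn).L⁻¹ = k.R⁻¹ :=
  mul_inv_face k.toHypermap

theorem numVertices_join_of_mem (hw : w ∈ k.rootVertex) :
    (join k w M nd hm hn).toSeq.numVertices = k.numVertices + 1 := by
  have : Nonempty k.Dart := ⟨w⟩
  rw [numVertices_toSeq, numOrbits_vertexPerm_of_linked (isLinked_join.2 hw), ratio_join,
    numVertices_eq]
  exact congrArg (· + 1) (numOrbits_inv k.R)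

theorem numVertices_join_of_notMem (hw : w ∉ k.rootVertex) :
    (join k w M nd hm hn).toSeq.numVertices + 1 = k.numVertices := by
  have : Nonempty k.Dart := ⟨w⟩
  rw [numVertices_toSeq, numOrbits_vertexPerm_of_not_linked (mt isLinked_join.1 hw), ratio_join,
    numVertices_eq, if_neg (show (join k w M nd hm hn).u ≠ none from root_ne_none_of_mem w),
    if_neg (show (join k w M nd hm hn).w ≠ none from Option.some_ne_none w)]
  exact numOrbits_inv k.R

theorem ncard_rootVertex_join : (join k w M nd hm hn).toSeq.rootVertex.ncard =
    (orb (vertexPerm k.root (some w) k.R⁻¹) none).ncard := by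
  rw [ncard_rootVertex_toSeq, ratio_join]
  rfl

theorem ncard_rootVertex_join_of_iterate {a : k.Dart} (ha : k.root = some a) {n : ℕ} (h0 : 0 < n)
    (hn' : n ≤ k.rootVertex.ncard) (hw : (⇑k.R⁻¹)^[n] a = w) :
    (join k w M nd hm hn).toSeq.rootVertex.ncard = n := by
  have := k.finite_dart
  rw [ncard_rootVertex_join, ha]
  refine (congrArg Set.ncard ?_).trans (ncard_orb_vertexPerm_of_iterate (ρ := k.R⁻¹) (a := a) h0 ?_)
  · rw [hw]
  · rwa [orb_inv, ← rootVertex_of_root_eq_some ha]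

/-- The new root vertex and the new vertex partition the old root vertex together with the new root.
-/
theorem ncard_rootVertex_add_ncard_newVertex (hw : w ∈ k.rootVertex) :
    (join k w M nd hm hn).toSeq.rootVertex.ncard + (newVertex k w).ncard =
      k.rootVertex.ncard + 1 := by
  have := k.finite_dart
  have hnone := none_notMem_newVertex hw
  obtain ⟨a, ha, haw⟩ := hw
  rw [Option.mem_def] at ha
  have h1 := orb_union_vertexPerm_of_linked (Perm.sameCycle_inv.2 haw)
  rw [newVertex] at hnone
  rw [ncard_rootVertex_join, newVertex, rootVertex_of_root_eq_some ha, ← ncard_insert_none,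
    ← orb_inv k.R, ← h1, ha]
  refine (Set.ncard_union_eq ?_ (Set.toFinite _) (Set.toFinite _)).symm
  rw [Set.disjoint_left]
  intro x hx hx'
  rw [ha] at hnone
  refine hnone ?_
  rw [← orb_eq_of_mem hx', orb_eq_of_mem hx]
  exact mem_orb_self _ _

theorem ncard_rootVertex_join_of_notMem (hw : w ∉ k.rootVertex) :
    (join k w M nd hm hn).toSeq.rootVertex.ncard =
      k.rootVertex.ncard + (orb k.R w).ncard + 1 := by
  have := k.finite_dart
  have hnl : ¬ Linked k.root (some w) k.R⁻¹ := mt linked_inv_iff.1 hw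
  rw [ncard_rootVertex_join, orb_vertexPerm_of_not_linked hnl, ncard_insert_none]
  have h1 : {b | ∃ a ∈ k.root, (k.R⁻¹).SameCycle a b} = k.rootVertex := by
    ext b
    simp [SequencedHypermap.rootVertex]
  have h2 : {b | ∃ a ∈ some w, (k.R⁻¹).SameCycle a b} = orb k.R w := by
    ext b
    simp [mem_orb]
  rw [h1, h2, Set.ncard_union_eq _ (Set.toFinite _) (Set.toFinite _)]
  rw [Set.disjoint_left]
  rintro b ⟨a, ha, hab⟩ hb
  exact hw ⟨a, ha, hab.trans (Perm.SameCycle.symm hb)⟩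

end Join

theorem degrees_map_image_some {k : SequencedHypermap} (l : List (Set k.Dart)) :
    (l.map fun s => some '' s).map (fun s => (s.ncard : ℤ)) = l.map fun s => (s.ncard : ℤ) := by
  rw [List.map_map]
  refine List.map_congr_left fun s _ => ?_
  rw [Function.comp_apply, ncard_image_some]

theorem degrees_link {k : SequencedHypermap} {w : k.Dart} {hw} :
    (link k w hw).toSeq.marked.map (fun s => (s.ncard : ℤ)) =
      k.marked.map fun s => (s.ncard : ℤ) :=
  degrees_map_image_some _

theorem degrees_markedLink {k : SequencedHypermap} {w : k.Dart} {hw j hj} :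
    (markedLink k w hw j hj).toSeq.marked.map (fun s => (s.ncard : ℤ)) =
      (k.marked.map fun s => (s.ncard : ℤ)).insertIdx j ((newVertex k w).ncard : ℤ) :=
  (List.map_insertIdx ..).trans
    (congrArg (fun l => l.insertIdx j ((newVertex k w).ncard : ℤ)) (degrees_map_image_some k.marked))

theorem degrees_handle {k : SequencedHypermap} {w : k.Dart} {s l h hw} :
    (handle k w s l h hw).toSeq.marked.map (fun s => (s.ncard : ℤ)) =
      l.map fun s => (s.ncard : ℤ) :=
  degrees_map_image_some _

theorem notMem_rootVertex_of_marked {k : SequencedHypermap} {w : k.Dart} {s : Set k.Dart}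
    (hs : s ∈ k.marked) (hw : w ∈ s) : w ∉ k.rootVertex :=
  fun H => notMem_of_mem_rootVertex H hs hw

theorem hasGenus_split {h₁ h₂ : SequencedHypermap} {M hM₁ hM₂} {g₁ g₂ g : ℤ}
    (H₁ : h₁.HasGenus g₁) (H₂ : h₂.HasGenus g₂) :
    (split h₁ h₂ M hM₁ hM₂).toSeq.HasGenus g ↔ g = g₁ + g₂ := by
  unfold Hypermap.HasGenus at *
  have h1 := numVertices_split (hM₁ := hM₁) (hM₂ := hM₂)
  rw [numDarts_split, numHyperedges_split, numFaces_split]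
  omega

/-- A join adds one dart and exchanges the numbers of faces and hyperedges, so the vertices decide:
one more vertex, as here, keeps the genus, and one fewer raises it by one. -/
theorem hasGenus_join_of_mem {k : SequencedHypermap} {w : k.Dart} {M nd hm hn}
    (hw : w ∈ k.rootVertex) {g : ℤ} :
    (join k w M nd hm hn).toSeq.HasGenus g ↔ k.HasGenus g := by
  unfold Hypermap.HasGenus at *
  rw [numDarts_join, numHyperedges_join, numFaces_join, numVertices_join_of_mem hw]
  omega

theorem hasGenus_join_of_notMem {k : SequencedHypermap} {w : k.Dart} {M nd hm hn}
    (hw : w ∉ k.rootVertex) {g : ℤ} :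
    (join k w M nd hm hn).toSeq.HasGenus g ↔ k.HasGenus (g - 1) := by
  unfold Hypermap.HasGenus at *
  have := numVertices_join_of_notMem (nd := nd) (hm := hm) (hn := hn) hw
  rw [numDarts_join, numHyperedges_join, numFaces_join]
  omega

end Extension

theorem hasGenus_of_iso {h k : SequencedHypermap} (H : SequencedHypermap.Iso h k) {g : ℤ}
    (hg : h.HasGenus g) : k.HasGenus g :=
  ((hasParams_iff_of_iso H).1 ⟨hg, rfl, rfl, rfl, rfl, rfl⟩).1

theorem numDarts_of_iso {h k : SequencedHypermap} (H : SequencedHypermap.Iso h k) :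
    k.numDarts = h.numDarts := by
  obtain ⟨φ, -⟩ := H
  exact (Nat.card_congr φ).symm

/-- The first sum is indexed by natural numbers, so each part of a split must have a non-negative
integral genus. This follows by induction on the number of darts along the decomposition itself. -/
theorem exists_hasGenus (h : SequencedHypermap) : ∃ g : ℕ, h.HasGenus g := by
  induction hn : h.numDarts using Nat.strong_induction_on generalizing h with
  | _ n ih =>
    subst hn
    by_cases hr : h.root = none
    · have := h.root_eq_none hr
      refine ⟨0, ?_⟩
      rw [Hypermap.HasGenus, numVertices_of_isEmpty, numFaces_of_isEmpty, numHyperedges_eq,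
        numOrbits_of_isEmpty, Hypermap.numDarts, Nat.card_of_isEmpty]
      norm_num
    · obtain ⟨E, hE⟩ := Extension.exists_iso_toSeq h hr
      rcases E.exists_decomposition with ⟨h₁, h₂, M, hM₁, hM₂, H⟩ | ⟨k, w, hw, H⟩ |
        ⟨k, w, hw, j, hj, H⟩ | ⟨k, w, s, l, hk, hw, H⟩
      all_goals
        replace H := H.trans hE
        have hd := numDarts_of_iso H
      · rw [Extension.numDarts_split] at hd
        obtain ⟨g₁, hg₁⟩ := ih h₁.numDarts (by omega) h₁ rfl
        obtain ⟨g₂, hg₂⟩ := ih h₂.numDarts (by omega) h₂ rfl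
        exact ⟨g₁ + g₂, hasGenus_of_iso H ((Extension.hasGenus_split hg₁ hg₂).2 (by push_cast; rfl))⟩
      · rw [Extension.link, Extension.numDarts_join] at hd
        obtain ⟨g, hg⟩ := ih k.numDarts (by omega) k rfl
        exact ⟨g, hasGenus_of_iso H ((Extension.hasGenus_join_of_mem hw).2 hg)⟩
      · rw [Extension.markedLink, Extension.numDarts_join] at hd
        obtain ⟨g, hg⟩ := ih k.numDarts (by omega) k rfl
        exact ⟨g, hasGenus_of_iso H ((Extension.hasGenus_join_of_mem hw).2 hg)⟩
      · rw [Extension.handle, Extension.numDarts_join] at hd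
        obtain ⟨g, hg⟩ := ih k.numDarts (by omega) k rfl
        refine ⟨g + 1, hasGenus_of_iso H ((Extension.hasGenus_join_of_notMem
          (Extension.notMem_rootVertex_of_marked (hk ▸ List.mem_cons_self) hw)).2 ?_)⟩
        simpa using hg

/-! ### Interleavings of two lists and sublists of `D`. -/

section Interleave
variable {α β : Type}

/-- The positions of `M` that hold an element of the first kind are those in `S`. -/
def HasPattern (M : List (α ⊕ β)) (N : ℕ) (S : Finset (Fin N)) : Prop :=
  M.map Sum.isLeft = List.ofFn fun i : Fin N => decide (i ∈ S)

theorem HasPattern.unique {M : List (α ⊕ β)} {N : ℕ} {S S' : Finset (Fin N)}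
    (h : HasPattern M N S) (h' : HasPattern M N S') : S = S' := by
  have := List.ofFn_injective (h.symm.trans h')
  ext i
  simpa using congrFun this i

theorem exists_hasPattern (M : List (α ⊕ β)) {N : ℕ} (hN : M.length = N) :
    ∃ S, HasPattern M N S := by
  subst hN
  refine ⟨Finset.univ.filter fun i => (M[i]).isLeft = true, ?_⟩
  refine List.ext_getElem (by simp) fun i h1 h2 => ?_
  simp

theorem hasPattern_map {γ δ : Type} (f : α → γ) (g : β → δ) {M : List (α ⊕ β)} {N : ℕ}
    {S : Finset (Fin N)} : HasPattern (M.map (Sum.map f g)) N S ↔ HasPattern M N S := by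
  unfold HasPattern
  rw [List.map_map]
  have : (Sum.isLeft ∘ Sum.map f g : α ⊕ β → Bool) = Sum.isLeft := by
    ext (x | x) <;> rfl
  rw [this]

theorem eq_of_filterMap_eq {M M' : List (α ⊕ β)} (h : M.map Sum.isLeft = M'.map Sum.isLeft)
    (h₁ : M.filterMap Sum.getLeft? = M'.filterMap Sum.getLeft?)
    (h₂ : M.filterMap Sum.getRight? = M'.filterMap Sum.getRight?) : M = M' := by
  induction M generalizing M' with
  | nil => simpa using h.symm
  | cons x M ih =>
    rcases M' with _ | ⟨y, M'⟩
    · simp at h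
    · rw [List.map_cons, List.map_cons, List.cons.injEq] at h
      rcases x with x | x <;> rcases y with y | y
      · simp only [List.filterMap_cons, Sum.getLeft?_inl, Sum.getRight?_inl, List.cons.injEq]
          at h₁ h₂
        rw [h₁.1, ih h.2 h₁.2 h₂]
      · simp at h
      · simp at h
      · simp only [List.filterMap_cons, Sum.getLeft?_inr, Sum.getRight?_inr, List.cons.injEq]
          at h₁ h₂
        rw [h₂.1, ih h.2 h₁ h₂.2]

/-- The set of positions in the tail of a list. -/
def tailSet {N : ℕ} (S : Finset (Fin (N + 1))) : Finset (Fin N) :=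
  Finset.univ.filter fun i => i.succ ∈ S

theorem tailSet_compl {N : ℕ} (S : Finset (Fin (N + 1))) : tailSet Sᶜ = (tailSet S)ᶜ := by
  ext i
  simp [tailSet]

theorem filter_finRange_succ {N : ℕ} (S : Finset (Fin (N + 1))) :
    (List.finRange (N + 1)).filter (fun i => decide (i ∈ S)) =
      (if (0 : Fin (N + 1)) ∈ S then [0] else []) ++
        ((List.finRange N).filter (fun i => decide (i ∈ tailSet S))).map Fin.succ := by
  rw [List.finRange_succ, List.filter_cons, List.filter_map]
  have : (fun i : Fin (N + 1) => decide (i ∈ S)) ∘ Fin.succ = fun i => decide (i ∈ tailSet S) := by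
    ext i
    simp [tailSet]
  rw [this]
  split_ifs <;> simp_all

theorem sublistAt_cons (d : ℤ) (D : List ℤ) (S : Finset (Fin (d :: D).length)) :
    sublistAt (d :: D) S =
      if (0 : Fin (D.length + 1)) ∈ S then d :: sublistAt D (tailSet S)
      else sublistAt D (tailSet S) := by
  have h := filter_finRange_succ (N := D.length) S
  have h2 : sublistAt (d :: D) S =
      (((if (0 : Fin (D.length + 1)) ∈ S then [0] else []) ++
        ((List.finRange D.length).filter (fun i => decide (i ∈ tailSet S))).map Fin.succ) :
          List (Fin (D.length + 1))).map (d :: D).get := congrArg (List.map (d :: D).get) h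
  rw [h2, List.map_append, List.map_map]
  have h3 : (d :: D).get ∘ Fin.succ = D.get := rfl
  rw [h3]
  split_ifs <;> rfl

theorem hasPattern_cons {x : α ⊕ β} {M : List (α ⊕ β)} {N : ℕ} {S : Finset (Fin (N + 1))} :
    HasPattern (x :: M) (N + 1) S ↔
      (x.isLeft = true ↔ (0 : Fin (N + 1)) ∈ S) ∧ HasPattern M N (tailSet S) := by
  unfold HasPattern
  rw [List.map_cons, List.ofFn_succ, List.cons.injEq]
  refine and_congr ?_ ?_
  · rw [Bool.eq_iff_iff, decide_eq_true_iff]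
  · simp [tailSet]

theorem map_filterMap_of_hasPattern {f : α → ℤ} {g : β → ℤ} {M : List (α ⊕ β)} {D : List ℤ}
    (hD : M.map (Sum.elim f g) = D) {S : Finset (Fin D.length)} (hS : HasPattern M D.length S) :
    (M.filterMap Sum.getLeft?).map f = sublistAt D S ∧
      (M.filterMap Sum.getRight?).map g = sublistAt D Sᶜ := by
  induction M generalizing D with
  | nil => subst hD; exact ⟨rfl, rfl⟩
  | cons x M ih =>
    subst hD
    obtain ⟨h1, h2⟩ := hasPattern_cons.1 hS
    obtain ⟨h3, h4⟩ := ih rfl h2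
    have e1 := sublistAt_cons (Sum.elim f g x) (M.map (Sum.elim f g)) S
    have e2 := sublistAt_cons (Sum.elim f g x) (M.map (Sum.elim f g)) Sᶜ
    have hc : (0 : Fin ((M.map (Sum.elim f g)).length + 1)) ∈ Sᶜ ↔
        ¬ (0 : Fin ((M.map (Sum.elim f g)).length + 1)) ∈ S := Finset.mem_compl
    have ht : tailSet Sᶜ = (tailSet S)ᶜ := tailSet_compl S
    rw [if_congr hc rfl rfl, ht] at e2
    rw [← h3] at e1
    rw [← h4] at e2
    rcases x with x | x
    · have h0 := h1.1 rfl
      rw [if_pos h0] at e1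
      rw [if_neg (not_not.2 h0)] at e2
      exact ⟨e1.symm, e2.symm⟩
    · have h0 : ¬ (0 : Fin ((M.map (Sum.elim f g)).length + 1)) ∈ S := fun h => by
        simpa using h1.2 h
      rw [if_neg h0] at e1
      rw [if_pos h0] at e2
      exact ⟨e1.symm, e2.symm⟩

/-- The set `S` dictates from which list each entry is drawn; `eq_of_filterMap_eq` provides the
uniqueness of the result. -/
theorem exists_interleave {f : α → ℤ} {g : β → ℤ} {D : List ℤ} {S : Finset (Fin D.length)}
    {l : List α} {m : List β} (hl : l.map f = sublistAt D S) (hm : m.map g = sublistAt D Sᶜ) :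
    ∃ M : List (α ⊕ β), M.map (Sum.elim f g) = D ∧ HasPattern M D.length S ∧
      M.filterMap Sum.getLeft? = l ∧ M.filterMap Sum.getRight? = m := by
  induction D generalizing l m with
  | nil =>
    have hl' : l = [] := by simpa [sublistAt] using hl
    have hm' : m = [] := by simpa [sublistAt] using hm
    subst hl' hm'
    exact ⟨[], rfl, rfl, rfl, rfl⟩
  | cons d D ih =>
    rw [sublistAt_cons] at hl hm
    have hc : (0 : Fin (D.length + 1)) ∈ Sᶜ ↔ ¬ (0 : Fin (D.length + 1)) ∈ S := Finset.mem_compl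
    have ht : tailSet Sᶜ = (tailSet S)ᶜ := tailSet_compl S
    rw [if_congr hc rfl rfl, ht] at hm
    by_cases h0 : (0 : Fin (D.length + 1)) ∈ S
    · rw [if_pos h0] at hl
      rw [if_neg (not_not.2 h0)] at hm
      rcases l with _ | ⟨x, l⟩
      · simp at hl
      rw [List.map_cons, List.cons.injEq] at hl
      obtain ⟨M, h1, h2, h3, h4⟩ := ih hl.2 hm
      refine ⟨Sum.inl x :: M, ?_, hasPattern_cons.2 ⟨?_, h2⟩, ?_, ?_⟩
      · rw [List.map_cons, h1, Sum.elim_inl, hl.1]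
      · simpa using h0
      · simp [h3]
      · simp [List.filterMap_cons, h4]
    · rw [if_neg h0] at hl
      rw [if_pos h0] at hm
      rcases m with _ | ⟨x, m⟩
      · simp at hm
      rw [List.map_cons, List.cons.injEq] at hm
      obtain ⟨M, h1, h2, h3, h4⟩ := ih hl hm.2
      refine ⟨Sum.inr x :: M, ?_, hasPattern_cons.2 ⟨?_, h2⟩, ?_, ?_⟩
      · rw [List.map_cons, h1, Sum.elim_inr, hm.1]
      · simpa using h0
      · simp [List.filterMap_cons, h3]
      · simp [h4]

end Interleave

/-! ### Isomorphism classes and their parameters. -/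

/-- The isomorphism class of a sequenced hypermap. -/
def cls (h : SequencedHypermap) : SequencedHypermapClass :=
  Quotient.mk SequencedHypermap.isoSetoid h

theorem cls_eq_iff {h k : SequencedHypermap} : cls h = cls k ↔ SequencedHypermap.Iso h k :=
  ⟨fun H => Quotient.exact H, fun H => Quotient.sound H⟩

/-- A representative of an isomorphism class. -/
noncomputable def rep (c : SequencedHypermapClass) : SequencedHypermap := Quotient.out c

theorem cls_rep (c : SequencedHypermapClass) : cls (rep c) = c := Quotient.out_eq c

theorem cls_mem_iff {h : SequencedHypermap} {g t f e n : ℤ} {D : List ℤ} :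
    cls h ∈ seqHypermaps g t f e n D ↔ h.HasParams g t f e n D := mk_mem_seqHypermaps

theorem hasParams_of_cls_eq {h : SequencedHypermap} {g t f e n : ℤ} {D : List ℤ}
    {c : seqHypermaps g t f e n D} (H : cls h = c.1) : h.HasParams g t f e n D :=
  cls_mem_iff.1 (H ▸ c.2)

theorem hasParams_unique {h : SequencedHypermap} {g t f e n g' t' f' e' n' : ℤ} {D D' : List ℤ}
    (H : h.HasParams g t f e n D) (H' : h.HasParams g' t' f' e' n' D') :
    g = g' ∧ t = t' ∧ f = f' ∧ e = e' ∧ n = n' ∧ D = D' := by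
  obtain ⟨h1, h2, h3, h4, h5, h6⟩ := H
  obtain ⟨h1', h2', h3', h4', h5', h6'⟩ := H'
  unfold Hypermap.HasGenus at h1 h1'
  exact ⟨by omega, by omega, by omega, by omega, by omega, h6.symm.trans h6'⟩

theorem ncard_rootVertex_pos {h : SequencedHypermap} (a : h.Dart) : 0 < h.rootVertex.ncard := by
  have := h.finite_dart
  obtain ⟨r, hr⟩ := Option.ne_none_iff_exists'.1 (root_ne_none_of_mem a)
  rw [rootVertex_of_root_eq_some hr, Set.ncard_pos (Set.toFinite _)]
  exact ⟨r, mem_orb_self _ _⟩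

theorem ncard_rootVertex_le {h : SequencedHypermap} : h.rootVertex.ncard ≤ h.numDarts := by
  have := h.finite_dart
  rw [Hypermap.numDarts, ← Set.ncard_univ]
  exact Set.ncard_le_ncard (Set.subset_univ _) (Set.toFinite _)

theorem exists_root_of_ncard_pos {h : SequencedHypermap} (H : 0 < h.rootVertex.ncard) :
    ∃ a, h.root = some a := by
  rw [← Option.ne_none_iff_exists']
  intro hr
  have : h.rootVertex = ∅ := by simp [SequencedHypermap.rootVertex, hr]
  rw [this, Set.ncard_empty] at H
  exact lt_irrefl _ H

namespace Extension

theorem iterate_mem_rootVertex {k : SequencedHypermap} {a : k.Dart} (ha : k.root = some a) (m : ℕ) :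
    (⇑k.R⁻¹)^[m] a ∈ k.rootVertex := by
  rw [rootVertex_of_root_eq_some ha, ← orb_inv]
  exact ⟨m, by rw [zpow_natCast, Perm.iterate_eq_pow]⟩

theorem exists_iterate_of_mem_rootVertex {k : SequencedHypermap} {a w : k.Dart}
    (ha : k.root = some a) (hw : w ∈ k.rootVertex) :
    ∃ m, 0 < m ∧ m ≤ k.rootVertex.ncard ∧ (⇑k.R⁻¹)^[m] a = w := by
  have := k.finite_dart
  rw [rootVertex_of_root_eq_some ha, ← orb_inv] at hw ⊢
  exact exists_iterate_of_sameCycle hw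

section Params
variable {g t f e n : ℤ} {D : List ℤ}

theorem hasParams_split {h₁ h₂ : SequencedHypermap} {M hM₁ hM₂}
    {g₁ t₁ f₁ e₁ n₁ g₂ t₂ f₂ e₂ n₂ : ℤ} {D₁ D₂ : List ℤ}
    (H₁ : h₁.HasParams g₁ t₁ f₁ e₁ n₁ D₁) (H₂ : h₂.HasParams g₂ t₂ f₂ e₂ n₂ D₂) :
    (split h₁ h₂ M hM₁ hM₂).toSeq.HasParams (g₁ + g₂) (t₁ + t₂ + 1) (e₁ + f₂) (f₁ + e₂)
      (n₁ + n₂ + 1) (M.map (Sum.elim (fun s => (s.ncard : ℤ)) (fun s => (s.ncard : ℤ)))) := by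
  obtain ⟨h1, h2, h3, h4, h5, -⟩ := H₁
  obtain ⟨h1', h2', h3', h4', h5', -⟩ := H₂
  refine ⟨(hasGenus_split h1 h1').2 rfl, ?_, ?_, ?_, ?_, degrees_split⟩
  · rw [numDarts_split]; push_cast; omega
  · rw [numFaces_split]; push_cast; omega
  · rw [numHyperedges_split]; push_cast; omega
  · rw [ncard_rootVertex_split]; push_cast; omega

theorem hasParams_handle_iff {k : SequencedHypermap} {w : k.Dart} {s l h hw} :
    (handle k w s l h hw).toSeq.HasParams g t f e n D ↔
      k.HasParams (g - 1) (t - 1) e f (n - 1 - s.ncard) (s.ncard :: D) := by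
  have hs : s ∈ k.marked := h ▸ List.mem_cons_self
  have hw' := notMem_rootVertex_of_marked hs hw
  unfold SequencedHypermap.HasParams
  rw [degrees_handle, h, List.map_cons, List.cons.injEq]
  refine and_congr (hasGenus_join_of_notMem hw') (and_congr ?_ ?_)
  · rw [handle, numDarts_join]; push_cast; omega
  have h1 : (handle k w s l h hw).toSeq.rootVertex.ncard = k.rootVertex.ncard + s.ncard + 1 := by
    have h0 := eq_orb_of_mem_marked hs hw
    exact (ncard_rootVertex_join_of_notMem hw').trans (by rw [← h0])
  have h2 : (handle k w s l h hw).toSeq.numFaces = k.numHyperedges := numFaces_join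
  have h3 : (handle k w s l h hw).toSeq.numHyperedges = k.numFaces := numHyperedges_join
  rw [h1, h2, h3]
  push_cast
  constructor
  · rintro ⟨h1, h2, h3, h4⟩; exact ⟨h2, h1, by omega, rfl, h4⟩
  · rintro ⟨h1, h2, h3, -, h4⟩; exact ⟨h2, h1, by omega, h4⟩

theorem hasParams_link_iff {k : SequencedHypermap} {a w : k.Dart} {hw} (ha : k.root = some a)
    {m : ℕ} (h0 : 0 < m) (hm : m ≤ k.rootVertex.ncard) (haw : (⇑k.R⁻¹)^[m] a = w) :
    (link k w hw).toSeq.HasParams g t f e n D ↔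
      n = m ∧ k.HasParams g (t - 1) e f k.rootVertex.ncard D := by
  unfold SequencedHypermap.HasParams
  have hg : (link k w hw).toSeq.HasGenus g ↔ k.HasGenus g := hasGenus_join_of_mem hw
  have h1 : (link k w hw).toSeq.rootVertex.ncard = m :=
    ncard_rootVertex_join_of_iterate ha h0 hm haw
  have h2 : (link k w hw).toSeq.numFaces = k.numHyperedges := numFaces_join
  have h3 : (link k w hw).toSeq.numHyperedges = k.numFaces := numHyperedges_join
  have h4 : (link k w hw).toSeq.numDarts = k.numDarts + 1 := numDarts_join
  rw [degrees_link, hg, h1, h2, h3, h4]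
  push_cast
  constructor
  · rintro ⟨H1, H2, H3, H4, H5, H6⟩; exact ⟨H5.symm, H1, by omega, H4, H3, rfl, H6⟩
  · rintro ⟨H5, H1, H2, H4, H3, -, H6⟩; exact ⟨H1, by omega, H3, H4, H5.symm, H6⟩

theorem hasParams_markedLink_iff {k : SequencedHypermap} {a w : k.Dart} {hw j hj}
    (ha : k.root = some a) {m : ℕ} (h0 : 0 < m) (hm : m ≤ k.rootVertex.ncard)
    (haw : (⇑k.R⁻¹)^[m] a = w) :
    (markedLink k w hw j hj).toSeq.HasParams g t f e n D ↔
      n = m ∧ D[j]? = some (k.rootVertex.ncard + 1 - n) ∧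
        k.HasParams g (t - 1) e f k.rootVertex.ncard (D.eraseIdx j) := by
  unfold SequencedHypermap.HasParams
  have hg : (markedLink k w hw j hj).toSeq.HasGenus g ↔ k.HasGenus g := hasGenus_join_of_mem hw
  have h1 : (markedLink k w hw j hj).toSeq.rootVertex.ncard = m :=
    ncard_rootVertex_join_of_iterate ha h0 hm haw
  have h2 : (markedLink k w hw j hj).toSeq.numFaces = k.numHyperedges := numFaces_join
  have h3 : (markedLink k w hw j hj).toSeq.numHyperedges = k.numFaces := numHyperedges_join
  have h4 : (markedLink k w hw j hj).toSeq.numDarts = k.numDarts + 1 := numDarts_join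
  have h5 : (markedLink k w hw j hj).toSeq.rootVertex.ncard + (newVertex k w).ncard =
      k.rootVertex.ncard + 1 := ncard_rootVertex_add_ncard_newVertex hw
  rw [h1] at h5
  rw [degrees_markedLink, hg, h1, h2, h3, h4]
  push_cast
  constructor
  · rintro ⟨H1, H2, H3, H4, rfl, rfl⟩
    refine ⟨rfl, ?_, H1, by omega, H4, H3, rfl, ?_⟩
    · rw [List.getElem?_insertIdx_self, if_pos (by simpa using hj), Option.some_inj]
      omega
    · rw [List.eraseIdx_insertIdx_self]
  · rintro ⟨rfl, H5, H1, H2, H4, H3, -, H6⟩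
    refine ⟨H1, by omega, H3, H4, rfl, ?_⟩
    obtain ⟨hj', hjD⟩ := List.getElem?_eq_some_iff.1 H5
    have h6 : ((newVertex k w).ncard : ℤ) = D[j] := by rw [hjD]; omega
    rw [H6, h6, List.insertIdx_eraseIdx_getElem]

end Params

open Classical in
/-- The kind of an extension, which decides the term of the decomposition it belongs to. -/
noncomputable def kind (E : Extension) : ℕ :=
  if ¬ E.Connected then 0 else if ¬ E.IsLinked then 1 else if ¬ E.MarkedAt then 2 else 3

open Classical in
theorem kind_eq_of_iso {E E' : Extension} (h : SequencedHypermap.Iso E.toSeq E'.toSeq) :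
    E.kind = E'.kind := by
  exact if_congr (not_congr (connected_iff_of_iso h)) rfl
    (if_congr (not_congr (isLinked_iff_of_iso h)) rfl
      (if_congr (not_congr (markedAt_iff_of_iso h)) rfl rfl))

theorem kind_split {h₁ h₂ : SequencedHypermap} {M hM₁ hM₂} : (split h₁ h₂ M hM₁ hM₂).kind = 0 :=
  if_pos not_connected_split

theorem kind_handle {k : SequencedHypermap} {w : k.Dart} {s l h hw} :
    (handle k w s l h hw).kind = 1 := by
  rw [kind, if_neg (not_not.2 (show (handle k w s l h hw).Connected from connected_join)),
    if_pos not_isLinked_handle]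

theorem kind_link {k : SequencedHypermap} {w : k.Dart} {hw} : (link k w hw).kind = 2 := by
  rw [kind, if_neg (not_not.2 (show (link k w hw).Connected from connected_join)),
    if_neg (not_not.2 isLinked_link), if_pos not_markedAt_link]

theorem kind_markedLink {k : SequencedHypermap} {w : k.Dart} {hw j hj} :
    (markedLink k w hw j hj).kind = 3 := by
  rw [kind, if_neg (not_not.2 (show (markedLink k w hw j hj).Connected from connected_join)),
    if_neg (not_not.2 isLinked_markedLink), if_neg (not_not.2 markedAt_markedLink)]

end Extension

open Extension

/-- The kind of a class of sequenced hypermaps; the empty hypermap has a kind of its own. -/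
def HasKind (c : SequencedHypermapClass) (i : ℕ) : Prop :=
  (i = 4 ∧ c = cls SequencedHypermap.empty) ∨ ∃ E : Extension, c = cls E.toSeq ∧ E.kind = i

theorem not_iso_empty (E : Extension) : ¬ SequencedHypermap.Iso SequencedHypermap.empty E.toSeq := by
  rintro ⟨φ, -, -, hr, -⟩
  have h1 : E.toSeq.root = some none := rfl
  rw [h1] at hr
  cases hr

theorem HasKind.unique {c : SequencedHypermapClass} {i j : ℕ} (hi : HasKind c i)
    (hj : HasKind c j) : i = j := by
  rcases hi with ⟨rfl, hi⟩ | ⟨E, hi, rfl⟩ <;> rcases hj with ⟨rfl, hj⟩ | ⟨E', hj, rfl⟩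
  · rfl
  · exact (not_iso_empty E' (cls_eq_iff.1 (hi.symm.trans hj))).elim
  · exact (not_iso_empty E (cls_eq_iff.1 (hj.symm.trans hi))).elim
  · exact kind_eq_of_iso (cls_eq_iff.1 (hi.symm.trans hj))

/-! ### The relations between the four terms and the isomorphism classes. -/

section Relations
variable {g t f e n : ℤ} {D : List ℤ}

/-- The classes obtained from an element of the first term. -/
def SplitRel (x : SplitTerm g t f e n D) (c : SequencedHypermapClass) : Prop :=
  ∃ h₁ h₂ M hM₁ hM₂, cls h₁ = x.2.1.1 ∧ cls h₂ = x.2.2.1 ∧ HasPattern M D.length x.1.S ∧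
    c = cls (split h₁ h₂ M hM₁ hM₂).toSeq

theorem SplitRel.hasKind {x : SplitTerm g t f e n D} {c} (h : SplitRel x c) : HasKind c 0 := by
  obtain ⟨h₁, h₂, M, hM₁, hM₂, -, -, -, rfl⟩ := h
  exact Or.inr ⟨_, rfl, kind_split⟩

theorem SplitRel.exists (x : SplitTerm g t f e n D) :
    ∃ c ∈ seqHypermaps g t f e n D, SplitRel x c := by
  obtain ⟨i, c₁, c₂⟩ := x
  have H₁ := hasParams_of_cls_eq (cls_rep c₁.1)
  have H₂ := hasParams_of_cls_eq (cls_rep c₂.1)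
  obtain ⟨M, hM, hS, hM₁, hM₂⟩ := exists_interleave H₁.2.2.2.2.2 H₂.2.2.2.2.2
  refine ⟨_, ?_, _, _, M, hM₁, hM₂, cls_rep c₁.1, cls_rep c₂.1, hS, rfl⟩
  rw [cls_mem_iff]
  have := hasParams_split (hM₁ := hM₁) (hM₂ := hM₂) H₁ H₂
  rw [hM] at this
  have e1 := i.hg
  have e2 := i.ht
  have e3 := i.he
  have e4 := i.hf
  have e5 := i.hn
  convert this using 1 <;> omega

theorem SplitRel.right_unique {x : SplitTerm g t f e n D} {c c'} (h : SplitRel x c)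
    (h' : SplitRel x c') : c = c' := by
  obtain ⟨h₁, h₂, M, hM₁, hM₂, e₁, e₂, hS, rfl⟩ := h
  obtain ⟨h₁', h₂', M', hM₁', hM₂', e₁', e₂', hS', rfl⟩ := h'
  obtain ⟨φ₁, hφ₁⟩ := cls_eq_iff.1 (e₁.trans e₁'.symm)
  obtain ⟨φ₂, hφ₂⟩ := cls_eq_iff.1 (e₂.trans e₂'.symm)
  refine cls_eq_iff.2 (split_iso_iff.2 ⟨φ₁, φ₂, hφ₁, hφ₂, ?_⟩)
  refine eq_of_filterMap_eq ?_ ?_ ?_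
  · exact hS'.trans ((hasPattern_map _ _).2 hS).symm
  · rw [hM₁', filterMap_getLeft_map, hM₁, hφ₁.2.2.2]
  · rw [hM₂', filterMap_getRight_map, hM₂, hφ₂.2.2.2]

theorem SplitRel.left_unique {x y : SplitTerm g t f e n D} {c} (h : SplitRel x c)
    (h' : SplitRel y c) : x = y := by
  obtain ⟨i, c₁, c₂⟩ := x
  obtain ⟨i', c₁', c₂'⟩ := y
  obtain ⟨h₁, h₂, M, hM₁, hM₂, e₁, e₂, hS, rfl⟩ := h
  obtain ⟨h₁', h₂', M', hM₁', hM₂', e₁', e₂', hS', hc⟩ := h'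
  obtain ⟨φ₁, φ₂, hφ₁, hφ₂, rfl⟩ := split_iso_iff.1 (cls_eq_iff.1 hc)
  have E₁ : c₁.1 = c₁'.1 := e₁.symm.trans ((cls_eq_iff.2 ⟨φ₁, hφ₁⟩).trans e₁')
  have E₂ : c₂.1 = c₂'.1 := e₂.symm.trans ((cls_eq_iff.2 ⟨φ₂, hφ₂⟩).trans e₂')
  obtain ⟨p1, p2, p3, p4, p5, -⟩ :=
    hasParams_unique (hasParams_of_cls_eq (e₁.trans E₁)) (hasParams_of_cls_eq e₁)
  obtain ⟨q1, q2, q3, q4, q5, -⟩ :=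
    hasParams_unique (hasParams_of_cls_eq (e₂.trans E₂)) (hasParams_of_cls_eq e₂)
  dsimp only at p1 p2 p3 p4 p5 q1 q2 q3 q4 q5
  have hi : i = i' := by
    ext1
    all_goals first | omega | exact hS.unique ((hasPattern_map _ _).1 hS')
  subst hi
  rw [Subtype.ext E₁, Subtype.ext E₂]

theorem SplitRel.of_hasParams {h₁ h₂ : SequencedHypermap} {M hM₁ hM₂}
    (H : (split h₁ h₂ M hM₁ hM₂).toSeq.HasParams g t f e n D) :
    ∃ x : SplitTerm g t f e n D, SplitRel x (cls (split h₁ h₂ M hM₁ hM₂).toSeq) := by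
  obtain ⟨g₁, hg₁⟩ := exists_hasGenus h₁
  obtain ⟨g₂, hg₂⟩ := exists_hasGenus h₂
  have H₁ : h₁.HasParams _ _ _ _ _ _ := ⟨hg₁, rfl, rfl, rfl, rfl, rfl⟩
  have H₂ : h₂.HasParams _ _ _ _ _ _ := ⟨hg₂, rfl, rfl, rfl, rfl, rfl⟩
  obtain ⟨p1, p2, p3, p4, p5, hD⟩ :=
    hasParams_unique (hasParams_split (hM₁ := hM₁) (hM₂ := hM₂) H₁ H₂) H
  obtain ⟨S, hS⟩ := exists_hasPattern M (N := D.length) (by rw [← hD, List.length_map])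
  obtain ⟨hS₁, hS₂⟩ := map_filterMap_of_hasPattern hD hS
  rw [hM₁] at hS₁
  rw [hM₂] at hS₂
  rw [hS₁] at H₁
  rw [hS₂] at H₂
  exact ⟨⟨⟨g₁, g₂, h₁.numDarts, h₂.numDarts, h₁.numFaces, h₂.numFaces, h₁.numHyperedges,
    h₂.numHyperedges, h₁.rootVertex.ncard, h₂.rootVertex.ncard, S, by omega, by omega, by omega,
    by omega, by omega⟩,
    ⟨_, cls_mem_iff.2 H₁⟩, ⟨_, cls_mem_iff.2 H₂⟩⟩, h₁, h₂, M, hM₁, hM₂, rfl, rfl, hS, rfl⟩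

/-- An enumeration of the elements of a finite set. -/
noncomputable def enum {α : Type} [Finite α] (s : Set α) : Set.Icc (1 : ℤ) s.ncard ≃ s :=
  (Finite.card_eq.1 (by
    rw [Nat.card_coe_set_eq, Nat.card_coe_set_eq, ← Finset.coe_Icc, Set.ncard_coe_finset,
      Int.card_Icc]
    simp)).some

/-- The classes obtained from an element of the second term. -/
def HandleRel (x : HandleTerm g t f e n D) (c : SequencedHypermapClass) : Prop :=
  have := (rep x.2.1.1).finite_dart
  ∃ s l, ∃ (h : (rep x.2.1.1).marked = s :: l) (hi : (x.2.2 : ℤ) ∈ Set.Icc (1 : ℤ) s.ncard),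
    c = cls (handle (rep x.2.1.1) (enum s ⟨x.2.2, hi⟩) s l h (enum s ⟨x.2.2, hi⟩).2).toSeq

theorem HandleRel.hasKind {x : HandleTerm g t f e n D} {c} (h : HandleRel x c) : HasKind c 1 := by
  obtain ⟨s, l, h, hi, rfl⟩ := h
  exact Or.inr ⟨_, rfl, kind_handle⟩

theorem HandleRel.exists (x : HandleTerm g t f e n D) :
    ∃ c ∈ seqHypermaps g t f e n D, HandleRel x c := by
  obtain ⟨⟨p, hp⟩, c, ⟨i, hi⟩⟩ := x
  have H := hasParams_of_cls_eq (cls_rep c.1)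
  have := (rep c.1).finite_dart
  rcases hm : (rep c.1).marked with _ | ⟨s, l⟩
  · have := H.2.2.2.2.2
    rw [hm] at this
    simp at this
  · have hD := H.2.2.2.2.2
    rw [hm, List.map_cons, List.cons.injEq] at hD
    have hi' : i ∈ Set.Icc (1 : ℤ) s.ncard := ⟨hi.1, hi.2.trans_eq hD.1.symm⟩
    refine ⟨_, cls_mem_iff.2 (hasParams_handle_iff.2 ?_), s, l, hm, hi', rfl⟩
    rw [hD.1]
    exact H

/-- An arbitrary enumeration of a vertex is not compatible with isomorphisms, so `HandleRel` is tied
to the fixed representative `rep`; uniqueness is then immediate. -/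
theorem HandleRel.right_unique {x : HandleTerm g t f e n D} {c c'} (h : HandleRel x c)
    (h' : HandleRel x c') : c = c' := by
  obtain ⟨s, l, h, hi, rfl⟩ := h
  obtain ⟨s', l', h', hi', rfl⟩ := h'
  obtain ⟨rfl, rfl⟩ := List.cons.inj (h.symm.trans h')
  rfl

theorem HandleRel.left_unique {x y : HandleTerm g t f e n D} {c} (h : HandleRel x c)
    (h' : HandleRel y c) : x = y := by
  obtain ⟨⟨p, hp⟩, ⟨c₀, hc₀⟩, ⟨i, hi⟩⟩ := x
  obtain ⟨⟨p', hp'⟩, ⟨c₀', hc₀'⟩, ⟨i', hi'⟩⟩ := y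
  obtain ⟨s, l, h, hi₁, rfl⟩ := h
  obtain ⟨s', l', h', hi₁', hc⟩ := h'
  obtain ⟨φ, hφ, hw⟩ := handle_iso_iff.1 (cls_eq_iff.1 hc)
  have hcc : c₀ = c₀' := by
    rw [← cls_rep c₀, ← cls_rep c₀']
    exact cls_eq_iff.2 ⟨φ, hφ⟩
  subst hcc
  obtain ⟨rfl, rfl⟩ := List.cons.inj (h.symm.trans h')
  have hpp : p = p' := by
    have := (hasParams_unique (hasParams_of_cls_eq (c := ⟨c₀, hc₀⟩) (cls_rep c₀))
      (hasParams_of_cls_eq (c := ⟨c₀, hc₀'⟩) (cls_rep c₀))).2.2.2.2.2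
    exact (List.cons.inj this).1
  subst hpp
  -- By rigidity `φ` is the identity of the representative, so the two chosen darts, and hence their
  -- numbers, agree.
  have hii : i = i' := by
    have := (rep c₀).finite_dart
    have h1 := hw.trans (hφ.eq_refl _)
    have h2 := (enum s).injective (Subtype.ext h1)
    exact (congrArg Subtype.val h2).symm
  subst hii
  rfl

theorem HandleRel.of_hasParams {k : SequencedHypermap} {w : k.Dart} {s l h hw}
    (H : (handle k w s l h hw).toSeq.HasParams g t f e n D) :
    ∃ x : HandleTerm g t f e n D, HandleRel x (cls (handle k w s l h hw).toSeq) := by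
  have Hk := hasParams_handle_iff.1 H
  have := k.finite_dart
  have hpos : 0 < s.ncard := (Set.ncard_pos (Set.toFinite _)).2 ⟨w, hw⟩
  -- The root vertex of `k` is non-empty, so `n - 1 - p ≥ 1`: this is the upper bound `p ≤ n - 2`.
  have hroot := ncard_rootVertex_pos w
  obtain ⟨φ, hφ⟩ := cls_eq_iff.1 (cls_rep (cls k)).symm
  have := (rep (cls k)).finite_dart
  have hcard : (φ '' s).ncard = s.ncard := Set.ncard_image_of_injective _ φ.injective
  -- The number of `w` is read in the fixed representative, after transport along `φ`.
  have hi := ((enum (φ '' s)).symm ⟨φ w, Set.mem_image_of_mem _ hw⟩).2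
  have hi' := (⟨hi.1, hi.2.trans_eq (by rw [hcard])⟩ : _ ∈ Set.Icc (1 : ℤ) s.ncard)
  have hn := Hk.2.2.2.2.1
  refine ⟨⟨⟨s.ncard, by omega, by omega⟩, ⟨cls k, cls_mem_iff.2 Hk⟩,
    ⟨((enum (φ '' s)).symm ⟨φ w, Set.mem_image_of_mem _ hw⟩ : Set.Icc (1 : ℤ) _), hi'⟩⟩, ?_⟩
  refine ⟨φ '' s, l.map (fun s => φ '' s), ?_, hi, ?_⟩
  · rw [hφ.2.2.2, h]; rfl
  · refine cls_eq_iff.2 (handle_iso_iff.2 ⟨φ, hφ, ?_⟩)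
    simp

theorem IsoVia.iterate {h k : SequencedHypermap} {φ : h.Dart ≃ k.Dart} (hφ : IsoVia h k φ)
    (m : ℕ) (a : h.Dart) : φ ((⇑h.R⁻¹)^[m] a) = (⇑k.R⁻¹)^[m] (φ a) := by
  refine Function.Semiconj.iterate_right (f := φ) (fun a => ?_) m a
  rw [Perm.eq_inv_iff_eq, ← hφ.1]
  simp

/-- The classes obtained from an element of the third term. -/
def LinkRel (x : LinkTerm g t f e n D) (c : SequencedHypermapClass) : Prop :=
  ∃ k, cls k = x.2.1 ∧ ∃ a, ∃ (ha : k.root = some a),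
    c = cls (link k _ (iterate_mem_rootVertex ha n.toNat)).toSeq

theorem LinkRel.hasKind {x : LinkTerm g t f e n D} {c} (h : LinkRel x c) : HasKind c 2 := by
  obtain ⟨k, -, a, ha, rfl⟩ := h
  exact Or.inr ⟨_, rfl, kind_link⟩

/-- As `1 ≤ n ≤ p`, the dart `R⁻ⁿ` of the root is a place that cuts off a new root vertex of degree
exactly `n`. -/
theorem LinkRel.exists (hn : 1 ≤ n) (x : LinkTerm g t f e n D) :
    ∃ c ∈ seqHypermaps g t f e n D, LinkRel x c := by
  obtain ⟨⟨p, hp1, hp2⟩, c⟩ := x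
  have H := hasParams_of_cls_eq (cls_rep c.1)
  have hr := H.2.2.2.2.1
  dsimp only at hr
  obtain ⟨a, ha⟩ := exists_root_of_ncard_pos (h := rep c.1) (by omega)
  refine ⟨_, cls_mem_iff.2 ((hasParams_link_iff ha (m := n.toNat) (by omega) (by omega) rfl).2
    ⟨by omega, ?_⟩), rep c.1, cls_rep c.1, a, ha, rfl⟩
  rw [hr]
  exact H

theorem LinkRel.right_unique {x : LinkTerm g t f e n D} {c c'} (h : LinkRel x c)
    (h' : LinkRel x c') : c = c' := by
  obtain ⟨k, e₁, a, ha, rfl⟩ := h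
  obtain ⟨k', e₁', a', ha', rfl⟩ := h'
  obtain ⟨φ, hφ⟩ := cls_eq_iff.1 (e₁.trans e₁'.symm)
  refine cls_eq_iff.2 (link_iso_iff.2 ⟨φ, hφ, ?_⟩)
  have hr := hφ.2.2.1
  rw [ha, ha', Option.map_some, Option.some_inj] at hr
  rw [IsoVia.iterate hφ, hr]

theorem LinkRel.left_unique {x y : LinkTerm g t f e n D} {c} (h : LinkRel x c)
    (h' : LinkRel y c) : x = y := by
  obtain ⟨⟨p, hp⟩, c₀⟩ := x
  obtain ⟨⟨p', hp'⟩, c₀'⟩ := y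
  obtain ⟨k, e₁, a, ha, rfl⟩ := h
  obtain ⟨k', e₁', a', ha', hc⟩ := h'
  obtain ⟨φ, hφ, -⟩ := link_iso_iff.1 (cls_eq_iff.1 hc)
  have E : c₀.1 = c₀'.1 := e₁.symm.trans ((cls_eq_iff.2 ⟨φ, hφ⟩).trans e₁')
  have hpp : p = p' :=
    (hasParams_unique (hasParams_of_cls_eq e₁) (hasParams_of_cls_eq (e₁.trans E))).2.2.2.2.1
  subst hpp
  rw [Subtype.ext E]

theorem LinkRel.of_hasParams {k : SequencedHypermap} {w : k.Dart} {hw}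
    (H : (link k w hw).toSeq.HasParams g t f e n D) :
    ∃ x : LinkTerm g t f e n D, LinkRel x (cls (link k w hw).toSeq) := by
  obtain ⟨a, ha⟩ := Option.ne_none_iff_exists'.1 (root_ne_none_of_mem w)
  obtain ⟨m, h0, hm, rfl⟩ := exists_iterate_of_mem_rootVertex ha hw
  obtain ⟨rfl, Hk⟩ := (hasParams_link_iff ha h0 hm rfl).1 H
  have h1 := ncard_rootVertex_le (h := k)
  have h2 := Hk.2.1
  exact ⟨⟨⟨k.rootVertex.ncard, by omega, by omega⟩, ⟨cls k, cls_mem_iff.2 Hk⟩⟩, k, rfl, a, ha, rfl⟩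

/-- The classes obtained from an element of the fourth term. -/
def MarkedLinkRel (x : MarkedLinkTerm g t f e n D) (c : SequencedHypermapClass) : Prop :=
  ∃ k, cls k = x.2.1 ∧ ∃ a, ∃ (ha : k.root = some a) (hj : (x.1 : ℕ) ≤ k.marked.length),
    c = cls (markedLink k _ (iterate_mem_rootVertex ha n.toNat) x.1 hj).toSeq

theorem MarkedLinkRel.hasKind {x : MarkedLinkTerm g t f e n D} {c} (h : MarkedLinkRel x c) :
    HasKind c 3 := by
  obtain ⟨k, -, a, ha, hj, rfl⟩ := h
  exact Or.inr ⟨_, rfl, kind_markedLink⟩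

/-- From `d_j ≥ 1` the root vertex of degree `d_j + n - 1` has at least `n` darts; cutting off a
root vertex of degree `n`, which includes the new root, leaves a vertex of degree `d_j`. -/
theorem MarkedLinkRel.exists (hD : ∀ d ∈ D, 1 ≤ d) (hn : 1 ≤ n) (x : MarkedLinkTerm g t f e n D) :
    ∃ c ∈ seqHypermaps g t f e n D, MarkedLinkRel x c := by
  obtain ⟨j, c⟩ := x
  have H := hasParams_of_cls_eq (cls_rep c.1)
  have hr := H.2.2.2.2.1
  have hd := hD _ (List.get_mem D j)
  obtain ⟨a, ha⟩ := exists_root_of_ncard_pos (h := rep c.1) (by omega)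
  have hj : (j : ℕ) ≤ (rep c.1).marked.length := by
    have := congrArg List.length H.2.2.2.2.2
    rw [List.length_map, List.length_eraseIdx, if_pos j.2] at this
    omega
  refine ⟨_, cls_mem_iff.2 ((hasParams_markedLink_iff (hj := hj) ha (m := n.toNat) (by omega)
    (by omega) rfl).2 ⟨by omega, ?_, ?_⟩), rep c.1, cls_rep c.1, a, ha, hj, rfl⟩
  · rw [List.getElem?_eq_getElem j.2, Option.some_inj, hr, List.get_eq_getElem]
    omega
  · rw [hr]
    exact H

theorem MarkedLinkRel.right_unique {x : MarkedLinkTerm g t f e n D} {c c'}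
    (h : MarkedLinkRel x c) (h' : MarkedLinkRel x c') : c = c' := by
  obtain ⟨k, e₁, a, ha, hj, rfl⟩ := h
  obtain ⟨k', e₁', a', ha', hj', rfl⟩ := h'
  obtain ⟨φ, hφ⟩ := cls_eq_iff.1 (e₁.trans e₁'.symm)
  refine cls_eq_iff.2 (markedLink_iso_iff.2 ⟨φ, hφ, ?_, rfl⟩)
  have hr := hφ.2.2.1
  rw [ha, ha', Option.map_some, Option.some_inj] at hr
  rw [IsoVia.iterate hφ, hr]

theorem MarkedLinkRel.left_unique {x y : MarkedLinkTerm g t f e n D} {c}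
    (h : MarkedLinkRel x c) (h' : MarkedLinkRel y c) : x = y := by
  obtain ⟨j, c₀⟩ := x
  obtain ⟨j', c₀'⟩ := y
  obtain ⟨k, e₁, a, ha, hj, rfl⟩ := h
  obtain ⟨k', e₁', a', ha', hj', hc⟩ := h'
  obtain ⟨φ, hφ, -, hjj⟩ := markedLink_iso_iff.1 (cls_eq_iff.1 hc)
  have E : c₀.1 = c₀'.1 := e₁.symm.trans ((cls_eq_iff.2 ⟨φ, hφ⟩).trans e₁')
  have hjj' : j = j' := Fin.ext hjj
  subst hjj'
  rw [Subtype.ext E]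

theorem MarkedLinkRel.of_hasParams {k : SequencedHypermap} {w : k.Dart} {hw j hj}
    (H : (markedLink k w hw j hj).toSeq.HasParams g t f e n D) :
    ∃ x : MarkedLinkTerm g t f e n D, MarkedLinkRel x (cls (markedLink k w hw j hj).toSeq) := by
  obtain ⟨a, ha⟩ := Option.ne_none_iff_exists'.1 (root_ne_none_of_mem w)
  obtain ⟨m, h0, hm, rfl⟩ := exists_iterate_of_mem_rootVertex ha hw
  obtain ⟨rfl, hjD, Hk⟩ := (hasParams_markedLink_iff ha h0 hm rfl).1 H
  obtain ⟨hj', hd⟩ := List.getElem?_eq_some_iff.1 hjD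
  have hp : (k.rootVertex.ncard : ℤ) = D.get ⟨j, hj'⟩ + m - 1 := by
    rw [List.get_eq_getElem]
    change _ = D[j] + _ - 1
    omega
  rw [hp] at Hk
  exact ⟨⟨⟨j, hj'⟩, ⟨cls k, cls_mem_iff.2 Hk⟩⟩, k, rfl, a, ha, hj, rfl⟩

end Relations

/-! ### Assembly of the bijection. -/

theorem nonempty_equiv_of_rel {T : Type 1} {C : Type 1} {s : Set C} (r : T → C → Prop)
    (h₁ : ∀ x, ∃ c ∈ s, r x c) (h₂ : ∀ c ∈ s, ∃ x, r x c)
    (h₃ : ∀ x c c', r x c → r x c' → c = c') (h₄ : ∀ x y c, r x c → r y c → x = y) :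
    Nonempty (s ≃ T) := by
  choose F hF hr using h₁
  refine ⟨(Equiv.ofBijective (fun x => (⟨F x, hF x⟩ : s)) ⟨fun x y hxy => ?_, fun c => ?_⟩).symm⟩
  · have hxy' : F x = F y := congrArg Subtype.val hxy
    exact h₄ x y _ (hr x) (hxy' ▸ hr y)
  · obtain ⟨x, hx⟩ := h₂ c.1 c.2
    exact ⟨x, Subtype.ext (h₃ x _ _ (hr x) hx)⟩

theorem iso_empty_of_root_eq_none {h : SequencedHypermap} (hr : h.root = none) :
    SequencedHypermap.Iso h SequencedHypermap.empty := by
  have he := h.root_eq_none hr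
  have hm : h.marked = [] := by
    refine List.eq_nil_iff_forall_not_mem.2 fun s hs => ?_
    obtain ⟨a, -⟩ := nonempty_of_mem_permOrbits (h.marked_vertex s hs)
    exact isEmptyElim a
  refine ⟨Equiv.equivOfIsEmpty h.Dart Empty, fun a => isEmptyElim a, fun a => isEmptyElim a, ?_, ?_⟩
  · rw [hr]; rfl
  · rw [hm]; rfl

theorem hasParams_empty : SequencedHypermap.empty.HasParams 0 0 1 0 0 [] := by
  have : IsEmpty SequencedHypermap.empty.Dart := inferInstanceAs (IsEmpty Empty)
  have h1 : SequencedHypermap.empty.numVertices = 1 := numVertices_of_isEmpty _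
  have h2 : SequencedHypermap.empty.numFaces = 1 := numFaces_of_isEmpty _
  have h3 : SequencedHypermap.empty.numHyperedges = 0 := numOrbits_of_isEmpty _
  have h4 : SequencedHypermap.empty.numDarts = 0 := Nat.card_of_isEmpty
  have h5 : SequencedHypermap.empty.rootVertex = ∅ := Set.eq_empty_of_isEmpty _
  refine ⟨?_, ?_, ?_, ?_, ?_, rfl⟩
  · rw [Hypermap.HasGenus, h1, h2, h3, h4]; norm_num
  · rw [h4]; rfl
  · rw [h2]; rfl
  · rw [h3]; rfl
  · rw [h5, Set.ncard_empty]; rfl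

section Main
variable {g t f e n : ℤ} {D : List ℤ}

/-- A hypermap with `t - 1` darts forces `t ≥ 1`, which rules out the alternative `t = 0`. -/
theorem one_le_of_seqHypermaps {g' f' e' n' : ℤ} {D' : List ℤ} (hn : 1 ≤ n ∨ t = 0)
    (c : seqHypermaps g' (t - 1) f' e' n' D') : 1 ≤ n := by
  have h1 := (hasParams_of_cls_eq (cls_rep c.1)).2.1
  omega

/-- The correspondence between the disjoint union and the classes of sequenced hypermaps. -/
def DecompositionRel : SplitTerm g t f e n D ⊕ HandleTerm g t f e n D ⊕ LinkTerm g t f e n D ⊕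
    MarkedLinkTerm g t f e n D ⊕ deltaSet ((g, t, f, e, n, D) = (0, 0, 1, 0, 0, [])) →
      SequencedHypermapClass → Prop :=
  Sum.elim SplitRel (Sum.elim HandleRel (Sum.elim LinkRel (Sum.elim MarkedLinkRel
    fun x c => c = x.1)))

end Main

end HypermapDecomposition

open HypermapDecomposition

theorem mainTheorem3 (g t f e n : ℤ) (D : List ℤ)
    (hD : ∀ d ∈ D, 1 ≤ d) (hn : 1 ≤ n ∨ t = 0) :
    Nonempty
      (seqHypermaps g t f e n D ≃
        SplitTerm g t f e n D ⊕ HandleTerm g t f e n D ⊕ LinkTerm g t f e n D ⊕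
          MarkedLinkTerm g t f e n D ⊕
            deltaSet ((g, t, f, e, n, D) = (0, 0, 1, 0, 0, []))) := by
  -- Each summand produces classes of one kind only, and a class has a single kind; hence elements
  -- of different summands are never related to the same class.
  have hkind : ∀ x c, DecompositionRel (g := g) (t := t) (f := f) (e := e) (n := n) (D := D) x c →
      HasKind c (Sum.elim (fun _ => 0) (Sum.elim (fun _ => 1) (Sum.elim (fun _ => 2)
        (Sum.elim (fun _ => 3) (fun _ => 4)))) x) := by
    rintro (x | x | x | x | x) c h
    · exact SplitRel.hasKind h
    · exact HandleRel.hasKind h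
    · exact LinkRel.hasKind h
    · exact MarkedLinkRel.hasKind h
    · exact Or.inl ⟨rfl, Eq.trans h x.2.2⟩
  refine nonempty_equiv_of_rel DecompositionRel ?_ ?_ ?_ ?_
  · rintro (x | x | x | x | x)
    · exact SplitRel.exists x
    · exact HandleRel.exists x
    · exact LinkRel.exists (one_le_of_seqHypermaps hn x.2) x
    · exact MarkedLinkRel.exists hD (one_le_of_seqHypermaps hn x.2) x
    · refine ⟨x.1, ?_, rfl⟩
      obtain ⟨c, h, rfl⟩ := x
      simp only [Prod.mk.injEq] at h
      obtain ⟨rfl, rfl, rfl, rfl, rfl, rfl⟩ := h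
      exact cls_mem_iff.2 hasParams_empty
  · rintro _ ⟨h, H, rfl⟩
    by_cases hr : h.root = none
    · have hiso := iso_empty_of_root_eq_none hr
      obtain ⟨rfl, rfl, rfl, rfl, rfl, rfl⟩ :=
        hasParams_unique ((hasParams_iff_of_iso hiso).1 H) hasParams_empty
      exact ⟨Sum.inr (Sum.inr (Sum.inr (Sum.inr ⟨_, rfl, rfl⟩))), cls_eq_iff.2 hiso⟩
    · obtain ⟨E, hE⟩ := Extension.exists_iso_toSeq h hr
      rcases E.exists_decomposition with ⟨h₁, h₂, M, hM₁, hM₂, H'⟩ | ⟨k, w, hw, H'⟩ |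
        ⟨k, w, hw, j, hj, H'⟩ | ⟨k, w, s, l, hk, hw, H'⟩
      all_goals
        replace H' := H'.trans hE
        have HP := (hasParams_iff_of_iso H').2 H
        have hcls := cls_eq_iff.2 H'
        change ∃ x, DecompositionRel x (cls h)
        rw [← hcls]
      · obtain ⟨x, hx⟩ := SplitRel.of_hasParams HP
        exact ⟨Sum.inl x, hx⟩
      · obtain ⟨x, hx⟩ := LinkRel.of_hasParams HP
        exact ⟨Sum.inr (Sum.inr (Sum.inl x)), hx⟩
      · obtain ⟨x, hx⟩ := MarkedLinkRel.of_hasParams HP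
        exact ⟨Sum.inr (Sum.inr (Sum.inr (Sum.inl x))), hx⟩
      · obtain ⟨x, hx⟩ := HandleRel.of_hasParams HP
        exact ⟨Sum.inr (Sum.inl x), hx⟩
  · rintro (x | x | x | x | x) c c' h h'
    · exact SplitRel.right_unique h h'
    · exact HandleRel.right_unique h h'
    · exact LinkRel.right_unique h h'
    · exact MarkedLinkRel.right_unique h h'
    · exact Eq.trans h (Eq.symm h')
  · intro x y c h h'
    have hk := (hkind x c h).unique (hkind y c h')
    rcases x with x | x | x | x | x <;> rcases y with y | y | y | y | y
    case inl.inl => rw [SplitRel.left_unique h h']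
    case inr.inl.inr.inl => rw [HandleRel.left_unique h h']
    case inr.inr.inl.inr.inr.inl => rw [LinkRel.left_unique h h']
    case inr.inr.inr.inl.inr.inr.inr.inl => rw [MarkedLinkRel.left_unique h h']
    case inr.inr.inr.inr.inr.inr.inr.inr => rw [Subtype.ext (Eq.trans (Eq.symm h) h')]
    all_goals simp at hk
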